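/- Let $D\subset\mathbb R^2$ be open, let $f:D\to\mathbb R$ be smooth with $0$ as a regular value, let $\Sigma=f^{-1}(0)$, and let $X,Y$ be vector fields of class $C^r$ on $D$, $1\le r\le\infty$. Let $Z=(X,Y)$ be the nonsmooth vector field equal to $X$ where $f\ge 0$ and to $Y$ where $f\le 0$, with trajectories in the sense of Filippov. Write $X.f=\langle\nabla f,X\rangle$ and $X^2.f=X.(X.f)$. Let $\Sigma_e=\{q\in\Sigma: X.f(q)>0>Y.f(q)\}$ and $\Sigma_s=\{q\in\Sigma: X.f(q)<0<Y.f(q)\}$. On $\Sigma_e\cup\Sigma_s$ let $Z^\Sigma$ be the convex combination of $X$ and $Y$ that is tangent to $\Sigma$. Suppose that $Z\in\Omega_2$, with singularity $p\in\Sigma$, that is: - $p$ is a $\Sigma$-fold point of $X$: $X.f(p)=0$ and $X^2.f(p)\ne 0$ (visible if $X^2.f(p)>0$, invisible if $X^2.f(p)<0$); - $p$ is a boundary saddle of $Y$: $Y(p)=0$, the linear map $DY(p)$ has one negative and one positive eigenvalue, and its eigenspaces are transverse to $\Sigma$ at $p$. For $\tau\in\{inv,vis\}$ and $\rho_1,k_1\in\{1,-1\}$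 let $Z^\tau$ be the piecewise-linear nonsmooth vector field on $\mathbb R^2$, with $f(x,y)=y$, $$Z^\tau=\begin{cases}X^\tau=(\rho_1,\ \alpha_1(\tau)\,x) & \text{if } y\ge 0,\\ (k_1y,\ k_1x) & \text{if } y\le 0,\end{cases}\qquad \alpha_1(inv)=-1,\ \alpha_1(vis)=1.$$ Then there are $\tau\in\{inv,vis\}$ and $\rho_1,k_1\in\{1,-1\}$ such that the origin is a visible fold point of $X^\tau$ if and only if $p$ is a visible fold point of $X$, and such that $Z$ near $p$ is $\Sigma$-equivalent to $Z^\tau$ near the origin. The latter means that there is an orientation preserving homeomorphism $h$ from an open neighbourhood $U\subset D$ of $p$ onto an open neighbourhood $\tilde U$ of the origin, with $h(p)=0$, which sends $\Sigma\cap U$ onto $\{y=0\}\cap\tilde U$, sends the oriented orbits of $Z$ in $U$ onto the oriented orbits of $Z^\tau$ in $\tilde U$, and sends the oriented orbits of the sliding vector field $Z^\Sigma$ in $U$ onto those of the sliding vector field of $Z^\tau$ in $\tilde U$. -/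

import Mathlib

open Set Filter Topology MeasureTheory
open scoped ContDiff

namespace Filippov

/-- The plane. (Its topology and smooth structure are the usual ones; no metric notion is used.) -/
abbrev Plane : Type := ℝ × ℝ

/-- The Lie derivative `X.f (p) = ⟨∇ f (p), X (p)⟩`. -/
noncomputable def lieD (X : Plane → Plane) (f : Plane → ℝ) (p : Plane) : ℝ :=
  fderiv ℝ f p (X p)

/-- A nonsmooth vector field `Z = (X, Y)` of class `C^r` on an open region `D` of the plane, with
switching manifold the zero set of a smooth function `f` having `0` as a regular value:
`Z = X` where `f ≥ 0` and `Z = Y` where `f ≤ 0`. -/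
structure NSVF (r : ℕ∞) where
  D : Set Plane
  isOpen_D : IsOpen D
  f : Plane → ℝ
  smooth_f : ContDiffOn ℝ ∞ f D
  regular_f : ∀ p ∈ D, f p = 0 → fderiv ℝ f p ≠ 0
  X : Plane → Plane
  Y : Plane → Plane
  smooth_X : ContDiffOn ℝ r X D
  smooth_Y : ContDiffOn ℝ r Y D

namespace NSVF

variable {r : ℕ∞}

/-- The switching manifold `Σ`. -/
def switching (Z : NSVF r) : Set Plane := {p | p ∈ Z.D ∧ Z.f p = 0}

/-- The escaping region `Σ_e`. -/
def escaping (Z : NSVF r) : Set Plane :=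
  {p | p ∈ Z.switching ∧ 0 < lieD Z.X Z.f p ∧ lieD Z.Y Z.f p < 0}

/-- The sliding region `Σ_s`. -/
def sliding (Z : NSVF r) : Set Plane :=
  {p | p ∈ Z.switching ∧ lieD Z.X Z.f p < 0 ∧ 0 < lieD Z.Y Z.f p}

/-- The sliding vector field `Z^Σ`: on `Σ_e ∪ Σ_s` (where `X.f` and `Y.f` have opposite signs), the
convex combination of `X p` and `Y p` that is tangent to `Σ`. -/
noncomputable def slidingField (Z : NSVF r) (p : Plane) : Plane :=
  (lieD Z.Y Z.f p - lieD Z.X Z.f p)⁻¹ •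
    (lieD Z.Y Z.f p • Z.X p - lieD Z.X Z.f p • Z.Y p)

/-- The values at `p` of the multivalued vector field given by Filippov's convention. -/
def filippovSet (Z : NSVF r) (p : Plane) : Set Plane :=
  {v | (0 < Z.f p ∧ v = Z.X p) ∨ (Z.f p < 0 ∧ v = Z.Y p) ∨
    (Z.f p = 0 ∧ v ∈ segment ℝ (Z.X p) (Z.Y p))}

/-- `γ`, restricted to the interval `I`, is a trajectory of `Z` inside `U`: an absolutely continuous
solution, in the sense of Filippov, of `q' = Z(q)`. -/
def IsTrajectory (Z : NSVF r) (U : Set Plane) (I : Set ℝ) (γ : ℝ → Plane) : Prop :=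
  I.OrdConnected ∧ MapsTo γ I U ∧
    (∀ a ∈ I, ∀ b ∈ I, AbsolutelyContinuousOnInterval γ a b) ∧
    ∀ᵐ t : ℝ, t ∈ I → ∃ v ∈ Z.filippovSet (γ t), HasDerivAt γ v t

/-- `γ`, restricted to the interval `I`, is a trajectory of `Z^Σ` inside `U`. -/
def IsSlidingTrajectory (Z : NSVF r) (U : Set Plane) (I : Set ℝ) (γ : ℝ → Plane) : Prop :=
  I.OrdConnected ∧ MapsTo γ I U ∧ MapsTo γ I (Z.escaping ∪ Z.sliding) ∧
    ∀ t ∈ I, HasDerivWithinAt γ (Z.slidingField (γ t)) I t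

end NSVF

/-- `p` is a `Σ`-fold point of `X`, where `Σ = {f = 0}`. -/
def IsFold (X : Plane → Plane) (f : Plane → ℝ) (p : Plane) : Prop :=
  f p = 0 ∧ lieD X f p = 0 ∧ lieD X (lieD X f) p ≠ 0

/-- `p` is a visible `Σ`-fold point of `X`. -/
def IsVisibleFold (X : Plane → Plane) (f : Plane → ℝ) (p : Plane) : Prop :=
  f p = 0 ∧ lieD X f p = 0 ∧ 0 < lieD X (lieD X f) p

/-- `p` is a boundary saddle of `Y`: a hyperbolic saddle equilibrium of `Y` lying on
`Σ = {f = 0}`, the eigenspaces of `DY(p)` being transverse to `Σ` at `p`. -/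
def IsBoundarySaddle (Y : Plane → Plane) (f : Plane → ℝ) (p : Plane) : Prop :=
  f p = 0 ∧ Y p = 0 ∧
    (∃ a b : ℝ, a < 0 ∧ 0 < b ∧
      Module.End.HasEigenvalue (fderiv ℝ Y p : Plane →ₗ[ℝ] Plane) a ∧
      Module.End.HasEigenvalue (fderiv ℝ Y p : Plane →ₗ[ℝ] Plane) b) ∧
    ∀ (c : ℝ) (v : Plane),
      Module.End.HasEigenvector (fderiv ℝ Y p : Plane →ₗ[ℝ] Plane) c v → fderiv ℝ f p v ≠ 0

/-- `Z` belongs to the codimension-two set `Ω₂`, with fold-saddle singularity `p`: the `Σ`-fold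
point of `X` coincides with the boundary saddle of `Y`. -/
def IsFoldSaddle {r : ℕ∞} (Z : NSVF r) (p : Plane) : Prop :=
  p ∈ Z.D ∧ IsFold Z.X Z.f p ∧ IsBoundarySaddle Z.Y Z.f p

/-- The local map `h` preserves the orientation of the plane at `q`: the images of all small
positively oriented circles around `q` have winding number `1` around `h q`. -/
def PreservesOrientationAt (h : Plane → Plane) (q : Plane) : Prop :=
  ∃ ε : ℝ, 0 < ε ∧ ∀ s : ℝ, 0 < s → s < ε →
    ∃ ρ φ : ℝ → ℝ, Continuous φ ∧ (∀ t, φ (t + 2 * Real.pi) = φ t + 2 * Real.pi) ∧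
      ∀ t, 0 < ρ t ∧
        h (q + s • (Real.cos t, Real.sin t)) - h q = ρ t • (Real.cos (φ t), Real.sin (φ t))

/-- `h` sends the oriented orbits described by the solution predicate `P` to oriented orbits
described by `Q`: the image of each solution of the first kind becomes, after an increasing change
of time, a solution of the second kind. -/
def MapsOrbits (P Q : Set ℝ → (ℝ → Plane) → Prop) (h : Plane → Plane) : Prop :=
  ∀ (I : Set ℝ) (γ : ℝ → Plane), P I γ →
    ∃ (J : Set ℝ) (σ : ℝ → ℝ), StrictMonoOn σ J ∧ σ '' J = I ∧ Q J (h ∘ γ ∘ σ)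

/-- `Z` near `p` and `W` near `q` are `Σ`-equivalent: there is an orientation preserving
homeomorphism `h` from an open neighbourhood `U` of `p` onto an open neighbourhood `V` of `q`, with
`h p = q`, that sends `Σ` to `Σ`, the orbits of `Z` in `U` onto those of `W` in `V`, and the orbits
of `Z^Σ` in `U` onto those of `W^Σ` in `V`. -/
def SigmaEquivalentAt {r s : ℕ∞} (Z : NSVF r) (p : Plane) (W : NSVF s) (q : Plane) : Prop :=
  ∃ h : OpenPartialHomeomorph Plane Plane,
    h.source ⊆ Z.D ∧ h.target ⊆ W.D ∧ p ∈ h.source ∧ h p = q ∧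
    (∀ x ∈ h.source, PreservesOrientationAt h x) ∧
    h '' (h.source ∩ Z.switching) = h.target ∩ W.switching ∧
    MapsOrbits (Z.IsTrajectory h.source) (W.IsTrajectory h.target) h ∧
    MapsOrbits (W.IsTrajectory h.target) (Z.IsTrajectory h.source) h.symm ∧
    MapsOrbits (Z.IsSlidingTrajectory h.source) (W.IsSlidingTrajectory h.target) h ∧
    MapsOrbits (W.IsSlidingTrajectory h.target) (Z.IsSlidingTrajectory h.source) h.symm

/-- The label `τ ∈ {inv, vis}` of the model. -/
inductive Kind : Type
  | inv : Kind
  | vis : Kind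

/-- `α₁(inv) = -1`, `α₁(vis) = 1`. -/
def alpha₁ : Kind → ℝ
  | Kind.inv => -1
  | Kind.vis => 1

/-- The piecewise-linear model `Z^τ`: `X^τ = (ρ₁, α₁(τ) x)` for `y ≥ 0` and `Y = (k₁ y, k₁ x)` for
`y ≤ 0`, on the whole plane. -/
def model (r : ℕ∞) (τ : Kind) (ρ₁ k₁ : ℝ) : NSVF r where
  D := univ
  isOpen_D := isOpen_univ
  f := Prod.snd
  smooth_f := contDiff_snd.contDiffOn
  regular_f := by
    intro p _ _ h
    have h1 := congrArg (fun L : Plane →L[ℝ] ℝ => L (0, 1)) h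
    simp [fderiv_snd] at h1
  X := fun p => (ρ₁, alpha₁ τ * p.1)
  Y := fun p => (k₁ * p.2, k₁ * p.1)
  smooth_X := by fun_prop
  smooth_Y := by fun_prop

end Filippov

open scoped NNReal


/-! Use coordinates (ξ - ξ(p), f) with a suitable linear form ξ. For some signs ρ, k, the field ρX
becomes a field U that moves to the right and has a fold at 0 on the line y = 0, and kY becomes a
field V for which (V₂, V₁) is strongly monotone. Truncation extends both to globally Lipschitz
fields with the same properties (`exists_straightens`, `exists_foldSaddle`). The only discrete datum
of the resulting `FoldSaddle` is δ, the sign of X².f(p). The models are the case U = (1, δx), V =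
(y, x), with α₁(τ) = ρδ. It remains to match two normal forms with the same δ, for common ρ and k.

Each normal form has a homeomorphism `chart` of the plane that straightens its orbits. For y ≥ 0,
let H(z) be the height at which the U-orbit of z crosses x = 0, and m(x) = -δ H(x, 0). This m grows
strictly from 0 to infinity on both sides of 0, and s(x) is the square root of m(x) with the sign of
x. The chart (s(x), H(z) - H(x, 0)) turns U-orbits into the curves y - δx² = const. For y ≤ 0, the
product xy increases strictly along V-orbits, so a nonzero orbit meets the coordinate axes at most
once. The first integral G is the value of x² - y² at that meeting, and 0 on separatrices. In each
lower quadrant the chart keeps xy and replaces x² - y² by a function ψ of G, chosen so that the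
pieces agree on the axes. The main points are that G is continuous (`G_continuous`) and that its
levels in a quadrant are single orbits (`exists_time_of_G_eq`), which rests on the uniqueness of the
separatrix in each lower quadrant (`separatrix_unique`). The conjugacy `conj` compares two charts.

Uniqueness fails for Filippov trajectories, so each one is followed individually. Below the axis
k·xy increases, hence the times with y ≥ 0 form an interval. Almost everywhere on that interval the
velocity at a point of the axis is tangent to it, and tangent velocities never point against ρ. Away
from the origin they exist only if ρδ = -k, which is the case with sliding. A trajectory is thereby
cut into finitely many pieces: arcs in a lower quadrant, rest at the origin, sliding arcs and upper
arcs. The conjugacy sends each piece to a reparametrised piece of the same kind, and these are glued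
(`Traj.reparam`).

For the orientation, the conjugacy reverses no direction on the upper half plane. Hence the image of
one small circle there has winding number one, and this propagates to all circles in a convex domain
by a homotopy of circles. -/

namespace Filippov

/-! ### Flows of globally Lipschitz plane fields -/

/-- Coordinatewise truncation of the plane to a square. -/
def clampSq (R : ℝ) (z : Plane) : Plane := (max (-R) (min R z.1), max (-R) (min R z.2))

lemma clampSq_lipschitz (R : ℝ) : LipschitzWith 1 (clampSq R) := by
  have h : LipschitzWith 1 (fun x : ℝ => max (-R) (min R x)) :=
    (LipschitzWith.id.const_min R).const_max (-R)
  have h1 : LipschitzWith 1 (fun z : Plane => max (-R) (min R z.1)) := by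
    rw [← one_mul (1 : ℝ≥0)]; exact h.comp LipschitzWith.prod_fst
  have h2 : LipschitzWith 1 (fun z : Plane => max (-R) (min R z.2)) := by
    rw [← one_mul (1 : ℝ≥0)]; exact h.comp LipschitzWith.prod_snd
  rw [← max_self (1 : ℝ≥0)]; exact h1.prodMk h2

lemma clampSq_of_norm_le {R : ℝ} {z : Plane} (h : ‖z‖ ≤ R) : clampSq R z = z := by
  have h1 := abs_le.1 ((norm_fst_le z).trans h)
  have h2 := abs_le.1 ((norm_snd_le z).trans h)
  ext <;> simp [clampSq, *]

lemma norm_clampSq_le {R : ℝ} (hR : 0 ≤ R) (z : Plane) : ‖clampSq R z‖ ≤ min R ‖z‖ := by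
  have key : ∀ x : ℝ, |max (-R) (min R x)| ≤ min R |x| := by
    intro x
    rw [abs_le]
    have h1 := neg_abs_le x
    have h2 := le_abs_self x
    have h3 := abs_nonneg x
    refine ⟨?_, max_le (by linarith [le_min hR h3]) ?_⟩
    · rcases le_total R |x| with h | h
      · rw [min_eq_left h]; exact le_max_left _ _
      · rw [min_eq_right h]
        exact le_max_of_le_right (le_min (by linarith) (by linarith))
    · exact min_le_min le_rfl (le_abs_self x)
  rw [Prod.norm_def]
  refine max_le ((key z.1).trans (min_le_min le_rfl (norm_fst_le z)))
    ((key z.2).trans (min_le_min le_rfl (norm_snd_le z)))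

lemma hasDerivAt_comp_affine {E : Type*} [NormedAddCommGroup E] [NormedSpace ℝ E] {γ : ℝ → E}
    {v : E} (a b : ℝ) {t : ℝ} (h : HasDerivAt γ v (a * t + b)) :
    HasDerivAt (fun s => γ (a * s + b)) (a • v) t := by
  simpa [Function.comp_def] using h.scomp t (((hasDerivAt_id t).const_mul a).add_const b)

/-- Truncating the argument of `V` makes the field bounded, so Picard–Lindelöf reaches all of [-T,
T]. The size `R` of the square is the Grönwall bound for a field growing like `V`, so the solution
never leaves the square and also solves the original equation. -/
lemma exists_solution_Icc {K : ℝ≥0} {V : Plane → Plane} (hV : LipschitzWith K V) (x : Plane)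
    {T : ℝ} (hT : 0 < T) :
    ∃ γ : ℝ → Plane, γ 0 = x ∧ ∀ t ∈ Ioo (-T) T, HasDerivAt γ (V (γ t)) t := by
  set R : ℝ := gronwallBound ‖x‖ K ‖V 0‖ T with hR
  have hR0 : 0 ≤ R := by
    have := gronwallBound_mono (norm_nonneg x) (norm_nonneg (V 0)) K.2 hT.le
    rw [gronwallBound_x0] at this
    exact (norm_nonneg x).trans this
  have hVn : ∀ z, ‖V z‖ ≤ K * ‖z‖ + ‖V 0‖ := by
    intro z
    have := hV.dist_le_mul z 0
    rw [dist_zero_right, dist_eq_norm] at this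
    calc ‖V z‖ = ‖(V z - V 0) + V 0‖ := by simp
      _ ≤ _ := (norm_add_le _ _).trans (by linarith)
  have hLip : LipschitzWith K (V ∘ clampSq R) := by simpa using hV.comp (clampSq_lipschitz R)
  obtain ⟨R', hR'⟩ : ∃ R' : ℝ≥0, (R' : ℝ) = R := ⟨⟨R, hR0⟩, rfl⟩
  obtain ⟨T', hT'⟩ : ∃ T' : ℝ≥0, (T' : ℝ) = T := ⟨⟨T, hT.le⟩, rfl⟩
  set L : ℝ≥0 := K * R' + ‖V 0‖₊ with hL
  have hb : ∀ z, ‖(V ∘ clampSq R) z‖ ≤ L := by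
    intro z
    refine (hVn _).trans ?_
    have := (norm_clampSq_le hR0 z).trans (min_le_left _ _)
    simp only [hL, NNReal.coe_add, NNReal.coe_mul, coe_nnnorm, hR']
    gcongr
  have h0 : (0 : ℝ) ∈ Icc (-T) T := ⟨by linarith, hT.le⟩
  have pl : IsPicardLindelof (fun _ => V ∘ clampSq R) (⟨0, h0⟩ : Icc (-T) T) x
      (L * T') 0 L K := by
    refine IsPicardLindelof.of_time_independent (fun z _ => hb z) hLip.lipschitzOnWith ?_
    simp [hT']
  obtain ⟨γ, hγ0, hγ⟩ := pl.exists_eq_forall_mem_Icc_hasDerivWithinAt₀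
  refine ⟨γ, hγ0, ?_⟩
  have hd : ∀ t ∈ Ioo (-T) T, HasDerivAt γ (V (clampSq R (γ t))) t := fun t ht =>
    (hγ t (Ioo_subset_Icc_self ht)).hasDerivAt (Icc_mem_nhds ht.1 ht.2)
  have hc : ContinuousOn γ (Icc (-T) T) := fun t ht => (hγ t ht).continuousWithinAt
  have hbd : ∀ t ∈ Icc 0 T, ‖γ t‖ ≤ R ∧ ‖γ (-t)‖ ≤ R := by
    have aux : ∀ g : ℝ → Plane, ‖g 0‖ = ‖x‖ → ContinuousOn g (Icc 0 T) →
        (∀ t ∈ Ico 0 T, ∃ g', ‖g'‖ ≤ K * ‖g t‖ + ‖V 0‖ ∧ HasDerivWithinAt g g' (Ici t) t) →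
        ∀ t ∈ Icc 0 T, ‖g t‖ ≤ R := by
      intro g hg0 hgc hg t ht
      choose! g' hg'1 hg'2 using hg
      refine (norm_le_gronwallBound_of_norm_deriv_right_le hgc hg'2 hg0.le
        (fun t ht => hg'1 t ht) t ht).trans ?_
      exact gronwallBound_mono (norm_nonneg x) (norm_nonneg (V 0)) K.2 (by linarith [ht.2])
    have hKn : ∀ z, ‖V (clampSq R z)‖ ≤ K * ‖z‖ + ‖V 0‖ := fun z => (hVn _).trans (by
      have := (norm_clampSq_le hR0 z).trans (min_le_right _ _)
      gcongr)
    intro t ht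
    refine ⟨aux γ (by rw [hγ0]) (hc.mono (Icc_subset_Icc (by linarith) le_rfl)) ?_ t ht,
      aux (fun t => γ (-t)) (by simp [hγ0]) (hc.comp continuousOn_neg ?_) ?_ t ht⟩
    · intro s hs
      exact ⟨_, hKn _, (hd s ⟨by linarith [hs.1], hs.2⟩).hasDerivWithinAt⟩
    · intro s hs; exact ⟨by linarith [hs.2], by linarith [hs.1]⟩
    · intro s hs
      refine ⟨-V (clampSq R (γ (-s))), by rw [norm_neg]; exact hKn _, ?_⟩
      have h1 : -s = -1 * s + 0 := by ring
      have h2 := hd (-s) ⟨by linarith [hs.2], by linarith [hs.1]⟩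
      have := hasDerivAt_comp_affine (-1) 0 (h1 ▸ h2)
      simp only [neg_mul, one_mul, add_zero, neg_smul, one_smul] at this
      exact this.hasDerivWithinAt
  intro t ht
  have hn : ‖γ t‖ ≤ R := by
    rcases le_total 0 t with h | h
    · exact (hbd t ⟨h, ht.2.le⟩).1
    · have := (hbd (-t) ⟨by linarith, by linarith [ht.1]⟩).2
      simpa using this
  have := hd t ht
  rwa [clampSq_of_norm_le hn] at this

/-- The flow `φ` of the field `V`. -/
structure IsFlow (V : Plane → Plane) (φ : ℝ → Plane → Plane) : Prop where
  zero : ∀ z, φ 0 z = z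
  deriv : ∀ z t, HasDerivAt (fun t => φ t z) (V (φ t z)) t
  cont : Continuous (fun q : ℝ × Plane => φ q.1 q.2)
  uniq : ∀ (γ : ℝ → Plane) (a b t₀ : ℝ), t₀ ∈ Ioo a b →
    (∀ t ∈ Ioo a b, HasDerivAt γ (V (γ t)) t) → ∀ t ∈ Ioo a b, γ t = φ (t - t₀) (γ t₀)

lemma exists_flow {K : ℝ≥0} {V : Plane → Plane} (hV : LipschitzWith K V) :
    ∃ φ, IsFlow V φ := by
  choose! γ hγ0 hγ using fun (x : Plane) (T : ℝ) (hT : 0 < T) => exists_solution_Icc hV x hT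
  have huniq : ∀ (f g : ℝ → Plane) (a b t₀ : ℝ), t₀ ∈ Ioo a b →
      (∀ t ∈ Ioo a b, HasDerivAt f (V (f t)) t) → (∀ t ∈ Ioo a b, HasDerivAt g (V (g t)) t) →
      f t₀ = g t₀ → EqOn f g (Ioo a b) := by
    intro f g a b t₀ ht hf hg h
    exact ODE_solution_unique_of_mem_Ioo (v := fun _ => V) (s := fun _ => univ) (K := K)
      (fun _ _ => hV.lipschitzOnWith) ht (fun t h => ⟨hf t h, trivial⟩)
      (fun t h => ⟨hg t h, trivial⟩) h
  -- By uniqueness every horizon larger than |t| gives the same value; |t| + 1 is one such horizon.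
  set φ : ℝ → Plane → Plane := fun t z => γ z (|t| + 1) t with hφ
  have habs : ∀ t : ℝ, t ∈ Ioo (-(|t| + 1)) (|t| + 1) := fun t =>
    ⟨by linarith [neg_abs_le t], by linarith [le_abs_self t]⟩
  have hT : ∀ t : ℝ, 0 < |t| + 1 := fun t => by positivity
  have heq : ∀ z T t, t ∈ Ioo (-T) T → φ t z = γ z T t := by
    intro z T t ht
    have hT0 : 0 < T := by linarith [ht.1, ht.2]
    have hm : t ∈ Ioo (-(min T (|t| + 1))) (min T (|t| + 1)) := by
      have := habs t
      rcases min_choice T (|t| + 1) with h | h <;> rw [h] <;> assumption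
    have hm0 : 0 < min T (|t| + 1) := lt_min hT0 (hT t)
    refine huniq _ _ _ _ 0 ⟨by linarith, hm0⟩ (fun s hs => hγ z _ (hT t) s ?_)
      (fun s hs => hγ z T hT0 s ?_) (by rw [hγ0 _ _ (hT t), hγ0 _ _ hT0]) hm
    · exact ⟨by linarith [hs.1, min_le_right T (|t| + 1)], hs.2.trans_le (min_le_right _ _)⟩
    · exact ⟨by linarith [hs.1, min_le_left T (|t| + 1)], hs.2.trans_le (min_le_left _ _)⟩
  have hderiv : ∀ z t, HasDerivAt (fun t => φ t z) (V (φ t z)) t := by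
    intro z t
    have h1 := hγ z _ (hT t) t (habs t)
    refine h1.congr_of_eventuallyEq ?_
    filter_upwards [Ioo_mem_nhds (habs t).1 (habs t).2] with s hs
    exact heq z _ s hs
  have hzero : ∀ z, φ 0 z = z := fun z => by simp [hφ, hγ0 z (|0| + 1) (hT 0)]
  have hdist : ∀ z z' t, dist (φ t z) (φ t z') ≤ dist z z' * Real.exp (K * |t|) := by
    have aux : ∀ (e : ℝ), e = 1 ∨ e = -1 → ∀ z z' t, 0 ≤ t →
        dist (φ (e * t) z) (φ (e * t) z') ≤ dist z z' * Real.exp (K * t) := by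
      intro e he z z' t ht
      have hl : LipschitzWith K (fun z => e • V z) := by
        refine LipschitzWith.of_dist_le_mul fun a b => ?_
        rw [dist_smul₀]
        rcases he with rfl | rfl <;> simpa using hV.dist_le_mul a b
      have hd : ∀ z t, HasDerivAt (fun t => φ (e * t) z) (e • V (φ (e * t) z)) t := by
        intro z t
        have := hasDerivAt_comp_affine e 0 (hderiv z (e * t + 0))
        simpa only [add_zero] using this
      have := dist_le_of_trajectories_ODE (v := fun _ z => e • V z) (K := K) (fun _ => hl)
        (f := fun t => φ (e * t) z) (g := fun t => φ (e * t) z') (a := 0) (b := t)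
        (δ := dist z z')
        (fun s _ => (hd z s).continuousAt.continuousWithinAt)
        (fun s _ => (hd z s).hasDerivWithinAt)
        (fun s _ => (hd z' s).continuousAt.continuousWithinAt)
        (fun s _ => (hd z' s).hasDerivWithinAt) (by simp [hzero]) t ⟨ht, le_rfl⟩
      simpa using this
    intro z z' t
    rcases le_total 0 t with h | h
    · simpa [abs_of_nonneg h] using aux 1 (Or.inl rfl) z z' t h
    · simpa [abs_of_nonpos h] using aux (-1) (Or.inr rfl) z z' (-t) (by linarith)
  refine ⟨φ, hzero, hderiv, ?_, ?_⟩
  · rw [continuous_iff_continuousAt]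
    rintro ⟨t, z⟩
    rw [ContinuousAt, tendsto_iff_dist_tendsto_zero]
    have hlim : Tendsto (fun q : ℝ × Plane => dist q.2 z * Real.exp (K * |q.1|) +
        dist (φ q.1 z) (φ t z)) (𝓝 (t, z)) (𝓝 (dist z z * Real.exp (K * |t|) +
        dist (φ t z) (φ t z))) := by
      have h1 : ContinuousAt (fun t => φ t z) t := (hderiv z t).continuousAt
      have h2 : Tendsto (fun q : ℝ × Plane => φ q.1 z) (𝓝 (t, z)) (𝓝 (φ t z)) :=
        Tendsto.comp h1 (continuous_fst.tendsto (t, z))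
      refine Tendsto.add ?_ (h2.dist tendsto_const_nhds)
      have : Continuous (fun q : ℝ × Plane => dist q.2 z * Real.exp (K * |q.1|)) := by fun_prop
      exact this.tendsto (t, z)
    rw [dist_self, dist_self, zero_mul, zero_add] at hlim
    refine squeeze_zero (fun _ => dist_nonneg) (fun q => ?_) hlim
    exact (dist_triangle _ (φ q.1 z) _).trans (by gcongr; exact hdist _ _ _)
  · intro g a b t₀ ht hg t htt
    refine huniq g (fun t => φ (t - t₀) (g t₀)) a b t₀ ht hg (fun s _ => ?_) (by simp [hzero]) htt
    have := hasDerivAt_comp_affine 1 (-t₀) (hderiv (g t₀) (1 * s + -t₀))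
    simpa only [one_mul, one_smul, ← sub_eq_add_neg] using this

lemma IsFlow.add {V : Plane → Plane} {φ : ℝ → Plane → Plane} (h : IsFlow V φ) (s t : ℝ)
    (z : Plane) : φ (s + t) z = φ s (φ t z) := by
  have := h.uniq (fun u => φ u z) (min t (s + t) - 1) (max t (s + t) + 1) t
    ⟨by linarith [min_le_left t (s + t)], by linarith [le_max_left t (s + t)]⟩
    (fun u _ => h.deriv z u) (s + t)
    ⟨by linarith [min_le_right t (s + t)], by linarith [le_max_right t (s + t)]⟩
  simpa using this

lemma IsFlow.neg_left {V : Plane → Plane} {φ : ℝ → Plane → Plane} (h : IsFlow V φ) (t : ℝ)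
    (z : Plane) : φ (-t) (φ t z) = z := by
  rw [← h.add, neg_add_cancel, h.zero]

lemma IsFlow.continuous_time {V : Plane → Plane} {φ : ℝ → Plane → Plane} (h : IsFlow V φ)
    (z : Plane) : Continuous (fun t => φ t z) :=
  h.cont.comp (by fun_prop : Continuous fun t : ℝ => (t, z))

/-- A strictly increasing parameter dependent function has a continuous zero. -/
lemma continuousAt_zero_of_strictMono {A : Type*} [TopologicalSpace A] {F : A → ℝ → ℝ} {z₀ : A}
    (hF : ∀ t, ContinuousAt (fun z => F z t) z₀) {τ : A → ℝ}
    (hmono : ∀ᶠ z in 𝓝 z₀, StrictMono (F z)) (hτ : ∀ᶠ z in 𝓝 z₀, F z (τ z) = 0) :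
    ContinuousAt τ z₀ := by
  have hm := hmono.self_of_nhds
  have h0 := hτ.self_of_nhds
  rw [ContinuousAt, Metric.tendsto_nhds]
  intro ε hε
  have h1 : F z₀ (τ z₀ - ε) < 0 := by rw [← h0]; exact hm (by linarith)
  have h2 : 0 < F z₀ (τ z₀ + ε) := by rw [← h0]; exact hm (by linarith)
  filter_upwards [(hF (τ z₀ - ε)).eventually_lt_const h1,
    (hF (τ z₀ + ε)).eventually_const_lt h2, hmono, hτ] with z hz1 hz2 hz3 hz4
  rw [Real.dist_eq, abs_lt]
  rw [← hz4] at hz1 hz2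
  exact ⟨by linarith [hz3.lt_iff_lt.1 hz1], by linarith [hz3.lt_iff_lt.1 hz2]⟩

/-- A fibrewise strictly increasing continuous bijection of a product is a homeomorphism. -/
lemma exists_fiber_inverse {A : Type*} [TopologicalSpace A] {T : A → ℝ → ℝ}
    (hT : Continuous (fun q : A × ℝ => T q.1 q.2)) (hmono : ∀ a, StrictMono (T a))
    (hsurj : ∀ a, Function.Surjective (T a)) :
    ∃ S : A → ℝ → ℝ, Continuous (fun q : A × ℝ => S q.1 q.2) ∧ (∀ a y, T a (S a y) = y) ∧
      ∀ a y, S a (T a y) = y := by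
  choose S hS using hsurj
  refine ⟨S, ?_, hS, fun a y => (hmono a).injective (hS a _)⟩
  rw [continuous_iff_continuousAt]
  intro q
  refine continuousAt_zero_of_strictMono (F := fun (q : A × ℝ) t => T q.1 t - q.2) (fun t => ?_)
    (Eventually.of_forall fun q => ?_) (Eventually.of_forall fun q => ?_)
  · exact Continuous.continuousAt
      ((hT.comp (by fun_prop : Continuous fun q : A × ℝ => (q.1, t))).sub continuous_snd)
  · intro s t hst; simpa using hmono q.1 hst
  · simp [hS]

/-- Global normal form of a fold-saddle: the switching manifold is `y = 0`, the field `U` (a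
multiple of the upper field) moves to the right and has a fold at the origin, visible if `δ = 1` and
invisible if `δ = -1`; the field `V` (a multiple of the lower field) is a perturbation of the linear
saddle `(y, x)` in the sense that `(V.2, V.1)` is strongly monotone. -/
structure FoldSaddle where
  U : Plane → Plane
  V : Plane → Plane
  δ : ℝ
  K : ℝ≥0
  κ : ℝ
  U_lip : LipschitzWith K U
  V_lip : LipschitzWith K V
  δ_eq : δ = 1 ∨ δ = -1
  κ_pos : 0 < κ
  U_fst : ∀ z, κ ≤ (U z).1
  U_zero : (U 0).2 = 0
  U_snd : ∀ x, x ≠ 0 → 0 < δ * x * (U (x, 0)).2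
  -- Far from the axis x = 0 the orbits have slope bounded away from zero. This makes `m` unbounded,
  -- hence `s` and `ψ` surjective.
  U_far : ∃ R > 0, ∃ c > 0, ∀ z, (R ≤ z.1 → c * (U z).1 ≤ δ * (U z).2) ∧
    (z.1 ≤ -R → c * (U z).1 ≤ -(δ * (U z).2))
  V_zero : V 0 = 0
  V_mono : ∀ z w, κ * ((z.1 - w.1) ^ 2 + (z.2 - w.2) ^ 2) ≤
    (z.1 - w.1) * ((V z).2 - (V w).2) + (z.2 - w.2) * ((V z).1 - (V w).1)
  -- Up to sign, the bracket is the numerator of the sliding velocity. The two bounds make it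
  -- comparable with x, so that the sliding speed stays between positive constants.
  slide : ∀ x, κ * x ^ 2 ≤
    x * ((V (x, 0)).2 * (U (x, 0)).1 - (U (x, 0)).2 * (V (x, 0)).1)
  slide_le : ∃ C, ∀ x, |(V (x, 0)).2 * (U (x, 0)).1 - (U (x, 0)).2 * (V (x, 0)).1| ≤ C * |x|

namespace FoldSaddle

variable (D : FoldSaddle)

/-- The flow of `U`. -/
noncomputable def φU : ℝ → Plane → Plane := (exists_flow D.U_lip).choose

/-- The flow of `V`. -/
noncomputable def φV : ℝ → Plane → Plane := (exists_flow D.V_lip).choose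

lemma flowU : IsFlow D.U D.φU := (exists_flow D.U_lip).choose_spec

lemma flowV : IsFlow D.V D.φV := (exists_flow D.V_lip).choose_spec

lemma δ_sq : D.δ * D.δ = 1 := by rcases D.δ_eq with h | h <;> rw [h] <;> norm_num

end FoldSaddle

/-! ### One-variable calculus along orbits -/

lemma hasDerivAt_fst {γ : ℝ → Plane} {v : Plane} {t : ℝ} (h : HasDerivAt γ v t) :
    HasDerivAt (fun t => (γ t).1) v.1 t :=
  (ContinuousLinearMap.fst ℝ ℝ ℝ).hasFDerivAt.comp_hasDerivAt t h

lemma hasDerivAt_snd {γ : ℝ → Plane} {v : Plane} {t : ℝ} (h : HasDerivAt γ v t) :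
    HasDerivAt (fun t => (γ t).2) v.2 t :=
  (ContinuousLinearMap.snd ℝ ℝ ℝ).hasFDerivAt.comp_hasDerivAt t h

lemma le_sub_of_le_deriv {f f' : ℝ → ℝ} {c : ℝ} (hf : ∀ t, HasDerivAt f (f' t) t)
    {s t : ℝ} (hst : s ≤ t) (hc : ∀ u ∈ Icc s t, c ≤ f' u) : c * (t - s) ≤ f t - f s := by
  refine (convex_Icc s t).mul_sub_le_image_sub_of_le_deriv
    (fun u _ => (hf u).continuousAt.continuousWithinAt)
    (fun u _ => (hf u).differentiableAt.differentiableWithinAt) (fun u hu => ?_)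
    s (left_mem_Icc.2 hst) t (right_mem_Icc.2 hst) hst
  rw [(hf u).deriv]
  exact hc u (interior_subset hu)

/-- Zeros can only be crossed upwards, so `g` never becomes negative after time 0. A zero at T with
positive derivative would be preceded by negative values. -/
lemma pos_of_deriv_pos_at_zeros {g g' : ℝ → ℝ} {T : ℝ} (hT : 0 < T)
    (hg : ∀ t, HasDerivAt g (g' t) t) (h0 : g 0 = 0)
    (hpos : ∀ t ∈ Icc 0 T, g t = 0 → 0 < g' t) : 0 < g T := by
  have hle : ∀ t ∈ Icc 0 T, 0 ≤ g t := by
    intro t ht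
    have := image_le_of_deriv_right_lt_deriv_boundary (f := fun t => -g t) (f' := fun t => -g' t)
      (a := 0) (b := T) (B := fun _ => 0) (B' := fun _ => 0)
      (fun u _ => (hg u).neg.continuousAt.continuousWithinAt)
      (fun u _ => (hg u).neg.hasDerivWithinAt) (by simp [h0]) (fun u => hasDerivAt_const u 0)
      (fun u hu h => by
        have := hpos u (Ico_subset_Icc_self hu) (by simpa using h)
        simpa using this) ht
    simpa using this
  rcases (hle T ⟨hT.le, le_rfl⟩).lt_or_eq with h | h
  · exact h
  exfalso
  have hd := hpos T ⟨hT.le, le_rfl⟩ h.symm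
  have hs := eventually_nhdsWithin_sign_eq_of_deriv_pos (f := g) (x₀ := T)
    (by rwa [(hg T).deriv]) h.symm
  have hs' : ∀ᶠ x in 𝓝[<] T, SignType.sign (g x) = SignType.sign (x - T) := by
    filter_upwards [nhdsWithin_le_nhds hs] with x hx using hx
  have h2 : ∀ᶠ x in 𝓝[<] T, x ∈ Ioo 0 T := Ioo_mem_nhdsLT hT
  obtain ⟨x, hx1, hx2⟩ := (hs'.and h2).exists
  rw [sign_neg (by linarith [hx2.2] : x - T < 0), sign_eq_neg_one_iff] at hx1
  linarith [hle x (Ioo_subset_Icc_self hx2)]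

namespace FoldSaddle

variable (D : FoldSaddle)

/-! ### The first integral of the upper field -/

lemma U_time {s t : ℝ} (h : s ≤ t) (z : Plane) :
    D.κ * (t - s) ≤ (D.φU t z).1 - (D.φU s z).1 :=
  le_sub_of_le_deriv (fun u => hasDerivAt_fst (D.flowU.deriv z u)) h (fun _ _ => D.U_fst _)

lemma U_strictMono (z : Plane) : StrictMono (fun t => (D.φU t z).1) := by
  intro s t h
  have := D.U_time h.le z
  have h2 := mul_pos D.κ_pos (sub_pos.2 h)
  dsimp only; linarith

lemma U_reach (z : Plane) (x : ℝ) : ∃ t, (D.φU t z).1 = x := by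
  have hc : Continuous (fun t => (D.φU t z).1) := continuous_fst.comp (D.flowU.continuous_time z)
  set T := |x - z.1| / D.κ with hT
  have hT0 : 0 ≤ T := div_nonneg (abs_nonneg _) D.κ_pos.le
  have hTk : D.κ * T = |x - z.1| := by rw [hT]; field_simp [D.κ_pos.ne']
  have h1 := D.U_time hT0 z
  have h2 := D.U_time (show -T ≤ 0 by linarith) z
  rw [D.flowU.zero] at h1 h2
  have := intermediate_value_Icc (show -T ≤ T by linarith) hc.continuousOn
  have hx : x ∈ Icc ((D.φU (-T) z).1) ((D.φU T z).1) := by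
    have h3 := le_abs_self (x - z.1)
    have h4 := neg_abs_le (x - z.1)
    constructor <;> linarith
  obtain ⟨t, -, ht⟩ := this hx
  exact ⟨t, ht⟩

/-- The time at which the `U`-orbit of `z` crosses the axis `x = 0`. -/
noncomputable def τU (z : Plane) : ℝ := (D.U_reach z 0).choose

lemma τU_spec (z : Plane) : (D.φU (D.τU z) z).1 = 0 := (D.U_reach z 0).choose_spec

lemma τU_continuous : Continuous D.τU := by
  rw [continuous_iff_continuousAt]
  intro z
  refine continuousAt_zero_of_strictMono (F := fun z t => (D.φU t z).1) (fun t => ?_)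
    (Eventually.of_forall D.U_strictMono) (Eventually.of_forall D.τU_spec)
  exact (continuous_fst.comp (D.flowU.cont.comp (by fun_prop : Continuous fun z : Plane => (t, z)))).continuousAt

/-- The height at which the `U`-orbit of `z` crosses the axis `x = 0`. -/
noncomputable def H (z : Plane) : ℝ := (D.φU (D.τU z) z).2

lemma φU_τU (z : Plane) : D.φU (D.τU z) z = (0, D.H z) := Prod.ext (D.τU_spec z) rfl

lemma H_continuous : Continuous D.H :=
  continuous_snd.comp (D.flowU.cont.comp (D.τU_continuous.prodMk continuous_id))

lemma H_flow (t : ℝ) (z : Plane) : D.H (D.φU t z) = D.H z := by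
  have h1 := D.τU_spec (D.φU t z)
  rw [← D.flowU.add, ← D.τU_spec z] at h1
  have := (D.U_strictMono z).injective h1
  rw [H, ← D.flowU.add, this, H]

lemma H_axis (y : ℝ) : D.H (0, y) = y := by
  have h : D.τU (0, y) = 0 := by
    apply (D.U_strictMono (0, y)).injective
    dsimp only
    rw [D.τU_spec, D.flowU.zero]
  rw [H, h, D.flowU.zero]

lemma exists_time_of_H_eq {z w : Plane} (h : D.H z = D.H w) : ∃ t, D.φU t z = w := by
  refine ⟨-D.τU w + D.τU z, ?_⟩
  rw [D.flowU.add, D.φU_τU, h, ← D.φU_τU, D.flowU.neg_left]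

lemma H_injective (x : ℝ) : Function.Injective (fun y => D.H (x, y)) := by
  intro y y' h
  obtain ⟨t, ht⟩ := D.exists_time_of_H_eq h
  have : t = 0 := by
    apply (D.U_strictMono (x, y)).injective
    dsimp only
    rw [ht, D.flowU.zero]
  rw [this, D.flowU.zero] at ht
  exact congrArg Prod.snd ht

/-- `H` is injective on every vertical line, since U always moves to the right and no orbit meets a
vertical twice. The sign of H(x, y') - H(x, y) therefore cannot change when x moves to 0, where H is
the height itself. -/
lemma H_strictMono (x : ℝ) : StrictMono (fun y => D.H (x, y)) := by
  intro y y' h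
  dsimp only
  by_contra hn
  set g : ℝ → ℝ := fun x => D.H (x, y') - D.H (x, y) with hg
  have hc : Continuous g := (D.H_continuous.comp (by fun_prop)).sub (D.H_continuous.comp (by fun_prop))
  have h0 : 0 ≤ g 0 := by simp only [hg, D.H_axis]; linarith
  have hx : g x ≤ 0 := by simp only [hg]; linarith
  obtain ⟨c, -, hc⟩ := intermediate_value_uIcc (a := x) (b := 0) hc.continuousOn
    (show (0 : ℝ) ∈ uIcc (g x) (g 0) from mem_uIcc_of_le hx h0)
  exact h.ne' (D.H_injective c (sub_eq_zero.1 hc))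

lemma H_surjective (x : ℝ) : Function.Surjective (fun y => D.H (x, y)) := by
  intro c
  obtain ⟨t, ht⟩ := D.U_reach (0, c) x
  refine ⟨(D.φU t (0, c)).2, ?_⟩
  have : (x, (D.φU t (0, c)).2) = D.φU t (0, c) := Prod.ext ht.symm rfl
  dsimp only
  rw [this, D.H_flow, D.H_axis]

/-- `m x = -δ H(x, 0)` labels the two points of the switching manifold on the same (extended)
`U`-orbit in the same way. -/
noncomputable def m (x : ℝ) : ℝ := -(D.δ * D.H (x, 0))

lemma m_continuous : Continuous D.m :=
  (continuous_const.mul (D.H_continuous.comp (by fun_prop))).neg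

lemma m_zero : D.m 0 = 0 := by simp [m, D.H_axis]

/-- Wherever the orbit meets y = 0 with e x > 0, the fold condition `U_snd` makes e δ y increase.
The crossings are thus all in one direction, and the orbit starts on the axis. -/
lemma cross {e : ℝ} (he : e = 1 ∨ e = -1) {x : ℝ} {T : ℝ} (hT : 0 < T)
    (hpos : ∀ t ∈ Icc 0 T, 0 < e * (D.φU t (x, 0)).1) : 0 < e * D.δ * (D.φU T (x, 0)).2 := by
  refine pos_of_deriv_pos_at_zeros (g := fun t => e * D.δ * (D.φU t (x, 0)).2) hT
    (fun t => (hasDerivAt_snd (D.flowU.deriv (x, 0) t)).const_mul (e * D.δ))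
    (by simp [D.flowU.zero]) ?_
  intro t ht h
  have hδ0 : D.δ ≠ 0 := by rcases D.δ_eq with h | h <;> rw [h] <;> norm_num
  have he0 : e ≠ 0 := by rcases he with h | h <;> rw [h] <;> norm_num
  have hy : (D.φU t (x, 0)).2 = 0 := by simpa [hδ0, he0] using h
  have hz : D.φU t (x, 0) = ((D.φU t (x, 0)).1, 0) := Prod.ext rfl hy
  have hp := hpos t ht
  have hx : (D.φU t (x, 0)).1 ≠ 0 := by intro h; rw [h] at hp; simp at hp
  have := D.U_snd _ hx
  rw [← hz] at this
  have h2 : 0 < (e * (D.φU t (x, 0)).1) * (e * D.δ * (D.U (D.φU t (x, 0))).2) := by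
    have : e * e = 1 := by rcases he with h | h <;> rw [h] <;> norm_num
    calc (0 : ℝ) < _ := D.U_snd _ hx
      _ = (e * e) * (D.δ * (D.φU t (x, 0)).1 * (D.U (D.φU t (x, 0))).2) := by
        rw [← hz, this, one_mul]
      _ = _ := by ring
  exact (pos_iff_pos_of_mul_pos h2).1 hp

lemma δ_mul_lt_iff {a b x : ℝ} :
    D.δ * D.H (x, a) < D.δ * D.H (x, b) ↔ D.δ * a < D.δ * b := by
  rcases D.δ_eq with h | h <;> rw [h] <;> simp [(D.H_strictMono x).lt_iff_lt]

/-- `H` is constant along the orbit of (x, 0). By `cross` this orbit lies on the side where δ times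
the height is positive once it stands over the abscissa y, and `H` increases along that vertical. -/
lemma m_lt_right {x y : ℝ} (hx : 0 < x) (hxy : x < y) : D.m x < D.m y := by
  obtain ⟨T, hT⟩ := D.U_reach (x, 0) y
  have hT0 : 0 < T := (D.U_strictMono (x, 0)).lt_iff_lt.1 (by
    rw [hT, D.flowU.zero]; exact hxy)
  have := D.cross (Or.inl rfl) (x := x) hT0 (fun t ht => by
    have := (D.U_strictMono (x, 0)).monotone ht.1
    rw [D.flowU.zero] at this; simp only [one_mul]; linarith)
  have h2 : D.H (x, 0) = D.H (y, (D.φU T (x, 0)).2) := by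
    rw [← D.H_flow T (x, 0)]; congr 1; exact Prod.ext hT rfl
  have h3 : D.δ * D.H (y, 0) < D.δ * D.H (y, (D.φU T (x, 0)).2) := by
    rw [D.δ_mul_lt_iff]; linarith
  rw [m, m, h2]; linarith

lemma m_lt_left {x y : ℝ} (hy : y < 0) (hxy : x < y) : D.m y < D.m x := by
  obtain ⟨T, hT⟩ := D.U_reach (x, 0) y
  have hT0 : 0 < T := (D.U_strictMono (x, 0)).lt_iff_lt.1 (by
    rw [hT, D.flowU.zero]; exact hxy)
  have := D.cross (Or.inr rfl) (x := x) hT0 (fun t ht => by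
    have := (D.U_strictMono (x, 0)).monotone ht.2
    rw [hT] at this; linarith)
  have h2 : D.H (x, 0) = D.H (y, (D.φU T (x, 0)).2) := by
    rw [← D.H_flow T (x, 0)]; congr 1; exact Prod.ext hT rfl
  have h3 : D.δ * D.H (y, (D.φU T (x, 0)).2) < D.δ * D.H (y, 0) := by
    rw [D.δ_mul_lt_iff]; linarith
  rw [m, m, h2]; linarith

lemma m_strictMonoOn {e : ℝ} (he : e = 1 ∨ e = -1) : StrictMonoOn (fun u => D.m (e * u)) (Ici 0) := by
  have hpos : ∀ u v, 0 < u → u < v → D.m (e * u) < D.m (e * v) := by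
    intro u v hu huv
    rcases he with rfl | rfl
    · simpa using D.m_lt_right hu huv
    · exact D.m_lt_left (by linarith) (by linarith)
  have hc : Continuous (fun u => D.m (e * u)) := D.m_continuous.comp (by fun_prop)
  intro u hu v hv huv
  rcases (mem_Ici.1 hu).lt_or_eq with h | h
  · exact hpos u v h huv
  · subst h
    -- The comparison of orbits needs x ≠ 0. The value at 0 is therefore compared by a limit, and
    -- the intermediate point v / 2 restores strictness.
    have h1 : D.m (e * 0) ≤ D.m (e * (v / 2)) := by
      have : Tendsto (fun u => D.m (e * u)) (𝓝[>] 0) (𝓝 (D.m (e * 0))) :=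
        (hc.tendsto 0).mono_left nhdsWithin_le_nhds
      refine le_of_tendsto this ?_
      filter_upwards [Ioo_mem_nhdsGT (show (0 : ℝ) < v / 2 by linarith)] with u hu
      exact (hpos u _ hu.1 hu.2).le
    exact h1.trans_lt (hpos _ _ (by linarith) (by linarith))

/-- Beyond the abscissa R orbits have slope at least c in absolute value, so the orbit of (e u, 0)
stands over e R at a height with δ y ≤ -c (u - R). On that vertical `H` takes every value. -/
lemma m_unbounded {e : ℝ} (he : e = 1 ∨ e = -1) (N : ℝ) : ∃ u, 0 ≤ u ∧ N ≤ D.m (e * u) := by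
  obtain ⟨R, hR, c, hc, hfar⟩ := D.U_far
  have key : ∀ u, R ≤ u → ∃ y, D.H (e * u, 0) = D.H (e * R, y) ∧ c * (u - R) ≤ -(D.δ * y) := by
    intro u hu
    have hmono : ∀ (d : ℝ) (z : Plane) (s t : ℝ), s ≤ t →
        (∀ v ∈ Icc s t, c * (D.U (D.φU v z)).1 ≤ d * (D.U (D.φU v z)).2) →
        d * (D.φU s z).2 - c * (D.φU s z).1 ≤ d * (D.φU t z).2 - c * (D.φU t z).1 := by
      intro d z s t hst h
      have := le_sub_of_le_deriv (f := fun t => d * (D.φU t z).2 - c * (D.φU t z).1) (c := 0)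
        (fun t => ((hasDerivAt_snd (D.flowU.deriv z t)).const_mul d).sub
          ((hasDerivAt_fst (D.flowU.deriv z t)).const_mul c)) hst
        (fun v hv => by have := h v hv; linarith)
      linarith
    obtain ⟨T, hT⟩ := D.U_reach (e * u, 0) (e * R)
    have hm := D.U_strictMono (e * u, 0)
    refine ⟨(D.φU T (e * u, 0)).2, ?_, ?_⟩
    · rw [← D.H_flow T]; congr 1; exact Prod.ext hT rfl
    have h0 : (D.φU 0 (e * u, 0)).1 = e * u := by rw [D.flowU.zero]
    have h0' : (D.φU 0 (e * u, 0)).2 = 0 := by rw [D.flowU.zero]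
    rcases he with rfl | rfl
    · have hT0 : T ≤ 0 := hm.le_iff_le.1 (by rw [hT, h0]; linarith)
      have := hmono D.δ (1 * u, 0) T 0 hT0 (fun v hv => (hfar _).1 (by
        have := hm.monotone hv.1; rw [hT] at this; linarith))
      rw [h0, h0', hT] at this
      linarith
    · have hT0 : 0 ≤ T := hm.le_iff_le.1 (by rw [hT, h0]; linarith)
      have := hmono (-D.δ) (-1 * u, 0) 0 T hT0 (fun v hv => by
        have h3 := (hfar (D.φU v (-1 * u, 0))).2 (by
          have := hm.monotone hv.2; rw [hT] at this; linarith)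
        linarith)
      rw [h0, h0', hT] at this
      linarith
  -- y is the height over e R where -δ H equals the target N; u is then far enough out for the orbit
  -- of (e u, 0) to pass on the far side of y.
  obtain ⟨y, hy⟩ := D.H_surjective (e * R) (-(D.δ * N))
  set u := R + |D.δ * y| / c with hu
  have hRu : R ≤ u := by rw [hu]; have := div_nonneg (abs_nonneg (D.δ * y)) hc.le; linarith
  obtain ⟨y', h1, h2⟩ := key u hRu
  refine ⟨u, by linarith, ?_⟩
  have h3 : c * (u - R) = |D.δ * y| := by rw [hu]; field_simp; ring
  have h4 : D.δ * y' ≤ D.δ * y := by linarith [neg_abs_le (D.δ * y)]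
  have h5 : D.δ * D.H (e * R, y') ≤ D.δ * D.H (e * R, y) := by
    rw [← not_lt, D.δ_mul_lt_iff]; linarith
  dsimp only at hy
  rw [hy] at h5
  rw [m, h1]
  have h6 : D.δ * -(D.δ * N) = -N := by linear_combination (-N) * D.δ_sq
  linarith

end FoldSaddle
/-! ### The square map of the plane -/

/-- Half the imaginary part of the square. -/
def qf (z : Plane) : ℝ := z.1 * z.2

/-- The real part of the square. -/
def pf (z : Plane) : ℝ := z.1 ^ 2 - z.2 ^ 2

/-- The square of the Euclidean norm. -/
def nf (z : Plane) : ℝ := z.1 ^ 2 + z.2 ^ 2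

lemma qf_continuous : Continuous qf := by unfold qf; fun_prop
lemma pf_continuous : Continuous pf := by unfold pf; fun_prop
lemma nf_continuous : Continuous nf := by unfold nf; fun_prop

lemma nf_nonneg (z : Plane) : 0 ≤ nf z := by unfold nf; positivity

lemma nf_sq (z : Plane) : nf z ^ 2 = pf z ^ 2 + 4 * qf z ^ 2 := by unfold nf pf qf; ring

lemma nf_eq_zero {z : Plane} : nf z = 0 ↔ z = 0 := by
  unfold nf
  constructor
  · intro h
    exact Prod.ext (by rw [Prod.fst_zero]; nlinarith [sq_nonneg z.1, sq_nonneg z.2])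
      (by rw [Prod.snd_zero]; nlinarith [sq_nonneg z.1, sq_nonneg z.2])
  · rintro rfl; simp

lemma nf_pos {z : Plane} (h : z ≠ 0) : 0 < nf z :=
  (nf_nonneg z).lt_of_ne' (fun h' => h (nf_eq_zero.1 h'))

lemma abs_qf_le (z : Plane) : 2 * |qf z| ≤ nf z := by
  unfold qf nf
  rw [abs_mul]
  nlinarith [sq_nonneg (|z.1| - |z.2|), sq_abs z.1, sq_abs z.2]

lemma abs_pf_le (z : Plane) : |pf z| ≤ nf z := by
  unfold pf nf
  rw [abs_le]
  constructor <;> nlinarith [sq_nonneg z.1, sq_nonneg z.2]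

lemma nf_le (z : Plane) : nf z ≤ |pf z| + 2 * |qf z| := by
  have h := nf_sq z
  have h1 := abs_nonneg (pf z)
  have h2 := abs_nonneg (qf z)
  refine abs_le_of_sq_le_sq' ?_ (by positivity) |>.2
  rw [h, ← sq_abs (pf z), ← sq_abs (qf z)]
  nlinarith

/-- The square map is injective on a quadrant: nf² = pf² + 4 qf² recovers nf, then nf and pf give
the squares of the coordinates, and the quadrant gives their signs. -/
lemma eq_of_pf_qf {e : ℝ} (he : e = 1 ∨ e = -1) {z w : Plane} (hz1 : 0 ≤ e * z.1)
    (hz2 : z.2 ≤ 0) (hw1 : 0 ≤ e * w.1) (hw2 : w.2 ≤ 0) (hp : pf z = pf w)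
    (hq : qf z = qf w) : z = w := by
  have hn : nf z = nf w := by
    have := nf_sq z
    rw [hp, hq, ← nf_sq] at this
    exact (pow_left_inj₀ (nf_nonneg z) (nf_nonneg w) two_ne_zero).1 this
  unfold nf at hn
  unfold pf at hp
  have h1 : z.1 ^ 2 = w.1 ^ 2 := by linarith
  have h2 : z.2 ^ 2 = w.2 ^ 2 := by linarith
  refine Prod.ext ?_ ?_
  · rcases he with rfl | rfl
    · exact (pow_left_inj₀ (by linarith) (by linarith) two_ne_zero).1 h1
    · have := (pow_left_inj₀ (a := -z.1) (b := -w.1) (by linarith) (by linarith) two_ne_zero).1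
        (by linarith)
      linarith
  · have := (pow_left_inj₀ (a := -z.2) (b := -w.2) (by linarith) (by linarith) two_ne_zero).1
      (by linarith)
    linarith

/-- The point of the quadrant `0 ≤ e x`, `y ≤ 0` with given values of `|qf|` and `pf`. -/
noncomputable def sqInv (e q p : ℝ) : Plane :=
  (e * √((√(p ^ 2 + 4 * q ^ 2) + p) / 2), -√((√(p ^ 2 + 4 * q ^ 2) - p) / 2))

lemma sqInv_continuous (e : ℝ) : Continuous (fun w : ℝ × ℝ => sqInv e w.1 w.2) := by
  unfold sqInv; fun_prop

lemma abs_le_sqrt_sq_add (q p : ℝ) : |p| ≤ √(p ^ 2 + 4 * q ^ 2) := by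
  rw [← Real.sqrt_sq_eq_abs]; exact Real.sqrt_le_sqrt (by nlinarith [sq_nonneg q])

lemma sqInv_fst {e : ℝ} (he : e = 1 ∨ e = -1) (q p : ℝ) : 0 ≤ e * (sqInv e q p).1 := by
  have : e * e = 1 := by rcases he with rfl | rfl <;> norm_num
  unfold sqInv
  rw [← mul_assoc, this, one_mul]; exact Real.sqrt_nonneg _

lemma sqInv_snd (e q p : ℝ) : (sqInv e q p).2 ≤ 0 := by
  exact neg_nonpos.2 (Real.sqrt_nonneg _)

lemma pf_sqInv {e : ℝ} (he : e = 1 ∨ e = -1) (q p : ℝ) : pf (sqInv e q p) = p := by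
  have h := abs_le.1 (abs_le_sqrt_sq_add q p)
  have : e ^ 2 = 1 := by rcases he with rfl | rfl <;> norm_num
  unfold pf sqInv
  rw [mul_pow, neg_sq, Real.sq_sqrt (by linarith), Real.sq_sqrt (by linarith), this]
  ring

lemma qf_sqInv (e q p : ℝ) : qf (sqInv e q p) = -(e * |q|) := by
  have h := abs_le.1 (abs_le_sqrt_sq_add q p)
  unfold qf sqInv
  have h2 : √((√(p ^ 2 + 4 * q ^ 2) + p) / 2) * √((√(p ^ 2 + 4 * q ^ 2) - p) / 2) = |q| := by
    rw [← Real.sqrt_mul (by linarith), ← Real.sqrt_sq_eq_abs]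
    congr 1
    have := Real.sq_sqrt (show 0 ≤ p ^ 2 + 4 * q ^ 2 by positivity)
    linear_combination this / 4
  simp only
  rw [mul_assoc, mul_neg, h2, mul_neg]

lemma qf_sqInv_of_le {e : ℝ} (he : e = 1 ∨ e = -1) {q : ℝ} (hq : e * q ≤ 0) (p : ℝ) :
    qf (sqInv e q p) = q := by
  rw [qf_sqInv]
  rcases he with rfl | rfl
  · rw [abs_of_nonpos (by linarith)]; ring
  · rw [abs_of_nonneg (by linarith)]; ring

lemma mul_qf_nonpos {e : ℝ} {z : Plane} (hz1 : 0 ≤ e * z.1) (hz2 : z.2 ≤ 0) :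
    e * qf z ≤ 0 := by
  unfold qf; rw [← mul_assoc]; exact mul_nonpos_of_nonneg_of_nonpos hz1 hz2

lemma sqInv_qf_pf {e : ℝ} (he : e = 1 ∨ e = -1) {z : Plane} (hz1 : 0 ≤ e * z.1)
    (hz2 : z.2 ≤ 0) : sqInv e (qf z) (pf z) = z :=
  eq_of_pf_qf he (sqInv_fst he _ _) (sqInv_snd _ _ _) hz1 hz2 (pf_sqInv he _ _)
    (qf_sqInv_of_le he (mul_qf_nonpos hz1 hz2) _)

lemma sqInv_ne_zero {e : ℝ} (he : e = 1 ∨ e = -1) {q p : ℝ} (h : q ≠ 0) : sqInv e q p ≠ 0 := by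
  intro h0
  have := qf_sqInv e q p
  rw [h0, show qf 0 = 0 by simp [qf]] at this
  have h2 : |q| = 0 := by rcases he with rfl | rfl <;> linarith
  exact h (abs_eq_zero.1 h2)

lemma exists_eq_of_le_deriv {f f' : ℝ → ℝ} {c : ℝ} (hc : 0 < c)
    (hf : ∀ t, HasDerivAt f (f' t) t) (h : ∀ t, c ≤ f' t) (y : ℝ) : ∃ t, f t = y := by
  have hcont : Continuous f := continuous_iff_continuousAt.2 fun t => (hf t).continuousAt
  set T := |y - f 0| / c with hT
  have hT0 : 0 ≤ T := div_nonneg (abs_nonneg _) hc.le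
  have hTk : c * T = |y - f 0| := by rw [hT]; field_simp
  have h1 := le_sub_of_le_deriv hf hT0 (fun u _ => h u)
  have h2 := le_sub_of_le_deriv hf (show -T ≤ 0 by linarith) (fun u _ => h u)
  have h3 := le_abs_self (y - f 0)
  have h4 := neg_abs_le (y - f 0)
  exact mem_range_of_exists_le_of_exists_ge hcont ⟨-T, by linarith⟩ ⟨T, by linarith⟩

namespace FoldSaddle

variable (D : FoldSaddle)

/-! ### The first integral of the saddle -/

lemma V_zero_mono (z : Plane) : D.κ * nf z ≤ z.1 * (D.V z).2 + z.2 * (D.V z).1 := by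
  have := D.V_mono z 0
  simpa [D.V_zero, nf] using this

lemma φV_zero (t : ℝ) : D.φV t 0 = 0 := by
  have := D.flowV.uniq (fun _ => 0) (-|t| - 1) (|t| + 1) 0
    ⟨by linarith [abs_nonneg t], by linarith [abs_nonneg t]⟩
    (fun s _ => by rw [D.V_zero]; exact hasDerivAt_const s 0) t
    ⟨by linarith [neg_abs_le t], by linarith [le_abs_self t]⟩
  simpa using this.symm

lemma φV_ne_zero {z : Plane} (hz : z ≠ 0) (t : ℝ) : D.φV t z ≠ 0 := by
  intro h
  apply hz
  rw [← D.flowV.neg_left t z, h, D.φV_zero]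

lemma qf_deriv (z : Plane) (t : ℝ) : HasDerivAt (fun t => qf (D.φV t z))
    ((D.φV t z).1 * (D.V (D.φV t z)).2 + (D.φV t z).2 * (D.V (D.φV t z)).1) t := by
  have := (hasDerivAt_fst (D.flowV.deriv z t)).mul (hasDerivAt_snd (D.flowV.deriv z t))
  exact this.congr_deriv (by ring)

lemma qf_strictMono {z : Plane} (hz : z ≠ 0) : StrictMono (fun t => qf (D.φV t z)) := by
  refine strictMono_of_deriv_pos fun t => ?_
  rw [(D.qf_deriv z t).deriv]
  exact (mul_pos D.κ_pos (nf_pos (D.φV_ne_zero hz t))).trans_le (D.V_zero_mono _)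

/-- Ratio bound between the rates of change of `pf` and `qf` along orbits. -/
noncomputable def M : ℝ := 4 * D.K / D.κ

lemma M_nonneg : 0 ≤ D.M := div_nonneg (by positivity) D.κ_pos.le

/-- Both rates are quadratic in the point: qf grows at rate at least κ nf by monotonicity of `V`,
and |pf'| ≤ 4K nf by the Lipschitz bound. -/
lemma pf_qf_bound (z : Plane) {s t : ℝ} (hst : s ≤ t) :
    |pf (D.φV t z) - pf (D.φV s z)| ≤ D.M * (qf (D.φV t z) - qf (D.φV s z)) := by
  have hd : ∀ t, HasDerivAt (fun t => pf (D.φV t z))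
      (2 * (D.φV t z).1 * (D.V (D.φV t z)).1 - 2 * (D.φV t z).2 * (D.V (D.φV t z)).2) t := by
    intro t
    have := ((hasDerivAt_fst (D.flowV.deriv z t)).pow 2).sub
      ((hasDerivAt_snd (D.flowV.deriv z t)).pow 2)
    exact this.congr_deriv (by simp)
  have hb : ∀ w : Plane, |2 * w.1 * (D.V w).1 - 2 * w.2 * (D.V w).2| ≤
      D.M * (w.1 * (D.V w).2 + w.2 * (D.V w).1) := by
    intro w
    have h1 := D.V_zero_mono w
    have hV : ‖D.V w‖ ≤ D.K * ‖w‖ := by simpa [D.V_zero] using D.V_lip.dist_le_mul w 0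
    have hw : ‖w‖ ^ 2 ≤ nf w := by
      rw [Prod.norm_def, nf]
      rcases max_choice ‖w.1‖ ‖w.2‖ with h | h <;> rw [h, Real.norm_eq_abs, sq_abs] <;>
        nlinarith [sq_nonneg w.1, sq_nonneg w.2]
    have ha : ∀ a b : ℝ, |a| ≤ ‖w‖ → |b| ≤ ‖D.V w‖ → |a * b| ≤ D.K * nf w := by
      intro a b ha hb
      rw [abs_mul]
      calc |a| * |b| ≤ ‖w‖ * (D.K * ‖w‖) := by gcongr; exact hb.trans hV
        _ = D.K * ‖w‖ ^ 2 := by ring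
        _ ≤ _ := by gcongr
    have h2 := ha _ _ (norm_fst_le w) (norm_fst_le (D.V w))
    have h3 := ha _ _ (norm_snd_le w) (norm_snd_le (D.V w))
    have h4 : D.M * (D.κ * nf w) = 4 * D.K * nf w := by
      rw [M]; field_simp [D.κ_pos.ne']
    have h5 := mul_le_mul_of_nonneg_left h1 D.M_nonneg
    rw [abs_le] at *
    constructor <;> nlinarith
  have aux : ∀ c : ℝ, |c| = 1 → c * (pf (D.φV t z) - pf (D.φV s z)) ≤
      D.M * (qf (D.φV t z) - qf (D.φV s z)) := by
    intro c hc
    have := le_sub_of_le_deriv (c := 0)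
      (fun t => ((D.qf_deriv z t).const_mul D.M).sub ((hd t).const_mul c)) hst (fun u _ => by
        have h1 := hb (D.φV u z)
        have h2 := le_abs_self (c * (2 * (D.φV u z).1 * (D.V (D.φV u z)).1 -
          2 * (D.φV u z).2 * (D.V (D.φV u z)).2))
        rw [abs_mul, hc, one_mul] at h2
        linarith)
    dsimp only [Pi.sub_apply] at this
    linarith
  rw [abs_le]
  have h1 := aux 1 (by simp)
  have h2 := aux (-1) (by simp)
  constructor <;> linarith

open Classical in
/-- The value of `pf` where the orbit of `z` crosses `qf = 0`, and `0` on the separatrices. -/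
noncomputable def G (z : Plane) : ℝ :=
  if h : ∃ t, qf (D.φV t z) = 0 then pf (D.φV h.choose z) else 0

lemma G_zero : D.G 0 = 0 := by
  unfold G
  split_ifs
  · rw [D.φV_zero]; simp [pf]
  · rfl

lemma G_of_hit {z : Plane} {t : ℝ} (h : qf (D.φV t z) = 0) : D.G z = pf (D.φV t z) := by
  rcases eq_or_ne z 0 with rfl | hz
  · rw [D.G_zero, D.φV_zero]; simp [pf]
  have hex : ∃ t, qf (D.φV t z) = 0 := ⟨t, h⟩
  unfold G
  rw [dif_pos hex]
  have : hex.choose = t := (D.qf_strictMono hz).injective (by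
    rw [hex.choose_spec, h])
  rw [this]

lemma G_of_not_hit {z : Plane} (h : ¬ ∃ t, qf (D.φV t z) = 0) : D.G z = 0 := by
  unfold G; rw [dif_neg h]

lemma G_of_qf {z : Plane} (h : qf z = 0) : D.G z = pf z := by
  have := D.G_of_hit (z := z) (t := 0) (by rwa [D.flowV.zero])
  rwa [D.flowV.zero] at this

lemma G_flow (s : ℝ) (z : Plane) : D.G (D.φV s z) = D.G z := by
  by_cases h : ∃ t, qf (D.φV t z) = 0
  · obtain ⟨t, ht⟩ := h
    have : D.φV (t - s) (D.φV s z) = D.φV t z := by rw [← D.flowV.add, sub_add_cancel]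
    rw [D.G_of_hit ht, D.G_of_hit (t := t - s) (by rwa [this]), this]
  · rw [D.G_of_not_hit h, D.G_of_not_hit]
    rintro ⟨t, ht⟩
    exact h ⟨t + s, by rwa [D.flowV.add]⟩

/-- If nf stayed above ε, then qf would grow at rate at least κε for all times and would have a
zero. -/
lemma exists_small {z : Plane} (h : ¬ ∃ t, qf (D.φV t z) = 0) {ε : ℝ} (hε : 0 < ε) :
    ∃ t, nf (D.φV t z) < ε := by
  by_contra! hn
  exact h (exists_eq_of_le_deriv (mul_pos D.κ_pos hε) (D.qf_deriv z)
    (fun t => (mul_le_mul_of_nonneg_left (hn t) D.κ_pos.le).trans (D.V_zero_mono _)) 0)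

lemma pf_qf_bound' (z : Plane) (s t : ℝ) :
    |pf (D.φV t z) - pf (D.φV s z)| ≤ D.M * |qf (D.φV t z) - qf (D.φV s z)| := by
  rcases le_total s t with h | h
  · exact (D.pf_qf_bound z h).trans (by gcongr; exacts [D.M_nonneg, le_abs_self _])
  · rw [abs_sub_comm, abs_sub_comm (qf _)]
    exact (D.pf_qf_bound z h).trans (by gcongr; exacts [D.M_nonneg, le_abs_self _])

/-- Up to the crossing point pf varies by at most M times the variation of qf. On a separatrix the
crossing point is replaced by points of the orbit arbitrarily close to the origin. -/
lemma G_sub_pf (z : Plane) : |D.G z - pf z| ≤ D.M * |qf z| := by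
  by_cases h : ∃ t, qf (D.φV t z) = 0
  · obtain ⟨t, ht⟩ := h
    have := D.pf_qf_bound' z 0 t
    rwa [D.flowV.zero, ht, zero_sub, abs_neg, ← D.G_of_hit ht] at this
  · rw [D.G_of_not_hit h, zero_sub, abs_neg]
    refine le_of_forall_pos_le_add fun ε hε => ?_
    obtain ⟨t, ht⟩ := D.exists_small h (ε := ε / (1 + D.M)) (by have := D.M_nonneg; positivity)
    have hM := D.M_nonneg
    have h1 := D.pf_qf_bound' z 0 t
    rw [D.flowV.zero] at h1
    have h2 := abs_pf_le (D.φV t z)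
    have h3 := abs_qf_le (D.φV t z)
    have h4 : (1 + D.M) * nf (D.φV t z) ≤ ε := by
      rw [lt_div_iff₀ (by positivity)] at ht; linarith
    have h5 := abs_sub_abs_le_abs_sub (pf z) (pf (D.φV t z))
    rw [abs_sub_comm] at h5
    have h6 : |qf (D.φV t z) - qf z| ≤ |qf (D.φV t z)| + |qf z| := abs_sub _ _
    have h7 := abs_nonneg (qf (D.φV t z))
    have h8 := mul_le_mul_of_nonneg_left h6 hM
    have h9 : D.M * |qf (D.φV t z)| ≤ D.M * nf (D.φV t z) := by gcongr; linarith
    linarith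

lemma abs_G_le (z : Plane) : |D.G z| ≤ (1 + D.M) * nf z := by
  have h1 := D.G_sub_pf z
  have h2 := abs_pf_le z
  have h3 := abs_qf_le z
  have h4 := abs_sub_abs_le_abs_sub (D.G z) (pf z)
  have h5 : D.M * |qf z| ≤ D.M * nf z := by
    have := abs_nonneg (qf z)
    gcongr; exacts [D.M_nonneg, by linarith]
  linarith

/-- Where the orbit crosses qf = 0 transversally, the crossing time is continuous, being the zero of
a strictly monotone function. On the separatrices and at the origin G vanishes; there one uses
invariance and |G| ≤ (1 + M) nf after flowing to a time when nf is tiny. -/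
lemma G_continuous : Continuous D.G := by
  rw [continuous_iff_continuousAt]
  intro z₀
  have hcz : ∀ t, Continuous (fun z => D.φV t z) := fun t =>
    D.flowV.cont.comp (by fun_prop : Continuous fun z : Plane => (t, z))
  by_cases h : (∃ t, qf (D.φV t z₀) = 0) ∧ z₀ ≠ 0
  · obtain ⟨⟨t₀, ht₀⟩, hz₀⟩ := h
    have hcq : ∀ t, Continuous (fun z => qf (D.φV t z)) := fun t => qf_continuous.comp (hcz t)
    have h1 : qf (D.φV (t₀ - 1) z₀) < 0 := by
      rw [← ht₀]; exact D.qf_strictMono hz₀ (by linarith)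
    have h2 : 0 < qf (D.φV (t₀ + 1) z₀) := by
      rw [← ht₀]; exact D.qf_strictMono hz₀ (by linarith)
    have hhit : ∀ᶠ z in 𝓝 z₀, ∃ t, qf (D.φV t z) = 0 := by
      filter_upwards [(hcq (t₀ - 1)).continuousAt.eventually_lt_const h1,
        (hcq (t₀ + 1)).continuousAt.eventually_const_lt h2] with z h1 h2
      exact mem_range_of_exists_le_of_exists_ge
        (qf_continuous.comp (D.flowV.continuous_time z)) ⟨_, h1.le⟩ ⟨_, h2.le⟩
    have hex : ∃ τ : Plane → ℝ, ∀ᶠ z in 𝓝 z₀, qf (D.φV (τ z) z) = 0 := by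
      classical
      refine ⟨fun z => if h : ∃ t, qf (D.φV t z) = 0 then h.choose else 0, ?_⟩
      filter_upwards [hhit] with z hz
      rw [dif_pos hz]; exact hz.choose_spec
    obtain ⟨τ, hτ⟩ := hex
    have hτc : ContinuousAt τ z₀ := continuousAt_zero_of_strictMono
      (F := fun z t => qf (D.φV t z)) (fun t => (hcq t).continuousAt)
      (by filter_upwards [isOpen_ne.mem_nhds hz₀] with z hz using D.qf_strictMono hz) hτ
    have hc : ContinuousAt (fun z => pf (D.φV (τ z) z)) z₀ :=
      (pf_continuous.comp D.flowV.cont).continuousAt.comp (hτc.prodMk continuousAt_id)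
    refine hc.congr ?_
    filter_upwards [hτ] with z hz
    exact (D.G_of_hit hz).symm
  · have hG : D.G z₀ = 0 := by
      rcases eq_or_ne z₀ 0 with rfl | h0
      · exact D.G_zero
      · exact D.G_of_not_hit fun h' => h ⟨h', h0⟩
    have hsmall : ∀ ε > 0, ∃ t, nf (D.φV t z₀) < ε := by
      intro ε hε
      rcases eq_or_ne z₀ 0 with rfl | h0
      · exact ⟨0, by rw [D.φV_zero]; simpa [nf] using hε⟩
      · exact D.exists_small (fun h' => h ⟨h', h0⟩) hε
    have hM := D.M_nonneg
    rw [ContinuousAt, hG, Metric.tendsto_nhds]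
    intro ε hε
    obtain ⟨t, ht⟩ := hsmall (ε / (1 + D.M)) (by positivity)
    filter_upwards [(nf_continuous.comp (hcz t)).continuousAt.eventually_lt_const ht] with z hz
    rw [dist_zero_right, Real.norm_eq_abs, ← D.G_flow t]
    refine (D.abs_G_le _).trans_lt ?_
    rw [Function.comp_apply, lt_div_iff₀ (by positivity)] at hz
    linarith

/-- Leaving the quadrant means crossing a coordinate axis, which is a zero of qf, and an orbit has
only one such zero. -/
lemma quadrant_of_hit {e : ℝ} {z : Plane} (hz : z ≠ 0) (hz1 : 0 ≤ e * z.1)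
    (hz2 : z.2 ≤ 0) {t : ℝ} (ht : qf (D.φV t z) = 0) :
    0 ≤ e * (D.φV t z).1 ∧ (D.φV t z).2 ≤ 0 := by
  have hc := D.flowV.continuous_time z
  have huniq : ∀ s, qf (D.φV s z) = 0 → s = t := fun s hs =>
    (D.qf_strictMono hz).injective (by rw [hs, ht])
  constructor
  · by_contra! hn
    have hc1 : Continuous (fun s => e * (D.φV s z).1) := by fun_prop
    obtain ⟨s, -, hs⟩ := intermediate_value_uIcc (a := t) (b := 0) hc1.continuousOn
      (show (0 : ℝ) ∈ _ from mem_uIcc_of_le hn.le (by simpa [D.flowV.zero] using hz1))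
    have he : e ≠ 0 := by rintro rfl; simp at hn
    have hs' : (D.φV s z).1 = 0 := by simpa [he] using hs
    rw [← huniq s (by simp [qf, hs']), hs'] at hn
    simp at hn
  · by_contra! hn
    have hc1 : Continuous (fun s => (D.φV s z).2) := by fun_prop
    obtain ⟨s, -, hs⟩ := intermediate_value_uIcc (a := 0) (b := t) hc1.continuousOn
      (show (0 : ℝ) ∈ _ from mem_uIcc_of_le (by simpa [D.flowV.zero] using hz2) hn.le)
    have hs' : (D.φV s z).2 = 0 := hs
    rw [← huniq s (by simp [qf, hs']), hs'] at hn
    simp at hn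

lemma signed_qf_deriv {e : ℝ} (he : e = 1 ∨ e = -1) (z : Plane) (t : ℝ) :
    ∃ d, D.κ * nf (D.φV (e * t) z) ≤ d ∧ HasDerivAt (fun t => e * qf (D.φV (e * t) z)) d t := by
  have h := hasDerivAt_comp_affine e 0 (D.qf_deriv z (e * t + 0))
  simp only [add_zero] at h
  refine ⟨_, D.V_zero_mono _, (h.const_mul e).congr_deriv ?_⟩
  have : e * e = 1 := by rcases he with rfl | rfl <;> norm_num
  rw [smul_eq_mul, ← mul_assoc, this, one_mul]

lemma signed_qf_neg {e : ℝ} {z : Plane} (h : ¬ ∃ t, qf (D.φV t z) = 0) (hq : e * qf z < 0)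
    (t : ℝ) : e * qf (D.φV t z) < 0 := by
  have hc : Continuous (fun t => e * qf (D.φV t z)) :=
    continuous_const.mul (qf_continuous.comp (D.flowV.continuous_time z))
  by_contra! hn
  obtain ⟨s, -, hs⟩ := intermediate_value_uIcc (a := 0) (b := t) hc.continuousOn
    (show (0 : ℝ) ∈ _ from mem_uIcc_of_le (by simpa [D.flowV.zero] using hq.le) hn)
  have he : e ≠ 0 := by rintro rfl; simp at hq
  exact h ⟨s, by simpa [he] using hs⟩

/-- On a separatrix |qf| becomes arbitrarily small by `exists_small`. In the opposite direction of
time |qf| grows at a rate bounded below, because nf ≥ 2|qf|. The intermediate value theorem gives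
all levels of the right sign. -/
lemma exists_level_of_not_hit {e : ℝ} (he : e = 1 ∨ e = -1) {z : Plane}
    (h : ¬ ∃ t, qf (D.φV t z) = 0) (hz : e * qf z < 0) {q : ℝ} (hq : e * q < 0) :
    ∃ t, qf (D.φV t z) = q := by
  have hee : e * e = 1 := by rcases he with rfl | rfl <;> norm_num
  choose d hd hdd using D.signed_qf_deriv he z
  set g : ℝ → ℝ := fun t => e * qf (D.φV (e * t) z) with hg
  have hneg : ∀ t, g t < 0 := fun t => D.signed_qf_neg h hz _
  have hgq : ∀ t, 2 * |g t| ≤ nf (D.φV (e * t) z) := by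
    intro t
    have : |g t| = |qf (D.φV (e * t) z)| := by
      rw [hg]; rcases he with rfl | rfl <;> simp
    rw [this]; exact abs_qf_le _
  have hcont : Continuous g := continuous_iff_continuousAt.2 fun t => (hdd t).continuousAt
  have hmono : ∀ s t, s ≤ t → g s ≤ g t := fun s t hst => by
    have := le_sub_of_le_deriv hdd (c := 0) hst
      (fun u _ => (mul_nonneg D.κ_pos.le (nf_nonneg _)).trans (hd u))
    linarith
  have hup : ∃ t, e * q ≤ g t := by
    obtain ⟨t, ht⟩ := D.exists_small h (ε := 2 * |e * q|) (by
      have := abs_pos.2 hq.ne; positivity)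
    refine ⟨e * t, ?_⟩
    have h1 := hgq (e * t)
    rw [← mul_assoc, hee, one_mul] at h1
    have h2 : |g (e * t)| < |e * q| := by linarith
    rw [abs_of_neg (hneg _), abs_of_neg hq] at h2
    linarith
  have hdown : ∃ t, g t ≤ e * q := by
    have h0 := hneg 0
    set c := D.κ * (2 * |g 0|) with hc
    have hc0 : 0 < c := by have := D.κ_pos; have := abs_pos.2 h0.ne; positivity
    refine ⟨-(|e * q| / c), ?_⟩
    have hle : -(|e * q| / c) ≤ 0 := by
      have := div_nonneg (abs_nonneg (e * q)) hc0.le; linarith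
    have := le_sub_of_le_deriv hdd (c := c) hle (fun u hu => by
      refine le_trans ?_ (hd u)
      rw [hc]
      have h1 := hgq u
      have h2 := hmono u 0 hu.2
      have : |g 0| ≤ |g u| := by rw [abs_of_neg h0, abs_of_neg (hneg u)]; linarith
      have := D.κ_pos
      gcongr; linarith)
    have h3 : c * (0 - -(|e * q| / c)) = |e * q| := by field_simp; ring
    rw [h3] at this
    have h5 := abs_of_neg hq
    linarith
  obtain ⟨t, ht⟩ := mem_range_of_exists_le_of_exists_ge hcont hdown hup
  refine ⟨e * t, ?_⟩
  have : e * (e * qf (D.φV (e * t) z)) = e * (e * q) := by rw [← ht]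
  rwa [← mul_assoc, ← mul_assoc, hee, one_mul, one_mul] at this

/-- On a separatrix G = 0, so |pf| ≤ M |qf|, and |qf| decreases in the direction of time fixed by e.
Hence nf ≤ |pf| + 2|qf| stays bounded. -/
lemma nf_bounded_of_not_hit {e : ℝ} (he : e = 1 ∨ e = -1) {z : Plane}
    (h : ¬ ∃ t, qf (D.φV t z) = 0) (hz : e * qf z < 0) {t : ℝ} (ht : 0 ≤ t) :
    nf (D.φV (e * t) z) ≤ (D.M + 2) * |qf z| := by
  choose d hd hdd using D.signed_qf_deriv he z
  have hmono := le_sub_of_le_deriv hdd (c := 0) ht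
      (fun u _ => (mul_nonneg D.κ_pos.le (nf_nonneg _)).trans (hd u))
  simp only [mul_zero, D.flowV.zero, zero_mul] at hmono
  have hneg := D.signed_qf_neg h hz (e * t)
  have hq : |qf (D.φV (e * t) z)| ≤ |qf z| := by
    rcases he with rfl | rfl
    · rw [abs_of_neg (by linarith), abs_of_neg (by linarith)]; linarith
    · rw [abs_of_pos (by linarith), abs_of_pos (by linarith)]; linarith
  have h1 := D.G_sub_pf (D.φV (e * t) z)
  rw [D.G_flow, D.G_of_not_hit h, zero_sub, abs_neg] at h1
  have h2 := nf_le (D.φV (e * t) z)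
  have h3 := mul_le_mul_of_nonneg_left hq D.M_nonneg
  linarith

/-- Strong monotonicity of `V` applies to the difference of two orbits: e·qf of the difference
increases at a rate at least κ nf. It is positive initially, since two distinct points of the open
quadrant on one hyperbola xy = const differ in both coordinates with the right signs. It therefore
grows at least linearly, while both separatrices remain bounded. -/
lemma separatrix_unique {e : ℝ} (he : e = 1 ∨ e = -1) {z w : Plane}
    (hz : ¬ ∃ t, qf (D.φV t z) = 0) (hw : ¬ ∃ t, qf (D.φV t w) = 0)
    (hz1 : 0 < e * z.1) (hz2 : z.2 < 0) (hw1 : 0 < e * w.1) (hw2 : w.2 < 0)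
    (hq : qf z = qf w) : z = w := by
  have hee : e * e = 1 := by rcases he with rfl | rfl <;> norm_num
  have hzq : e * qf z < 0 := by
    unfold qf; rw [← mul_assoc]; exact mul_neg_of_pos_of_neg hz1 hz2
  have hwq : e * qf w < 0 := by rwa [← hq]
  by_contra hne
  set E : ℝ → ℝ := fun t => e * qf (D.φV (e * t) z - D.φV (e * t) w) with hE
  have hderiv : ∀ t, ∃ d, D.κ * nf (D.φV (e * t) z - D.φV (e * t) w) ≤ d ∧
      HasDerivAt E d t := by
    intro t
    have h0 := (D.flowV.deriv z (e * t + 0)).sub (D.flowV.deriv w (e * t + 0))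
    have h1 := ((hasDerivAt_fst h0).mul (hasDerivAt_snd h0))
    have h2 := (hasDerivAt_comp_affine e 0 h1).const_mul e
    simp only [add_zero] at h2
    refine ⟨_, ?_, h2⟩
    rw [smul_eq_mul, ← mul_assoc, hee, one_mul]
    have := D.V_mono (D.φV (e * t) z) (D.φV (e * t) w)
    simp only [nf, Prod.fst_sub, Prod.snd_sub, Pi.sub_apply]
    linarith
  choose d hd hdd using hderiv
  have hE0 : 0 < E 0 := by
    simp only [hE, mul_zero, D.flowV.zero, qf, Prod.fst_sub, Prod.snd_sub]
    unfold qf at hq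
    have hx : z.1 ≠ w.1 := by
      intro hx
      apply hne
      refine Prod.ext hx ?_
      rw [hx] at hq
      have : w.1 ≠ 0 := by rintro h; rw [h] at hw1; simp at hw1
      exact mul_left_cancel₀ this hq
    -- Multiplying by e z.1 > 0 and using qf z = qf w turns the product of differences into (z.1 -
    -- w.1)² · (-w.2).
    have hpos : 0 < (e * z.1) * (e * ((z.1 - w.1) * (z.2 - w.2))) := by
      have : (e * z.1) * (e * ((z.1 - w.1) * (z.2 - w.2))) =
          (e * e) * ((z.1 - w.1) * (z.1 * z.2 - z.1 * w.2)) := by ring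
      rw [this, hee, hq, one_mul]
      have : (z.1 - w.1) * (w.1 * w.2 - z.1 * w.2) = (z.1 - w.1) ^ 2 * (-w.2) := by ring
      rw [this]
      exact mul_pos (by have := sub_ne_zero.2 hx; positivity) (by linarith)
    exact (pos_iff_pos_of_mul_pos hpos).1 hz1
  have hqn : ∀ t, 2 * E t ≤ nf (D.φV (e * t) z - D.φV (e * t) w) := by
    intro t
    refine le_trans ?_ (abs_qf_le _)
    have : e * qf (D.φV (e * t) z - D.φV (e * t) w) ≤ |qf (D.φV (e * t) z - D.φV (e * t) w)| := by
      rcases he with rfl | rfl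
      · rw [one_mul]; exact le_abs_self _
      · rw [neg_one_mul]; exact neg_le_abs _
    simp only [hE]; linarith
  have hge : ∀ t, 0 ≤ t → E 0 ≤ E t := fun t ht => by
    have := le_sub_of_le_deriv hdd (c := 0) ht
      (fun u _ => (mul_nonneg D.κ_pos.le (nf_nonneg _)).trans (hd u))
    linarith
  set c := D.κ * (2 * E 0) with hc
  have hc0 : 0 < c := by have := D.κ_pos; positivity
  have hgrow : ∀ t, 0 ≤ t → c * t ≤ E t := fun t ht => by
    have := le_sub_of_le_deriv hdd (c := c) ht (fun u hu => by
      refine le_trans ?_ (hd u)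
      have h1 := hqn u
      have h2 := hge u hu.1
      have := D.κ_pos
      rw [hc]; gcongr; linarith)
    linarith
  have hbdd : ∀ t, 0 ≤ t → E t ≤ 2 * (D.M + 2) * |qf z| := fun t ht => by
    have h1 := D.nf_bounded_of_not_hit he hz hzq ht
    have h2 := D.nf_bounded_of_not_hit he hw hwq ht
    rw [← hq] at h2
    have h3 : nf (D.φV (e * t) z - D.φV (e * t) w) ≤
        2 * nf (D.φV (e * t) z) + 2 * nf (D.φV (e * t) w) := by
      simp only [nf, Prod.fst_sub, Prod.snd_sub]
      nlinarith [sq_nonneg ((D.φV (e * t) z).1 + (D.φV (e * t) w).1),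
        sq_nonneg ((D.φV (e * t) z).2 + (D.φV (e * t) w).2)]
    have h4 := hqn t
    linarith
  have hB : 0 ≤ 2 * (D.M + 2) * |qf z| := by have := D.M_nonneg; positivity
  have h1 := hgrow ((2 * (D.M + 2) * |qf z| + 1) / c) (by positivity)
  have h2 := hbdd ((2 * (D.M + 2) * |qf z| + 1) / c) (by positivity)
  have h3 : c * ((2 * (D.M + 2) * |qf z| + 1) / c) = 2 * (D.M + 2) * |qf z| + 1 := by field_simp
  linarith

/-- A crossing orbit is determined by its crossing point, where qf = 0 and pf = G ≠ 0. The level G =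
0 consists of separatrices, which are moved to the same value of qf and then coincide by
`separatrix_unique`. -/
lemma exists_time_of_G_eq {e : ℝ} (he : e = 1 ∨ e = -1) {z w : Plane} (hz : z ≠ 0) (hw : w ≠ 0)
    (hz1 : 0 ≤ e * z.1) (hz2 : z.2 ≤ 0) (hw1 : 0 ≤ e * w.1) (hw2 : w.2 ≤ 0)
    (hG : D.G z = D.G w) : ∃ t, D.φV t z = w := by
  have hne : ∀ {z : Plane} {t : ℝ}, z ≠ 0 → qf (D.φV t z) = 0 → D.G z ≠ 0 := by
    intro z t hz ht h
    rw [D.G_of_hit ht] at h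
    apply D.φV_ne_zero hz t
    rw [← nf_eq_zero]
    have := nf_sq (D.φV t z)
    rw [h, ht] at this
    simpa using this
  by_cases h : ∃ t, qf (D.φV t z) = 0
  · obtain ⟨t, ht⟩ := h
    by_cases h' : ∃ t, qf (D.φV t w) = 0
    · obtain ⟨t', ht'⟩ := h'
      obtain ⟨a1, a2⟩ := D.quadrant_of_hit hz hz1 hz2 ht
      obtain ⟨b1, b2⟩ := D.quadrant_of_hit hw hw1 hw2 ht'
      have : D.φV t z = D.φV t' w := eq_of_pf_qf he a1 a2 b1 b2
        (by rw [← D.G_of_hit ht, ← D.G_of_hit ht', hG]) (by rw [ht, ht'])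
      exact ⟨-t' + t, by rw [D.flowV.add, this, D.flowV.neg_left]⟩
    · exact absurd (hG.trans (D.G_of_not_hit h')) (hne hz ht)
  · by_cases h' : ∃ t, qf (D.φV t w) = 0
    · obtain ⟨t', ht'⟩ := h'
      exact absurd (hG.symm.trans (D.G_of_not_hit h)) (hne hw ht')
    · have hopen : ∀ {z : Plane}, (¬ ∃ t, qf (D.φV t z) = 0) → 0 ≤ e * z.1 → z.2 ≤ 0 →
          0 < e * z.1 ∧ z.2 < 0 := by
        intro z h h1 h2
        have hq : qf z ≠ 0 := fun h0 => h ⟨0, by rwa [D.flowV.zero]⟩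
        refine ⟨h1.lt_of_ne' fun h0 => hq ?_, h2.lt_of_ne fun h0 => hq (by simp [qf, h0])⟩
        have : z.1 = 0 := by rcases he with rfl | rfl <;> linarith
        simp [qf, this]
      obtain ⟨a1, a2⟩ := hopen h hz1 hz2
      obtain ⟨b1, b2⟩ := hopen h' hw1 hw2
      have hq : ∀ {z : Plane}, 0 < e * z.1 → z.2 < 0 → e * qf z < 0 := by
        intro z h1 h2
        unfold qf; rw [← mul_assoc]; exact mul_neg_of_pos_of_neg h1 h2
      obtain ⟨t, ht⟩ := D.exists_level_of_not_hit he h (hq a1 a2) (hq b1 b2)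
      refine ⟨t, ?_⟩
      have hnh : ¬ ∃ s, qf (D.φV s (D.φV t z)) = 0 := by
        rintro ⟨s, hs⟩
        exact h ⟨s + t, by rwa [D.flowV.add]⟩
      have hc := D.flowV.continuous_time z
      have hx : 0 ≤ e * (D.φV t z).1 := by
        by_contra! hn
        have hc1 : Continuous (fun s => e * (D.φV s z).1) := by fun_prop
        obtain ⟨s, -, hs⟩ := intermediate_value_uIcc (a := t) (b := 0) hc1.continuousOn
          (show (0 : ℝ) ∈ _ from mem_uIcc_of_le hn.le (by simpa [D.flowV.zero] using hz1))
        have he0 : e ≠ 0 := by rintro rfl; simp at hn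
        exact h ⟨s, by simp [qf, show (D.φV s z).1 = 0 by simpa [he0] using hs]⟩
      have hy : (D.φV t z).2 ≤ 0 := by
        by_contra! hn
        have hc1 : Continuous (fun s => (D.φV s z).2) := by fun_prop
        obtain ⟨s, -, hs⟩ := intermediate_value_uIcc (a := 0) (b := t) hc1.continuousOn
          (show (0 : ℝ) ∈ _ from mem_uIcc_of_le (by simpa [D.flowV.zero] using hz2) hn.le)
        exact h ⟨s, by simp [qf, show (D.φV s z).2 = 0 from hs]⟩
      obtain ⟨c1, c2⟩ := hopen hnh hx hy
      exact D.separatrix_unique he hnh h' c1 c2 b1 b2 ht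

end FoldSaddle
end Filippov

namespace Filippov
namespace FoldSaddle

variable (D : FoldSaddle)

/-! ### The chart sending the orbits of the two fields to standard curves -/

lemma m_nonneg (x : ℝ) : 0 ≤ D.m x := by
  have key : ∀ e : ℝ, e = 1 ∨ e = -1 → ∀ u, 0 ≤ u → 0 ≤ D.m (e * u) := by
    intro e he u hu
    have := (D.m_strictMonoOn he).monotoneOn (mem_Ici.2 le_rfl) (mem_Ici.2 hu) hu
    simpa [D.m_zero] using this
  rcases le_total 0 x with h | h
  · simpa using key 1 (Or.inl rfl) x h
  · simpa using key (-1) (Or.inr rfl) (-x) (by linarith)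

/-- The normalisation of the labels `G` on the quadrant `0 ≤ e x`, `y ≤ 0`. -/
noncomputable def ψ (e u : ℝ) : ℝ := min u 0 + D.m (e * √u)

lemma ψ_continuous (e : ℝ) : Continuous (D.ψ e) := by
  have := D.m_continuous
  unfold ψ; fun_prop

lemma ψ_of_nonpos {u : ℝ} (e : ℝ) (h : u ≤ 0) : D.ψ e u = u := by
  simp [ψ, Real.sqrt_eq_zero_of_nonpos h, D.m_zero, h]

lemma ψ_of_nonneg {u : ℝ} (e : ℝ) (h : 0 ≤ u) : D.ψ e u = D.m (e * √u) := by
  simp [ψ, h]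

lemma ψ_strictMono {e : ℝ} (he : e = 1 ∨ e = -1) : StrictMono (D.ψ e) := by
  intro u v huv
  rcases le_or_gt v 0 with h | h
  · rw [D.ψ_of_nonpos e h, D.ψ_of_nonpos e (by linarith)]; exact huv
  · rw [D.ψ_of_nonneg e h.le]
    rcases le_or_gt u 0 with h' | h'
    · rw [D.ψ_of_nonpos e h']
      have := D.m_strictMonoOn he (mem_Ici.2 le_rfl) (mem_Ici.2 (Real.sqrt_nonneg v))
        (Real.sqrt_pos.2 h)
      simp only [mul_zero, D.m_zero] at this
      linarith
    · rw [D.ψ_of_nonneg e h'.le]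
      exact D.m_strictMonoOn he (mem_Ici.2 (Real.sqrt_nonneg u)) (mem_Ici.2 (Real.sqrt_nonneg v))
        (Real.sqrt_lt_sqrt h'.le huv)

lemma ψ_surjective {e : ℝ} (he : e = 1 ∨ e = -1) : Function.Surjective (D.ψ e) := by
  intro y
  refine mem_range_of_exists_le_of_exists_ge (D.ψ_continuous e) ⟨min y 0, ?_⟩ ?_
  · rw [D.ψ_of_nonpos e (min_le_right _ _)]; exact min_le_left _ _
  · obtain ⟨u, hu, h⟩ := D.m_unbounded he y
    exact ⟨u ^ 2, by rwa [D.ψ_of_nonneg e (sq_nonneg u), Real.sqrt_sq hu]⟩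

/-- The conjugacy on the switching manifold. -/
noncomputable def s (x : ℝ) : ℝ := √(D.m (max x 0)) - √(D.m (min x 0))

lemma s_continuous : Continuous D.s := by
  have := D.m_continuous
  unfold s; fun_prop

lemma s_of_nonneg {x : ℝ} (h : 0 ≤ x) : D.s x = √(D.m x) := by
  simp [s, h, D.m_zero]

lemma s_of_nonpos {x : ℝ} (h : x ≤ 0) : D.s x = -√(D.m x) := by
  simp [s, h, D.m_zero]

lemma s_zero : D.s 0 = 0 := by simp [s, D.m_zero]

lemma s_sq (x : ℝ) : D.s x ^ 2 = D.m x := by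
  rcases le_total 0 x with h | h
  · rw [D.s_of_nonneg h, Real.sq_sqrt (D.m_nonneg x)]
  · rw [D.s_of_nonpos h, neg_sq, Real.sq_sqrt (D.m_nonneg x)]

lemma s_strictMono : StrictMono D.s := by
  have hr : ∀ x y, 0 ≤ x → x < y → D.s x < D.s y := by
    intro x y hx hxy
    rw [D.s_of_nonneg hx, D.s_of_nonneg (by linarith)]
    refine Real.sqrt_lt_sqrt (D.m_nonneg x) ?_
    simpa using D.m_strictMonoOn (Or.inl rfl) (mem_Ici.2 hx) (mem_Ici.2 (by linarith)) hxy
  have hl : ∀ x y, y ≤ 0 → x < y → D.s x < D.s y := by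
    intro x y hy hxy
    rw [D.s_of_nonpos hy, D.s_of_nonpos (by linarith), neg_lt_neg_iff]
    refine Real.sqrt_lt_sqrt (D.m_nonneg y) ?_
    simpa using D.m_strictMonoOn (Or.inr rfl) (mem_Ici.2 (show 0 ≤ -y by linarith))
      (mem_Ici.2 (show 0 ≤ -x by linarith)) (by linarith)
  intro x y hxy
  rcases le_total 0 x with hx | hx
  · exact hr x y hx hxy
  rcases le_total y 0 with hy | hy
  · exact hl x y hy hxy
  · rcases hx.lt_or_eq with hx | rfl
    · have h1 := hl x 0 le_rfl hx
      rcases hy.lt_or_eq with hy | rfl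
      · exact h1.trans (hr 0 y le_rfl hy)
      · exact h1
    · exact hr 0 y le_rfl hxy

lemma s_surjective : Function.Surjective D.s := by
  intro y
  refine mem_range_of_exists_le_of_exists_ge D.s_continuous ?_ ?_
  · obtain ⟨u, hu, h⟩ := D.m_unbounded (Or.inr rfl) (y ^ 2)
    refine ⟨-1 * u, ?_⟩
    rw [D.s_of_nonpos (by linarith)]
    have := Real.sqrt_le_sqrt h
    rw [Real.sqrt_sq_eq_abs] at this
    linarith [neg_abs_le y]
  · obtain ⟨u, hu, h⟩ := D.m_unbounded (Or.inl rfl) (y ^ 2)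
    refine ⟨1 * u, ?_⟩
    rw [D.s_of_nonneg (by linarith)]
    have := Real.sqrt_le_sqrt h
    rw [Real.sqrt_sq_eq_abs] at this
    linarith [le_abs_self y]

/-- The conjugacy on the switching manifold as a homeomorphism. -/
noncomputable def sHomeo : ℝ ≃ₜ ℝ :=
  (D.s_strictMono.orderIsoOfSurjective D.s D.s_surjective).toHomeomorph

/-- The label of a point with given values of `qf` and `pf`. -/
noncomputable def T (e q p : ℝ) : ℝ := D.ψ e (D.G (sqInv e q p))

lemma T_continuous (e : ℝ) : Continuous (fun w : ℝ × ℝ => D.T e w.1 w.2) :=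
  (D.ψ_continuous e).comp (D.G_continuous.comp (sqInv_continuous e))

lemma G_sqInv_zero {e : ℝ} (he : e = 1 ∨ e = -1) (p : ℝ) : D.G (sqInv e 0 p) = p := by
  rw [D.G_of_qf (by rw [qf_sqInv]; simp), pf_sqInv he]

/-- Two points of the quadrant with the same G lie on one orbit, and along an orbit qf is strictly
monotone, so equal qf forces equal points. -/
lemma G_sqInv_injective {e : ℝ} (he : e = 1 ∨ e = -1) (q : ℝ) :
    Function.Injective (fun p => D.G (sqInv e q p)) := by
  intro p p' h
  dsimp only at h
  rcases eq_or_ne q 0 with rfl | hq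
  · rwa [D.G_sqInv_zero he, D.G_sqInv_zero he] at h
  · have hz := sqInv_ne_zero he (p := p) hq
    obtain ⟨t, ht⟩ := D.exists_time_of_G_eq he hz (sqInv_ne_zero he (p := p') hq)
      (sqInv_fst he _ _) (sqInv_snd _ _ _) (sqInv_fst he _ _) (sqInv_snd _ _ _) h
    have : t = 0 := (D.qf_strictMono hz).injective (by
      rw [ht, D.flowV.zero, qf_sqInv, qf_sqInv])
    rw [this, D.flowV.zero] at ht
    rw [← pf_sqInv he q p, ht, pf_sqInv he]

lemma G_sqInv_strictMono {e : ℝ} (he : e = 1 ∨ e = -1) (q : ℝ) :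
    StrictMono (fun p => D.G (sqInv e q p)) := by
  intro p p' h
  dsimp only
  by_contra hn
  have hc : ∀ p, Continuous (fun q => D.G (sqInv e q p)) := fun p =>
    D.G_continuous.comp (by unfold sqInv; fun_prop)
  set g : ℝ → ℝ := fun q => D.G (sqInv e q p') - D.G (sqInv e q p) with hg
  have hgc : Continuous g := (hc p').sub (hc p)
  have h0 : 0 ≤ g 0 := by simp only [hg, D.G_sqInv_zero he]; linarith
  have hx : g q ≤ 0 := by simp only [hg]; linarith
  obtain ⟨c, -, hc⟩ := intermediate_value_uIcc (a := q) (b := 0) hgc.continuousOn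
    (show (0 : ℝ) ∈ uIcc (g q) (g 0) from mem_uIcc_of_le hx h0)
  exact h.ne' (D.G_sqInv_injective he c (sub_eq_zero.1 hc))

lemma T_strictMono {e : ℝ} (he : e = 1 ∨ e = -1) (q : ℝ) : StrictMono (D.T e q) :=
  (D.ψ_strictMono he).comp (D.G_sqInv_strictMono he q)

/-- At fixed q, the map p ↦ G differs from the identity by at most M |q|, hence is onto. -/
lemma T_surjective {e : ℝ} (he : e = 1 ∨ e = -1) (q : ℝ) : Function.Surjective (D.T e q) := by
  refine (D.ψ_surjective he).comp (g := D.ψ e) (f := fun p => D.G (sqInv e q p)) ?_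
  intro y
  have hb : ∀ p, |D.G (sqInv e q p) - p| ≤ D.M * |q| := by
    intro p
    have := D.G_sub_pf (sqInv e q p)
    have h2 : |qf (sqInv e q p)| = |q| := by
      rw [qf_sqInv]; rcases he with rfl | rfl <;> simp
    rwa [pf_sqInv he, h2] at this
  refine mem_range_of_exists_le_of_exists_ge
    (D.G_continuous.comp (by unfold sqInv; fun_prop))
    ⟨y - D.M * |q|, ?_⟩ ⟨y + D.M * |q|, ?_⟩
  · have := abs_le.1 (hb (y - D.M * |q|)); linarith
  · have := abs_le.1 (hb (y + D.M * |q|)); linarith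

lemma exists_upper_inverse : ∃ S : ℝ → ℝ → ℝ, Continuous (fun q : ℝ × ℝ => S q.1 q.2) ∧
    (∀ x y, D.H (x, S x y) - D.H (x, 0) = y) ∧ ∀ x y, S x (D.H (x, y) - D.H (x, 0)) = y := by
  refine exists_fiber_inverse (T := fun x y => D.H (x, y) - D.H (x, 0)) ?_ ?_ ?_
  · have := D.H_continuous
    fun_prop
  · intro x y y' h
    have := D.H_strictMono x h
    dsimp only at this ⊢; linarith
  · intro x y
    obtain ⟨c, hc⟩ := D.H_surjective x (y + D.H (x, 0))
    exact ⟨c, by dsimp only at hc ⊢; rw [hc]; ring⟩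

/-- The upper half of the chart. -/
noncomputable def chartU (z : Plane) : Plane := (D.s z.1, D.H z - D.H (z.1, 0))

/-- The lower quadrants of the chart. -/
noncomputable def chartL (e : ℝ) (z : Plane) : Plane := sqInv e (qf z) (D.T e (qf z) (pf z))

lemma chartU_continuous : Continuous D.chartU := by
  have := D.s_continuous
  have := D.H_continuous
  unfold chartU; fun_prop

lemma chartL_continuous (e : ℝ) : Continuous (D.chartL e) := by
  have h1 := D.T_continuous e
  have h2 := sqInv_continuous e
  have h3 := qf_continuous
  have h4 := pf_continuous
  exact h2.comp (h3.prodMk (h1.comp (h3.prodMk h4)))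

lemma qf_chartL {e : ℝ} (he : e = 1 ∨ e = -1) {z : Plane} (h1 : 0 ≤ e * z.1) (h2 : z.2 ≤ 0) :
    qf (D.chartL e z) = qf z := qf_sqInv_of_le he (mul_qf_nonpos h1 h2) _

lemma pf_chartL {e : ℝ} (he : e = 1 ∨ e = -1) {z : Plane} (h1 : 0 ≤ e * z.1) (h2 : z.2 ≤ 0) :
    pf (D.chartL e z) = D.ψ e (D.G z) := by
  rw [chartL, pf_sqInv he, T, sqInv_qf_pf he h1 h2]

/-- On the axis y = 0 one has qf = 0 and G = x², and `ψ` was built to send x² to m(x) = s(x)². This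
is the compatibility that makes the two halves of the chart fit. -/
lemma chartL_eq_chartU {e : ℝ} (he : e = 1 ∨ e = -1) {x : ℝ} (h1 : 0 ≤ e * x) :
    D.chartL e (x, 0) = D.chartU (x, 0) := by
  have h2 : ((x, 0) : Plane).2 ≤ 0 := le_rfl
  refine eq_of_pf_qf he (sqInv_fst he _ _) (sqInv_snd _ _ _) ?_ ?_ ?_ ?_
  · simp only [chartU]
    have := D.s_strictMono.monotone
    rcases he with rfl | rfl
    · have := this (show 0 ≤ x by linarith); rw [D.s_zero] at this; linarith
    · have := this (show x ≤ 0 by linarith); rw [D.s_zero] at this; linarith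
  · simp [chartU]
  · rw [D.pf_chartL he h1 h2, D.G_of_qf (by simp [qf]), D.ψ_of_nonneg e (by simp [pf, sq_nonneg])]
    have : e * √(pf (x, 0)) = x := by
      rcases he with rfl | rfl
      · simp [pf, Real.sqrt_sq (show 0 ≤ x by linarith)]
      · simp [pf, Real.sqrt_sq_eq_abs, abs_of_nonpos (show x ≤ 0 by linarith)]
    rw [this]; simp [pf, chartU, D.s_sq]
  · rw [D.qf_chartL he h1 h2]; simp [qf, chartU]

/-- On the half axis x = 0, y ≤ 0 one has G = -y² ≤ 0, where `ψ` is the identity whichever the sign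
e, so the two lower quadrants fit. -/
lemma chartL_axis {e : ℝ} (he : e = 1 ∨ e = -1) {y : ℝ} (hy : y ≤ 0) :
    D.chartL e (0, y) = (0, y) := by
  refine eq_of_pf_qf he (sqInv_fst he _ _) (sqInv_snd _ _ _) (by simp) hy ?_ ?_
  · rw [D.pf_chartL he (by simp) hy, D.G_of_qf (by simp [qf]),
      D.ψ_of_nonpos e (by simp [pf, sq_nonneg])]
  · exact D.qf_chartL he (by simp) hy

/-- The inverse of the upper half of the chart. -/
noncomputable def chartUInv (z : Plane) : Plane :=
  (D.sHomeo.symm z.1, D.exists_upper_inverse.choose (D.sHomeo.symm z.1) z.2)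

lemma chartUInv_continuous : Continuous D.chartUInv := by
  have h1 := D.exists_upper_inverse.choose_spec.1
  have h2 := D.sHomeo.symm.continuous
  exact (h2.comp continuous_fst).prodMk (h1.comp ((h2.comp continuous_fst).prodMk continuous_snd))

lemma chartUInv_chartU (z : Plane) : D.chartUInv (D.chartU z) = z := by
  have h : D.sHomeo.symm (D.s z.1) = z.1 := D.sHomeo.symm_apply_apply z.1
  unfold chartUInv chartU
  refine Prod.ext h ?_
  dsimp only
  rw [h]
  exact D.exists_upper_inverse.choose_spec.2.2 z.1 z.2

lemma chartU_chartUInv (z : Plane) : D.chartU (D.chartUInv z) = z := by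
  unfold chartUInv chartU
  refine Prod.ext (D.sHomeo.apply_symm_apply z.1) ?_
  exact D.exists_upper_inverse.choose_spec.2.1 _ z.2

lemma chartU_snd_nonneg {z : Plane} : 0 ≤ (D.chartU z).2 ↔ 0 ≤ z.2 := by
  have h := (D.H_strictMono z.1).le_iff_le (a := 0) (b := z.2)
  rw [← h]
  exact sub_nonneg

lemma chartU_snd_eq_zero {z : Plane} : (D.chartU z).2 = 0 ↔ z.2 = 0 := by
  have h := (D.H_injective z.1).eq_iff (a := z.2) (b := 0)
  rw [← h]
  exact sub_eq_zero

lemma exists_lower_inverse {e : ℝ} (he : e = 1 ∨ e = -1) :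
    ∃ S : ℝ → ℝ → ℝ, Continuous (fun q : ℝ × ℝ => S q.1 q.2) ∧
    (∀ q p, D.T e q (S q p) = p) ∧ ∀ q p, S q (D.T e q p) = p :=
  exists_fiber_inverse (D.T_continuous e) (D.T_strictMono he) (D.T_surjective he)

lemma exists_chartL_inverse {e : ℝ} (he : e = 1 ∨ e = -1) : ∃ g : Plane → Plane, Continuous g ∧
    (∀ z : Plane, 0 ≤ e * (g z).1 ∧ (g z).2 ≤ 0) ∧
    (∀ z : Plane, 0 ≤ e * z.1 → z.2 ≤ 0 → g (D.chartL e z) = z) ∧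
    ∀ z : Plane, 0 ≤ e * z.1 → z.2 ≤ 0 → D.chartL e (g z) = z := by
  obtain ⟨S, hS, h1, h2⟩ := D.exists_lower_inverse he
  refine ⟨fun z => sqInv e (qf z) (S (qf z) (pf z)), (sqInv_continuous e).comp
    (qf_continuous.prodMk (hS.comp (qf_continuous.prodMk pf_continuous))),
    fun z => ⟨sqInv_fst he _ _, sqInv_snd _ _ _⟩, ?_, ?_⟩
  · intro z hz1 hz2
    dsimp only
    rw [D.qf_chartL he hz1 hz2, chartL, pf_sqInv he, h2, sqInv_qf_pf he hz1 hz2]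
  · intro z hz1 hz2
    have hq := qf_sqInv_of_le he (mul_qf_nonpos hz1 hz2) (S (qf z) (pf z))
    rw [chartL, hq, pf_sqInv he, h1, sqInv_qf_pf he hz1 hz2]

/-- A map given by continuous formulas on the upper half plane and on the lower quadrants. -/
noncomputable def glue (f g k : Plane → Plane) (z : Plane) : Plane :=
  if 0 ≤ z.2 then f z else if 0 ≤ z.1 then g z else k z

end FoldSaddle

open FoldSaddle

/-! ### Gluing continuous maps along the upper half plane and the two lower quadrants -/

section glue

variable {f g k : Plane → Plane} (hfg : ∀ x, 0 ≤ x → g (x, 0) = f (x, 0))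
  (hfk : ∀ x, x ≤ 0 → k (x, 0) = f (x, 0)) (hgk : ∀ y, y ≤ 0 → g (0, y) = k (0, y))

lemma glue_upper {z : Plane} (h : 0 ≤ z.2) : glue f g k z = f z := if_pos h

include hfg in
lemma glue_right {z : Plane} (h1 : 0 ≤ z.1) (h2 : z.2 ≤ 0) : glue f g k z = g z := by
  unfold glue
  split_ifs with h
  · rw [show z = (z.1, 0) from Prod.ext rfl (le_antisymm h2 h), hfg _ h1]
  · rfl

include hfk hgk in
lemma glue_left {z : Plane} (h1 : z.1 ≤ 0) (h2 : z.2 ≤ 0) : glue f g k z = k z := by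
  unfold glue
  split_ifs with h h'
  · rw [show z = (z.1, 0) from Prod.ext rfl (le_antisymm h2 h), hfk _ h1]
  · rw [show z = (0, z.2) from Prod.ext (le_antisymm h1 h') rfl, hgk _ h2]
  · rfl

include hfg hfk hgk in
lemma glue_continuous (hf : Continuous f) (hg : Continuous g) (hk : Continuous k) :
    Continuous (glue f g k) := by
  have hU : IsClosed {z : Plane | 0 ≤ z.2} := isClosed_le continuous_const continuous_snd
  have hR : IsClosed {z : Plane | 0 ≤ z.1 ∧ z.2 ≤ 0} :=
    (isClosed_le continuous_const continuous_fst).inter (isClosed_le continuous_snd continuous_const)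
  have hL : IsClosed {z : Plane | z.1 ≤ 0 ∧ z.2 ≤ 0} :=
    (isClosed_le continuous_fst continuous_const).inter (isClosed_le continuous_snd continuous_const)
  have c1 : ContinuousOn (glue f g k) {z : Plane | 0 ≤ z.2} :=
    hf.continuousOn.congr fun z hz => glue_upper hz
  have c2 : ContinuousOn (glue f g k) {z : Plane | 0 ≤ z.1 ∧ z.2 ≤ 0} :=
    hg.continuousOn.congr fun z hz => glue_right hfg hz.1 hz.2
  have c3 : ContinuousOn (glue f g k) {z : Plane | z.1 ≤ 0 ∧ z.2 ≤ 0} :=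
    hk.continuousOn.congr fun z hz => glue_left hfk hgk hz.1 hz.2
  have := (c1.union_of_isClosed c2 hU hR).union_of_isClosed c3 (hU.union hR) hL
  rw [← continuousOn_univ]
  refine this.mono fun z _ => ?_
  rcases le_total 0 z.2 with h | h
  · exact Or.inl (Or.inl h)
  · rcases le_total 0 z.1 with h' | h'
    · exact Or.inl (Or.inr ⟨h', h⟩)
    · exact Or.inr ⟨h', h⟩

end glue

namespace FoldSaddle

variable (D : FoldSaddle)

lemma exists_chart : ∃ c : Plane ≃ₜ Plane, (∀ z : Plane, 0 ≤ z.2 → c z = D.chartU z) ∧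
    ∀ e : ℝ, (e = 1 ∨ e = -1) → ∀ z : Plane, 0 ≤ e * z.1 → z.2 ≤ 0 → c z = D.chartL e z := by
  have h1 : (1 : ℝ) = 1 ∨ (1 : ℝ) = -1 := Or.inl rfl
  have h2 : (-1 : ℝ) = 1 ∨ (-1 : ℝ) = -1 := Or.inr rfl
  obtain ⟨g, hg, hgq, hgl, hgr⟩ := D.exists_chartL_inverse h1
  obtain ⟨k, hk, hkq, hkl, hkr⟩ := D.exists_chartL_inverse h2
  set c := glue D.chartU (D.chartL 1) (D.chartL (-1))
  set d := glue D.chartUInv g k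
  have cfg : ∀ x, 0 ≤ x → D.chartL 1 (x, 0) = D.chartU (x, 0) := fun x hx =>
    D.chartL_eq_chartU h1 (by linarith)
  have cfk : ∀ x, x ≤ 0 → D.chartL (-1) (x, 0) = D.chartU (x, 0) := fun x hx =>
    D.chartL_eq_chartU h2 (by linarith)
  have cgk : ∀ y, y ≤ 0 → D.chartL 1 (0, y) = D.chartL (-1) (0, y) := fun y hy => by
    rw [D.chartL_axis h1 hy, D.chartL_axis h2 hy]
  have hinv : ∀ x, ∃ a, D.chartUInv (x, 0) = (a, 0) ∧ D.s a = x := by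
    intro x
    have h := D.chartU_chartUInv (x, 0)
    have h0 := D.chartU_snd_eq_zero.1 (show (D.chartU (D.chartUInv (x, 0))).2 = 0 by rw [h])
    exact ⟨_, Prod.ext rfl h0, congrArg Prod.fst h⟩
  have dfg : ∀ x, 0 ≤ x → g (x, 0) = D.chartUInv (x, 0) := by
    intro x hx
    obtain ⟨a, ha, hax⟩ := hinv x
    have ha0 : 0 ≤ a := D.s_strictMono.le_iff_le.1 (by rw [D.s_zero, hax]; exact hx)
    have h := D.chartU_chartUInv (x, 0)
    rw [ha, ← cfg a ha0] at h
    rw [← h, hgl (a, 0) (by simpa using ha0) le_rfl, h, ha]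
  have dfk : ∀ x, x ≤ 0 → k (x, 0) = D.chartUInv (x, 0) := by
    intro x hx
    obtain ⟨a, ha, hax⟩ := hinv x
    have ha0 : a ≤ 0 := D.s_strictMono.le_iff_le.1 (by rw [D.s_zero, hax]; exact hx)
    have h := D.chartU_chartUInv (x, 0)
    rw [ha, ← cfk a ha0] at h
    rw [← h, hkl (a, 0) (by simpa using ha0) le_rfl, h, ha]
  have dgk : ∀ y, y ≤ 0 → g (0, y) = k (0, y) := by
    intro y hy
    have e1 := hgl (0, y) (by simp) hy
    have e2 := hkl (0, y) (by simp) hy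
    rw [D.chartL_axis h1 hy] at e1
    rw [D.chartL_axis h2 hy] at e2
    rw [e1, e2]
  have hcU : ∀ z : Plane, 0 ≤ z.2 → c z = D.chartU z := fun z hz => glue_upper hz
  have hcL : ∀ e : ℝ, (e = 1 ∨ e = -1) → ∀ z : Plane, 0 ≤ e * z.1 → z.2 ≤ 0 →
      c z = D.chartL e z := by
    rintro e (rfl | rfl) z hz1 hz2
    · exact glue_right cfg (by linarith) hz2
    · exact glue_left cfk cgk (by linarith) hz2
  have hdU : ∀ z : Plane, 0 ≤ z.2 → d z = D.chartUInv z := fun z hz => glue_upper hz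
  have hdR : ∀ z : Plane, 0 ≤ z.1 → z.2 ≤ 0 → d z = g z := fun z hz1 hz2 => glue_right dfg hz1 hz2
  have hdL : ∀ z : Plane, z.1 ≤ 0 → z.2 ≤ 0 → d z = k z :=
    fun z hz1 hz2 => glue_left dfk dgk hz1 hz2
  refine ⟨⟨⟨c, d, ?_, ?_⟩, glue_continuous cfg cfk cgk D.chartU_continuous (D.chartL_continuous 1)
    (D.chartL_continuous (-1)), glue_continuous dfg dfk dgk D.chartUInv_continuous hg hk⟩,
    hcU, hcL⟩
  · intro z
    rcases le_total 0 z.2 with h | h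
    · rw [hcU z h, hdU _ (D.chartU_snd_nonneg.2 h), D.chartUInv_chartU]
    rcases le_total 0 z.1 with h' | h'
    · have := sqInv_fst h1 (qf z) (D.T 1 (qf z) (pf z))
      rw [hcL 1 h1 z (by linarith) h, hdR (D.chartL 1 z) (by simpa [chartL] using this) (sqInv_snd _ _ _),
        hgl z (by linarith) h]
    · have := sqInv_fst h2 (qf z) (D.T (-1) (qf z) (pf z))
      rw [hcL (-1) h2 z (by linarith) h, hdL (D.chartL (-1) z) (by simpa [chartL] using this) (sqInv_snd _ _ _),
        hkl z (by linarith) h]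
  · intro z
    rcases le_total 0 z.2 with h | h
    · rw [hdU z h, hcU _ (D.chartU_snd_nonneg.1 (by rwa [D.chartU_chartUInv])),
        D.chartU_chartUInv]
    rcases le_total 0 z.1 with h' | h'
    · rw [hdR z h' h, hcL 1 h1 _ (hgq z).1 (hgq z).2, hgr z (by linarith) h]
    · rw [hdL z h' h, hcL (-1) h2 _ (hkq z).1 (hkq z).2, hkr z (by linarith) h]

/-- The homeomorphism of the plane straightening the orbits. -/
noncomputable def chart : Plane ≃ₜ Plane := D.exists_chart.choose

lemma chart_upper {z : Plane} (h : 0 ≤ z.2) : D.chart z = D.chartU z :=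
  D.exists_chart.choose_spec.1 z h

lemma chart_lower {e : ℝ} (he : e = 1 ∨ e = -1) {z : Plane} (h1 : 0 ≤ e * z.1) (h2 : z.2 ≤ 0) :
    D.chart z = D.chartL e z :=
  D.exists_chart.choose_spec.2 e he z h1 h2

lemma chart_zero : D.chart 0 = 0 := by
  rw [D.chart_upper (show 0 ≤ (0 : Plane).2 from le_rfl)]
  exact Prod.ext D.s_zero (D.chartU_snd_eq_zero.2 rfl)

lemma chart_fst_nonneg {e : ℝ} (he : e = 1 ∨ e = -1) {z : Plane} (h : 0 ≤ e * z.1) :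
    0 ≤ e * (D.chart z).1 := by
  rcases le_total 0 z.2 with h2 | h2
  · rw [D.chart_upper h2, chartU]
    have := D.s_strictMono.monotone
    rcases he with rfl | rfl
    · have := this (show 0 ≤ z.1 by linarith); rw [D.s_zero] at this; simpa using this
    · have := this (show z.1 ≤ 0 by linarith); rw [D.s_zero] at this; simpa using this
  · rw [D.chart_lower he h h2]; exact sqInv_fst he _ _

lemma chart_snd_nonpos {z : Plane} (h : z.2 ≤ 0) : (D.chart z).2 ≤ 0 := by
  rcases le_total 0 z.1 with h1 | h1
  · rw [D.chart_lower (e := 1) (Or.inl rfl) (by linarith) h]; exact sqInv_snd _ _ _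
  · rw [D.chart_lower (e := -1) (Or.inr rfl) (by linarith) h]; exact sqInv_snd _ _ _

lemma chart_snd_eq_zero {z : Plane} : (D.chart z).2 = 0 ↔ z.2 = 0 := by
  constructor
  · intro h
    rcases le_total 0 z.2 with h2 | h2
    · rw [D.chart_upper h2] at h; exact D.chartU_snd_eq_zero.1 h
    · have : ∀ e : ℝ, (e = 1 ∨ e = -1) → 0 ≤ e * z.1 → z.2 = 0 := by
        intro e he h1
        rw [D.chart_lower he h1 h2] at h
        have hq := D.qf_chartL he h1 h2
        have hp := D.pf_chartL he h1 h2
        rw [qf, h, mul_zero] at hq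
        rcases mul_eq_zero.1 hq.symm with h3 | h3
        · have hz : z = (0, z.2) := Prod.ext h3 rfl
          rw [hz, D.chartL_axis he h2] at h
          exact h
        · exact h3
      rcases le_total 0 z.1 with h1 | h1
      · exact this 1 (Or.inl rfl) (by linarith)
      · exact this (-1) (Or.inr rfl) (by linarith)
  · intro h
    rw [D.chart_upper h.ge]
    exact D.chartU_snd_eq_zero.2 h

lemma chart_snd_nonneg {z : Plane} : 0 ≤ (D.chart z).2 ↔ 0 ≤ z.2 := by
  refine ⟨fun h => ?_, fun h => by rw [D.chart_upper h]; exact D.chartU_snd_nonneg.2 h⟩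
  by_contra! hn
  have := D.chart_snd_eq_zero.1 (le_antisymm (D.chart_snd_nonpos hn.le) h)
  linarith

/-- In the chart the U-orbits are parabolas that depend on the normal form only through δ. This is
why two charts with equal δ can be compared. -/
lemma H_eq_chart {z : Plane} (h : 0 ≤ z.2) :
    D.H z = (D.chart z).2 - D.δ * (D.chart z).1 ^ 2 := by
  rw [D.chart_upper h]
  simp only [chartU, D.s_sq, m]
  linear_combination (-D.H (z.1, 0)) * D.δ_sq

lemma qf_chart {z : Plane} (h2 : z.2 ≤ 0) : qf (D.chart z) = qf z := by
  rcases le_total 0 z.1 with h1 | h1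
  · rw [D.chart_lower (e := 1) (Or.inl rfl) (by linarith) h2,
      D.qf_chartL (Or.inl rfl) (by linarith) h2]
  · rw [D.chart_lower (e := -1) (Or.inr rfl) (by linarith) h2,
      D.qf_chartL (Or.inr rfl) (by linarith) h2]

lemma pf_chart {e : ℝ} (he : e = 1 ∨ e = -1) {z : Plane} (h1 : 0 ≤ e * z.1) (h2 : z.2 ≤ 0) :
    pf (D.chart z) = D.ψ e (D.G z) := by
  rw [D.chart_lower he h1 h2, D.pf_chartL he h1 h2]

end FoldSaddle
/-! ### Absolutely continuous curves -/

section AbsCont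

variable {X Y : Type*} [PseudoMetricSpace X] [PseudoMetricSpace Y]

lemma ac_congr {f g : ℝ → X} {a b : ℝ} (hf : AbsolutelyContinuousOnInterval f a b)
    (h : EqOn f g (uIcc a b)) : AbsolutelyContinuousOnInterval g a b := by
  rw [absolutelyContinuousOnInterval_iff] at hf ⊢
  intro ε hε
  obtain ⟨d, hd, H⟩ := hf ε hε
  refine ⟨d, hd, fun E hE hs => ?_⟩
  refine lt_of_eq_of_lt (Finset.sum_congr rfl fun i hi => ?_) (H E hE hs)
  rw [h (hE.1 i hi).1, h (hE.1 i hi).2]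

lemma ac_lipschitz_comp {f : ℝ → X} {g : X → Y} {K : ℝ≥0} {S : Set X} {a b : ℝ}
    (hg : LipschitzOnWith K g S) (hf : AbsolutelyContinuousOnInterval f a b)
    (hS : MapsTo f (uIcc a b) S) : AbsolutelyContinuousOnInterval (g ∘ f) a b := by
  rw [absolutelyContinuousOnInterval_iff] at hf ⊢
  intro ε hε
  obtain ⟨d, hd, H⟩ := hf (ε / (K + 1)) (by positivity)
  refine ⟨d, hd, fun E hE hs => ?_⟩
  have h1 := H E hE hs
  rw [lt_div_iff₀ (by positivity)] at h1
  refine lt_of_le_of_lt ?_ h1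
  rw [Finset.sum_mul]
  refine Finset.sum_le_sum fun i hi => ?_
  refine (hg.dist_le_mul _ (hS (hE.1 i hi).1) _ (hS (hE.1 i hi).2)).trans ?_
  have : 0 ≤ dist (f (E.2 i).1) (f (E.2 i).2) := dist_nonneg
  nlinarith

lemma ac_comp_monotone {f : ℝ → X} {g : ℝ → ℝ} {a b c d : ℝ} (hg : Monotone g)
    (hg1 : LipschitzWith 1 g) (hf : AbsolutelyContinuousOnInterval f c d)
    (hS : MapsTo g (uIcc a b) (uIcc c d)) : AbsolutelyContinuousOnInterval (f ∘ g) a b := by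
  rw [absolutelyContinuousOnInterval_iff] at hf ⊢
  intro ε hε
  obtain ⟨δ, hδ, H⟩ := hf ε hε
  refine ⟨δ, hδ, fun E hE hs => ?_⟩
  refine H (E.1, fun i => (g (E.2 i).1, g (E.2 i).2))
    ⟨fun i hi => ⟨hS (hE.1 i hi).1, hS (hE.1 i hi).2⟩, ?_⟩ ?_
  · intro i hi j hj hij
    have h := hE.2 hi hj hij
    simp only [Function.onFun] at h ⊢
    rw [Set.disjoint_left] at h ⊢
    intro x hx hx'
    simp only [uIoc, mem_Ioc, ← hg.map_min, ← hg.map_max] at hx hx'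
    have h1 := hg.reflect_lt (hx.1.trans_le hx.2)
    have h2 := hg.reflect_lt (hx.1.trans_le hx'.2)
    have h3 := hg.reflect_lt (hx'.1.trans_le hx.2)
    have h4 := hg.reflect_lt (hx'.1.trans_le hx'.2)
    exact h (a := min (max (E.2 i).1 (E.2 i).2) (max (E.2 j).1 (E.2 j).2))
      ⟨lt_min h1 h2, min_le_left _ _⟩ ⟨lt_min h3 h4, min_le_right _ _⟩
  · refine lt_of_le_of_lt (Finset.sum_le_sum fun i _ => ?_) hs
    simpa using hg1.dist_le_mul (E.2 i).1 (E.2 i).2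

lemma ac_translate {f : ℝ → X} {a b c : ℝ}
    (hf : AbsolutelyContinuousOnInterval f (a + c) (b + c)) :
    AbsolutelyContinuousOnInterval (fun t => f (t + c)) a b := by
  refine ac_comp_monotone (g := fun t => t + c) (fun x y h => by dsimp only; linarith) ?_ hf ?_
  · exact LipschitzWith.of_dist_le_mul fun x y => by simp
  · intro t ht
    rcases mem_uIcc.1 ht with h | h
    · exact mem_uIcc.2 (Or.inl ⟨by linarith, by linarith⟩)
    · exact mem_uIcc.2 (Or.inr ⟨by linarith, by linarith⟩)

variable {E : Type*} [NormedAddCommGroup E]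

/-- f(t) = f(min(t, c)) + f(max(t, c)) - f(c), and each term is absolutely continuous as a
composition with a monotone 1-Lipschitz map. -/
lemma ac_glue {f : ℝ → E} {a b c : ℝ} (hac : a ≤ c) (hcb : c ≤ b)
    (h1 : AbsolutelyContinuousOnInterval f a c) (h2 : AbsolutelyContinuousOnInterval f c b) :
    AbsolutelyContinuousOnInterval f a b := by
  have e1 : AbsolutelyContinuousOnInterval (f ∘ fun t => min t c) a b :=
    ac_comp_monotone (fun x y h => min_le_min_right c h)
      (LipschitzWith.of_dist_le_mul fun x y => by
        simpa [Real.dist_eq] using abs_min_sub_min_le_max x c y c) h1 (fun t ht => by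
        rw [uIcc_of_le (hac.trans hcb)] at ht
        rw [uIcc_of_le hac]
        exact ⟨le_min ht.1 hac, min_le_right _ _⟩)
  have e2 : AbsolutelyContinuousOnInterval (f ∘ fun t => max t c) a b :=
    ac_comp_monotone (fun x y h => max_le_max_right c h)
      (LipschitzWith.of_dist_le_mul fun x y => by
        simpa [Real.dist_eq] using abs_max_sub_max_le_max x c y c) h2 (fun t ht => by
        rw [uIcc_of_le (hac.trans hcb)] at ht
        rw [uIcc_of_le hcb]
        exact ⟨le_max_right _ _, max_le ht.2 hcb⟩)
  have e3 : AbsolutelyContinuousOnInterval (fun _ : ℝ => f c) a b :=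
    (LipschitzWith.const (f c)).lipschitzOnWith.absolutelyContinuousOnInterval
  refine ac_congr ((e1.add e2).sub e3) fun t _ => ?_
  simp only [Pi.sub_apply, Pi.add_apply, Function.comp_apply]
  rcases le_total t c with h | h
  · rw [min_eq_left h, max_eq_right h, add_sub_cancel_right]
  · rw [min_eq_right h, max_eq_left h, add_sub_cancel_left]

lemma ac_of_hasDerivAt [NormedSpace ℝ E] {ζ v : ℝ → E} (h : ∀ t, HasDerivAt ζ (v t) t)
    (hv : Continuous v) (a b : ℝ) : AbsolutelyContinuousOnInterval ζ a b := by
  have : ContDiff ℝ 1 ζ := contDiff_one_iff_deriv.2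
    ⟨fun t => (h t).differentiableAt, by rwa [show deriv ζ = v from funext fun t => (h t).deriv]⟩
  exact this.contDiffOn.absolutelyContinuousOnInterval

/-- The difference between γ and a primitive of the continuous function V ∘ γ is absolutely
continuous with derivative zero almost everywhere, hence constant. -/
lemma hasDerivAt_of_ae [NormedSpace ℝ E] [CompleteSpace E] {γ : ℝ → E} {V : E → E} {a b : ℝ} (hab : a < b)
    (hV : Continuous V) (hγ : AbsolutelyContinuousOnInterval γ a b)
    (h : ∀ᵐ t, t ∈ Ioo a b → HasDerivAt γ (V (γ t)) t) :
    ∀ t ∈ Ioo a b, HasDerivAt γ (V (γ t)) t := by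
  have hc := hγ.continuousOn
  rw [uIcc_of_le hab.le] at hc
  set g : ℝ → E := fun t => V (IccExtend hab.le (fun t : Icc a b => γ t) t) with hg
  have hgc : Continuous g := hV.comp (continuousOn_iff_continuous_domRestrict.1 hc).Icc_extend'
  have hgeq : ∀ t ∈ Icc a b, g t = V (γ t) := fun t ht => by
    simp only [hg]; rw [IccExtend_of_mem hab.le _ ht]
  have hG : ∀ t, HasDerivAt (fun t => ∫ u in a..t, g u) (g t) t := fun t =>
    intervalIntegral.integral_hasDerivAt_right (hgc.intervalIntegrable _ _)
      (hgc.stronglyMeasurableAtFilter _ _) hgc.continuousAt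
  obtain ⟨C, hC⟩ := (hγ.sub (ac_of_hasDerivAt hG hgc a b)).const_of_ae_hasDerivAt_zero (by
    rw [uIcc_of_le hab.le]
    have hne : ∀ c : ℝ, ∀ᵐ t, t ≠ c := fun c => by simp [ae_iff]
    filter_upwards [h, hne a, hne b] with t ht h1 h2 ht'
    have := (ht ⟨lt_of_le_of_ne ht'.1 h1.symm, lt_of_le_of_ne ht'.2 h2⟩).sub (hG t)
    rwa [hgeq t ht', sub_self] at this)
  intro t ht
  have := (hG t).add_const C
  rw [hgeq t ⟨ht.1.le, ht.2.le⟩] at this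
  refine this.congr_of_eventuallyEq ?_
  filter_upwards [Ioo_mem_nhds ht.1 ht.2] with u hu
  have := hC u (by rw [uIcc_of_le hab.le]; exact ⟨hu.1.le, hu.2.le⟩)
  rw [← this, Pi.sub_apply, add_sub_cancel]

lemma le_of_ae_deriv_nonneg {f : ℝ → ℝ} {a b : ℝ} (hab : a ≤ b)
    (hf : AbsolutelyContinuousOnInterval f a b)
    (h : ∀ᵐ t, t ∈ Ioo a b → ∃ v, 0 ≤ v ∧ HasDerivAt f v t) : f a ≤ f b := by
  have h1 := hf.integral_deriv_eq_sub
  have h2 : 0 ≤ ∫ t in a..b, deriv f t := by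
    refine intervalIntegral.integral_nonneg_of_ae_restrict hab ?_
    rw [EventuallyLE, ae_restrict_iff' measurableSet_Icc]
    have hne : ∀ c : ℝ, ∀ᵐ t, t ≠ c := fun c => by simp [ae_iff]
    filter_upwards [h, hne a, hne b] with t ht h1 h2 ht'
    obtain ⟨v, hv, hd⟩ := ht ⟨lt_of_le_of_ne ht'.1 h1.symm, lt_of_le_of_ne ht'.2 h2⟩
    rw [hd.deriv]; exact hv
  linarith

lemma exists_mem_of_ae {p : ℝ → Prop} (h : ∀ᵐ t, p t) {S : Set ℝ} (hS : IsOpen S)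
    (hne : S.Nonempty) : ∃ t ∈ S, p t := by
  by_contra! hn
  have : volume S = 0 := measure_mono_null (fun t ht => hn t ht) (ae_iff.1 h)
  exact (hS.measure_pos volume hne).ne' this

end AbsCont

/-- The points of a set of times lying strictly between two other points of it. -/
def inner (K : Set ℝ) : Set ℝ := {t | (∃ s ∈ K, s < t) ∧ ∃ u ∈ K, t < u}

/-- Only a least and a greatest element of K can fail. At an inner time a convex K is a
neighbourhood, so derivatives there depend only on the values on K. -/
lemma ae_mem_inner (K : Set ℝ) : ∀ᵐ t : ℝ, t ∈ K → t ∈ inner K := by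
  have h1 : {t | t ∈ K ∧ ∀ s ∈ K, t ≤ s}.Subsingleton := fun x hx y hy =>
    le_antisymm (hx.2 y hy.1) (hy.2 x hx.1)
  have h2 : {t | t ∈ K ∧ ∀ s ∈ K, s ≤ t}.Subsingleton := fun x hx y hy =>
    le_antisymm (hy.2 x hx.1) (hx.2 y hy.1)
  have m1 := h1.measure_zero volume
  have m2 := h2.measure_zero volume
  rw [measure_eq_zero_iff_ae_notMem] at m1 m2
  filter_upwards [m1, m2] with t t1 t2 ht
  constructor
  · by_contra! h; exact t1 ⟨ht, h⟩
  · by_contra! h; exact t2 ⟨ht, h⟩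

lemma inner_subset {K : Set ℝ} (hK : K.OrdConnected) : inner K ⊆ K := by
  rintro t ⟨⟨s, hs, hst⟩, u, hu, htu⟩
  exact hK.out hs hu ⟨hst.le, htu.le⟩

lemma inner_mono {K L : Set ℝ} (h : K ⊆ L) : inner K ⊆ inner L := by
  rintro t ⟨⟨s, hs, hst⟩, u, hu, htu⟩
  exact ⟨⟨s, h hs, hst⟩, u, h hu, htu⟩

lemma Ioo_subset_inner {K : Set ℝ} {s t : ℝ} (hs : s ∈ K) (ht : t ∈ K) : Ioo s t ⊆ inner K :=
  fun _ hr => ⟨⟨s, hs, hr.1⟩, t, ht, hr.2⟩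

lemma inner_mem_nhds {K : Set ℝ} {t : ℝ} (ht : t ∈ inner K) : inner K ∈ 𝓝 t := by
  obtain ⟨⟨s, hs, hst⟩, u, hu, htu⟩ := ht
  exact mem_of_superset (Ioo_mem_nhds hst htu) (Ioo_subset_inner hs hu)

end Filippov

namespace Filippov
namespace FoldSaddle

/-! ### The conjugacy between two fold-saddles -/

lemma chart_fst_ne_zero (D : FoldSaddle) {z : Plane} (h : z.1 ≠ 0) : (D.chart z).1 ≠ 0 := by
  intro h0
  rcases le_or_gt 0 z.2 with h2 | h2
  · rw [D.chart_upper h2, chartU] at h0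
    exact h (D.s_strictMono.injective (h0.trans D.s_zero.symm))
  · have := D.qf_chart h2.le
    rw [qf, h0, zero_mul] at this
    exact mul_ne_zero h h2.ne this.symm

/-- The homeomorphism of the plane identifying the charts of two fold-saddles. -/
noncomputable def conj (Z W : FoldSaddle) : Plane ≃ₜ Plane := Z.chart.trans W.chart.symm

variable (Z W : FoldSaddle)

lemma chart_conj (z : Plane) : W.chart (conj Z W z) = Z.chart z := W.chart.apply_symm_apply _

lemma conj_zero : conj Z W 0 = 0 :=
  W.chart.injective (by rw [chart_conj, Z.chart_zero, W.chart_zero])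

lemma conj_eq_zero {z : Plane} : conj Z W z = 0 ↔ z = 0 := by
  conv_rhs => rw [← (conj Z W).injective.eq_iff, conj_zero]

lemma conj_snd_nonneg {z : Plane} : 0 ≤ (conj Z W z).2 ↔ 0 ≤ z.2 := by
  rw [← W.chart_snd_nonneg, chart_conj, Z.chart_snd_nonneg]

lemma conj_snd_eq_zero {z : Plane} : (conj Z W z).2 = 0 ↔ z.2 = 0 := by
  rw [← W.chart_snd_eq_zero, chart_conj, Z.chart_snd_eq_zero]

lemma conj_snd_pos {z : Plane} (h : 0 < z.2) : 0 < (conj Z W z).2 :=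
  lt_of_le_of_ne ((conj_snd_nonneg Z W).2 h.le) fun h0 =>
    h.ne' ((conj_snd_eq_zero Z W).1 h0.symm)

lemma conj_snd_neg {z : Plane} (h : z.2 < 0) : (conj Z W z).2 < 0 := by
  by_contra! hn
  exact h.not_ge ((conj_snd_nonneg Z W).1 hn)

lemma conj_snd_nonpos {z : Plane} (h : z.2 ≤ 0) : (conj Z W z).2 ≤ 0 := by
  rcases h.lt_or_eq with h | h
  · exact (conj_snd_neg Z W h).le
  · exact ((conj_snd_eq_zero Z W).2 h).le

lemma conj_fst_nonneg {e : ℝ} (he : e = 1 ∨ e = -1) {z : Plane} (h : 0 ≤ e * z.1) :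
    0 ≤ e * (conj Z W z).1 := by
  by_contra! hn
  have h1 := Z.chart_fst_nonneg he h
  have h2 := W.chart_fst_nonneg (e := -e) (z := conj Z W z)
    (by rcases he with rfl | rfl <;> simp) (by linarith)
  rw [chart_conj] at h2
  refine W.chart_fst_ne_zero (z := conj Z W z) (fun h0 => by rw [h0, mul_zero] at hn; exact lt_irrefl _ hn) ?_
  rw [chart_conj]
  rcases he with rfl | rfl <;> linarith

lemma s_conj {z : Plane} (h : 0 ≤ z.2) : W.s (conj Z W z).1 = Z.s z.1 := by
  have := congrArg Prod.fst (chart_conj Z W z)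
  rwa [W.chart_upper ((conj_snd_nonneg Z W).2 h), Z.chart_upper h] at this

lemma conj_fst_lt {z w : Plane} (hz : 0 ≤ z.2) (hw : 0 ≤ w.2) :
    (conj Z W z).1 < (conj Z W w).1 ↔ z.1 < w.1 := by
  rw [← W.s_strictMono.lt_iff_lt, s_conj Z W hz, s_conj Z W hw, Z.s_strictMono.lt_iff_lt]

lemma H_conj (hδ : Z.δ = W.δ) {z : Plane} (h : 0 ≤ z.2) : W.H (conj Z W z) = Z.H z := by
  rw [W.H_eq_chart ((conj_snd_nonneg Z W).2 h), chart_conj, Z.H_eq_chart h, hδ]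

lemma qf_conj {z : Plane} (h : z.2 ≤ 0) : qf (conj Z W z) = qf z := by
  rw [← W.qf_chart (conj_snd_nonpos Z W h), chart_conj, Z.qf_chart h]

/-- In a quadrant the charts give ψ_W(G_W) ∘ conj = ψ_Z(G_Z), and ψ_W is injective, so levels of G
go to levels of G. -/
lemma G_conj {e : ℝ} (he : e = 1 ∨ e = -1) {z w : Plane} (hz1 : 0 ≤ e * z.1) (hz2 : z.2 ≤ 0)
    (hw1 : 0 ≤ e * w.1) (hw2 : w.2 ≤ 0) (h : Z.G z = Z.G w) :
    W.G (conj Z W z) = W.G (conj Z W w) := by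
  apply (W.ψ_strictMono he).injective
  rw [← W.pf_chart he (conj_fst_nonneg Z W he hz1) (conj_snd_nonpos Z W hz2),
    ← W.pf_chart he (conj_fst_nonneg Z W he hw1) (conj_snd_nonpos Z W hw2),
    chart_conj, chart_conj, Z.pf_chart he hz1 hz2, Z.pf_chart he hw1 hw2, h]

/-! ### Filippov trajectories of a fold-saddle -/

variable (D : FoldSaddle) {ρ k : ℝ}

/-- The Filippov set at `z` of the field equal to `ρ U` above and to `k V` below. -/
def fset (ρ k : ℝ) (z : Plane) : Set Plane :=
  {v | (0 < z.2 ∧ v = ρ • D.U z) ∨ (z.2 < 0 ∧ v = k • D.V z) ∨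
    (z.2 = 0 ∧ v ∈ segment ℝ (ρ • D.U z) (k • D.V z))}

/-- Filippov trajectories of the field equal to `ρ U` above and to `k V` below. -/
def Traj (ρ k : ℝ) (I : Set ℝ) (γ : ℝ → Plane) : Prop :=
  I.OrdConnected ∧ (∀ a ∈ I, ∀ b ∈ I, AbsolutelyContinuousOnInterval γ a b) ∧
    ∀ᵐ t : ℝ, t ∈ I → ∃ v ∈ D.fset ρ k (γ t), HasDerivAt γ v t

/-- The sliding vector field. -/
noncomputable def slideField (ρ k : ℝ) (z : Plane) : Plane :=
  (k * (D.V z).2 - ρ * (D.U z).2)⁻¹ •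
    ((k * (D.V z).2) • (ρ • D.U z) - (ρ * (D.U z).2) • (k • D.V z))

/-- Trajectories of the sliding vector field. -/
def SlideTraj (ρ k : ℝ) (I : Set ℝ) (γ : ℝ → Plane) : Prop :=
  I.OrdConnected ∧ (∀ t ∈ I, (γ t).2 = 0 ∧ ρ * (D.U (γ t)).2 * (k * (D.V (γ t)).2) < 0) ∧
    ∀ t ∈ I, HasDerivWithinAt γ (D.slideField ρ k (γ t)) I t

variable {D}

lemma Traj.mono {I K : Set ℝ} {γ : ℝ → Plane} (h : D.Traj ρ k I γ) (hK : K.OrdConnected)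
    (hKI : K ⊆ I) : D.Traj ρ k K γ := by
  refine ⟨hK, fun a ha b hb => h.2.1 a (hKI ha) b (hKI hb), ?_⟩
  filter_upwards [h.2.2] with t ht htK using ht (hKI htK)

lemma Traj.continuousOn {I : Set ℝ} {γ : ℝ → Plane} (h : D.Traj ρ k I γ) : ContinuousOn γ I := by
  intro t ht
  rw [ContinuousWithinAt]
  by_cases hs : ∃ s ∈ I, s < t
  all_goals by_cases hu : ∃ u ∈ I, t < u
  · obtain ⟨s, hs, hst⟩ := hs
    obtain ⟨u, hu, htu⟩ := hu
    have := (h.2.1 s hs u hu).continuousOn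
    rw [uIcc_of_le (hst.trans htu).le] at this
    exact ((this t ⟨hst.le, htu.le⟩).continuousAt (Icc_mem_nhds hst htu)).tendsto.mono_left
      nhdsWithin_le_nhds
  · obtain ⟨s, hs, hst⟩ := hs
    push Not at hu
    have := (h.2.1 s hs t ht).continuousOn
    rw [uIcc_of_le hst.le] at this
    refine (this t ⟨hst.le, le_rfl⟩).mono_left ?_
    refine nhdsWithin_le_iff.2 (mem_of_superset (inter_mem_nhdsWithin I (Ioi_mem_nhds hst)) ?_)
    exact fun r hr => ⟨(mem_Ioi.1 hr.2).le, hu r hr.1⟩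
  · obtain ⟨u, hu, htu⟩ := hu
    push Not at hs
    have := (h.2.1 t ht u hu).continuousOn
    rw [uIcc_of_le htu.le] at this
    refine (this t ⟨le_rfl, htu.le⟩).mono_left ?_
    refine nhdsWithin_le_iff.2 (mem_of_superset (inter_mem_nhdsWithin I (Iio_mem_nhds htu)) ?_)
    exact fun r hr => ⟨hs r hr.1, (mem_Iio.1 hr.2).le⟩
  · push Not at hs hu
    have hI : I ⊆ {t} := fun r hr => le_antisymm (hu r hr) (hs r hr)
    exact (tendsto_nhdsWithin_mono_left hI (by simpa using tendsto_pure_nhds γ t))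

lemma Traj.congr {I : Set ℝ} {γ η : ℝ → Plane} (h : D.Traj ρ k I γ) (he : EqOn γ η I) :
    D.Traj ρ k I η := by
  refine ⟨h.1, fun a ha b hb => ac_congr (h.2.1 a ha b hb) (he.mono (h.1.uIcc_subset ha hb)), ?_⟩
  filter_upwards [h.2.2, ae_mem_inner I] with t ht hi htI
  obtain ⟨v, hv, hd⟩ := ht htI
  refine ⟨v, by rwa [← he htI], hd.congr_of_eventuallyEq ?_⟩
  filter_upwards [inner_mem_nhds (hi htI)] with r hr using (he (inner_subset h.1 hr)).symm

lemma Traj.translate {I : Set ℝ} {γ : ℝ → Plane} (h : D.Traj ρ k I γ) (c : ℝ) :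
    D.Traj ρ k ((fun t => t + c) ⁻¹' I) (fun t => γ (t + c)) := by
  refine ⟨⟨fun a ha b hb t ht => h.1.out ha hb ⟨by linarith [ht.1], by linarith [ht.2]⟩⟩,
    fun a ha b hb => ac_translate (h.2.1 _ ha _ hb), ?_⟩
  have := (measurePreserving_add_right volume c).quasiMeasurePreserving.ae h.2.2
  filter_upwards [this] with t ht htI
  obtain ⟨v, hv, hd⟩ := ht htI
  exact ⟨v, hv, HasDerivAt.comp_add_const t c hd⟩

lemma Traj.glue {I : Set ℝ} {γ : ℝ → Plane} (hI : I.OrdConnected) {c : ℝ} (hc : c ∈ I)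
    (h1 : D.Traj ρ k (I ∩ Iic c) γ) (h2 : D.Traj ρ k (I ∩ Ici c) γ) : D.Traj ρ k I γ := by
  have key : ∀ a ∈ I, ∀ b ∈ I, a ≤ b → AbsolutelyContinuousOnInterval γ a b := by
    intro a ha b hb hab
    rcases le_total b c with hbc | hbc
    · exact h1.2.1 a ⟨ha, hab.trans hbc⟩ b ⟨hb, hbc⟩
    rcases le_total c a with hca | hca
    · exact h2.2.1 a ⟨ha, hca⟩ b ⟨hb, hca.trans hab⟩
    · exact ac_glue hca hbc (h1.2.1 a ⟨ha, hca⟩ c ⟨hc, mem_Iic.2 le_rfl⟩)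
        (h2.2.1 c ⟨hc, mem_Ici.2 le_rfl⟩ b ⟨hb, hbc⟩)
  refine ⟨hI, fun a ha b hb => ?_, ?_⟩
  · rcases le_total a b with hab | hab
    · exact key a ha b hb hab
    · exact (key b hb a ha hab).symm
  · filter_upwards [h1.2.2, h2.2.2] with t t1 t2 ht
    rcases le_total t c with h | h
    · exact t1 ⟨ht, h⟩
    · exact t2 ⟨ht, h⟩

/-- The curve `c`, restricted to `I`, is an increasing reparametrisation of a trajectory. -/
def Reparam (D : FoldSaddle) (ρ k : ℝ) (c : ℝ → Plane) (K : Set ℝ) : Prop :=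
  ∃ (J : Set ℝ) (σ : ℝ → ℝ), StrictMonoOn σ J ∧ σ '' J = K ∧ D.Traj ρ k J (c ∘ σ)

/-! ### Cutting and gluing reparametrised trajectories -/

variable {c : ℝ → Plane}

lemma Reparam.of_subsingleton {K : Set ℝ} (hK : K.Subsingleton) : D.Reparam ρ k c K := by
  refine ⟨K, id, strictMonoOn_id, image_id K, ?_⟩
  refine ⟨⟨fun a ha b hb => ?_⟩, fun a ha b hb => ?_, ?_⟩
  · rw [hK ha hb, Icc_self]; exact singleton_subset_iff.2 hb
  · rw [hK ha hb]
    refine LipschitzOnWith.absolutelyContinuousOnInterval (K := 0) ?_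
    rw [uIcc_self]
    exact LipschitzOnWith.of_dist_le_mul fun x hx y hy => by
      rw [mem_singleton_iff.1 hx, mem_singleton_iff.1 hy, dist_self]; simp
  · filter_upwards [ae_mem_inner K] with t ht htK
    obtain ⟨⟨s, hs, hst⟩, -⟩ := ht htK
    exact absurd (hK hs htK) hst.ne

lemma Reparam.glue {K : Set ℝ} {a : ℝ} (ha : a ∈ K) (h1 : D.Reparam ρ k c (K ∩ Iic a))
    (h2 : D.Reparam ρ k c (K ∩ Ici a)) : D.Reparam ρ k c K := by
  obtain ⟨J₁, σ₁, hσ₁, hK₁, hT₁⟩ := h1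
  obtain ⟨J₂, σ₂, hσ₂, hK₂, hT₂⟩ := h2
  obtain ⟨j₁, hj₁, hj₁a⟩ : a ∈ σ₁ '' J₁ := hK₁ ▸ ⟨ha, mem_Iic.2 le_rfl⟩
  obtain ⟨j₂, hj₂, hj₂a⟩ : a ∈ σ₂ '' J₂ := hK₂ ▸ ⟨ha, mem_Ici.2 le_rfl⟩
  have hm₁ : ∀ j ∈ J₁, j ≤ j₁ := fun j hj => by
    rw [← hσ₁.le_iff_le hj hj₁, hj₁a]
    exact (hK₁ ▸ mem_image_of_mem σ₁ hj : σ₁ j ∈ K ∩ Iic a).2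
  have hm₂ : ∀ j ∈ J₂, j₂ ≤ j := fun j hj => by
    rw [← hσ₂.le_iff_le hj₂ hj, hj₂a]
    exact (hK₂ ▸ mem_image_of_mem σ₂ hj : σ₂ j ∈ K ∩ Ici a).2
  -- The second time domain is shifted so that it begins where the first one ends.
  set d := j₂ - j₁ with hd
  have hT₂' := hT₂.translate d
  set J₂' := (fun t => t + d) ⁻¹' J₂ with hJ₂'
  have hj₁' : j₁ ∈ J₂' := by simp only [hJ₂', mem_preimage, hd, add_sub_cancel]; exact hj₂
  have hm₂' : ∀ j ∈ J₂', j₁ ≤ j := fun j hj => by have := hm₂ _ hj; linarith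
  set σ : ℝ → ℝ := fun t => if t ≤ j₁ then σ₁ t else σ₂ (t + d) with hσ
  have e1 : EqOn σ σ₁ J₁ := fun t ht => if_pos (hm₁ t ht)
  have e2 : EqOn σ (fun t => σ₂ (t + d)) J₂' := by
    intro t ht
    by_cases h : t ≤ j₁
    · have : t = j₁ := le_antisymm h (hm₂' t ht)
      subst this
      simp only [hσ, le_refl, if_true, hj₁a, hd, add_sub_cancel, hj₂a]
    · exact if_neg h
  have i1 : (J₁ ∪ J₂') ∩ Iic j₁ = J₁ := by
    ext t
    refine ⟨?_, fun ht => ⟨Or.inl ht, hm₁ t ht⟩⟩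
    rintro ⟨ht | ht, h⟩
    · exact ht
    · rw [le_antisymm h (hm₂' t ht)]; exact hj₁
  have i2 : (J₁ ∪ J₂') ∩ Ici j₁ = J₂' := by
    ext t
    refine ⟨?_, fun ht => ⟨Or.inr ht, hm₂' t ht⟩⟩
    rintro ⟨ht | ht, h⟩
    · rw [le_antisymm (hm₁ t ht) h]; exact hj₁'
    · exact ht
  have hoc : (J₁ ∪ J₂').OrdConnected := by
    refine ⟨fun x hx y hy t ht => ?_⟩
    rcases le_total t j₁ with h | h
    · rcases hx with hx | hx
      · exact Or.inl (hT₁.1.out hx hj₁ ⟨ht.1, h⟩)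
      · exact Or.inr (hT₂'.1.out hx hj₁' ⟨ht.1, h⟩)
    · rcases hy with hy | hy
      · exact Or.inl (hT₁.1.out hj₁ hy ⟨h, ht.2⟩)
      · exact Or.inr (hT₂'.1.out hj₁' hy ⟨h, ht.2⟩)
  have m2 : StrictMonoOn σ J₂' := fun x hx y hy hxy => by
    rw [e2 hx, e2 hy]; exact hσ₂ hx hy (by linarith)
  have m1 : StrictMonoOn σ J₁ := fun x hx y hy hxy => by
    rw [e1 hx, e1 hy]; exact hσ₁ hx hy hxy
  refine ⟨J₁ ∪ J₂', σ, m1.union m2 ⟨hj₁, hm₁⟩ ⟨hj₁', hm₂'⟩, ?_, ?_⟩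
  · rw [image_union, e1.image_eq, hK₁, e2.image_eq]
    have : (fun t => σ₂ (t + d)) '' J₂' = σ₂ '' J₂ := by
      rw [show (fun t => σ₂ (t + d)) = σ₂ ∘ (fun t => t + d) from rfl, image_comp,
        image_preimage_eq _ (fun x => ⟨x - d, sub_add_cancel x d⟩)]
    rw [this, hK₂, ← inter_union_distrib_left, Iic_union_Ici, inter_univ]
  · refine Traj.glue hoc (Or.inl hj₁) ?_ ?_
    · rw [i1]; exact hT₁.congr fun t ht => by simp only [Function.comp_apply, e1 ht]
    · rw [i2]; exact hT₂'.congr fun t ht => by simp only [Function.comp_apply, e2 ht]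

/-- The cut is made at the infimum of P. Whether that point belongs to P does not matter, because
the hypotheses only concern inner points of the pieces. -/
lemma Reparam.split_upper {K : Set ℝ} (hK : K.OrdConnected) {P : Set ℝ}
    (hP : ∀ s ∈ P, ∀ t, s ≤ t → t ∈ P)
    (h1 : ∀ L ⊆ K, L.OrdConnected → inner L ⊆ P → D.Reparam ρ k c L)
    (h2 : ∀ L ⊆ K, L.OrdConnected → Disjoint (inner L) P → D.Reparam ρ k c L) :
    D.Reparam ρ k c K := by
  by_cases hd : Disjoint K P
  · exact h2 K subset_rfl hK (hd.mono_left (inner_subset hK))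
  by_cases hs : K ⊆ P
  · exact h1 K subset_rfl hK ((inner_subset hK).trans hs)
  obtain ⟨t, htK, htP⟩ := not_disjoint_iff.1 hd
  obtain ⟨s, hsK, hsP⟩ := not_subset.1 hs
  have hb : ∀ r ∈ P, s ≤ r := fun r hr => by
    by_contra! hn; exact hsP (hP r hr s hn.le)
  have hbdd : BddBelow P := ⟨s, hb⟩
  have hsa : s ≤ sInf P := le_csInf ⟨t, htP⟩ hb
  have hat : sInf P ≤ t := csInf_le hbdd htP
  refine Reparam.glue (hK.out hsK htK ⟨hsa, hat⟩) ?_ ?_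
  · refine h2 _ inter_subset_left (hK.inter ordConnected_Iic) ?_
    rw [Set.disjoint_left]
    rintro r ⟨-, u, hu, hru⟩ hr
    exact (csInf_le hbdd hr).not_gt (hru.trans_le hu.2)
  · refine h1 _ inter_subset_left (hK.inter ordConnected_Ici) ?_
    rintro r ⟨⟨u, hu, hur⟩, -⟩
    obtain ⟨q, hq, hqr⟩ := exists_lt_of_csInf_lt ⟨t, htP⟩ (lt_of_le_of_lt hu.2 hur)
    exact hP q hq r hqr.le

/-- It suffices to treat the pieces whose inner points all satisfy, or all fail, a condition
holding on a convex set of times. -/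
lemma Reparam.split {K : Set ℝ} (hK : K.OrdConnected) {P : Set ℝ} (hP : P.OrdConnected)
    (h1 : ∀ L ⊆ K, L.OrdConnected → inner L ⊆ P → D.Reparam ρ k c L)
    (h2 : ∀ L ⊆ K, L.OrdConnected → Disjoint (inner L) P → D.Reparam ρ k c L) :
    D.Reparam ρ k c K := by
  -- A convex P consists of the times that are above some point of P but not strictly above all of
  -- P. Both conditions are upward closed, so two cuts suffice.
  refine Reparam.split_upper hK (P := {t | ∃ m ∈ P, m ≤ t})
    (fun s ⟨m, hm, hms⟩ t hst => ⟨m, hm, hms.trans hst⟩) ?_ ?_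
  · intro L hLK hL hLi
    refine Reparam.split_upper hL (P := {t | ∀ m ∈ P, m < t})
      (fun s hs t hst m hm => (hs m hm).trans_le hst) ?_ ?_
    · intro M hML hM hMi
      refine h2 M (hML.trans hLK) hM (Set.disjoint_left.2 fun r hr hrP => ?_)
      exact lt_irrefl r (hMi hr r hrP)
    · intro M hML hM hMi
      refine h1 M (hML.trans hLK) hM fun r hr => ?_
      obtain ⟨m, hm, hmr⟩ := hLi (inner_mono hML hr)
      have := Set.disjoint_left.1 hMi hr
      simp only [mem_ofPred_eq, not_forall, not_lt] at this
      obtain ⟨q, hq, hrq⟩ := this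
      exact hP.out hm hq ⟨hmr, hrq⟩
  · intro L hLK hL hLi
    exact h2 L hLK hL (Set.disjoint_left.2 fun r hr hrP =>
      Set.disjoint_left.1 hLi hr ⟨r, hrP, le_rfl⟩)

/-- A curve running monotonically along a parametrised curve. -/
lemma exists_clock {K : Set ℝ} (hK : K.OrdConnected) {ζ : ℝ → Plane} {l : Plane → ℝ}
    (hc : ContinuousOn (fun t => l (c t)) K) (hm : StrictMonoOn (fun t => l (c t)) K)
    (hζ : StrictMono (fun τ => l (ζ τ))) (hr : ∀ t ∈ K, ∃ τ, ζ τ = c t) :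
    ∃ (J : Set ℝ) (σ : ℝ → ℝ), J.OrdConnected ∧ StrictMonoOn σ J ∧ σ '' J = K ∧
      ∀ τ ∈ J, c (σ τ) = ζ τ := by
  -- θ t is the parameter on ζ of the point c t. It is increasing because l orders both curves, its
  -- image is convex by the intermediate value theorem, and σ is its inverse.
  choose! θ hθ using hr
  have hθm : StrictMonoOn θ K := fun s hs t ht hst => by
    rw [← hζ.lt_iff_lt, hθ s hs, hθ t ht]; exact hm hs ht hst
  have hinv : ∀ t ∈ K, Function.invFunOn θ K (θ t) = t := fun t ht =>
    hθm.injOn.leftInvOn_invFunOn ht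
  refine ⟨θ '' K, Function.invFunOn θ K, ⟨?_⟩, ?_, ?_, ?_⟩
  · rintro _ ⟨s, hs, rfl⟩ _ ⟨t, ht, rfl⟩ τ hτ
    have hst : s ≤ t := (hθm.le_iff_le hs ht).1 (hτ.1.trans hτ.2)
    obtain ⟨r, hr, hrτ⟩ := intermediate_value_Icc hst (hc.mono (hK.out hs ht))
      (show l (ζ τ) ∈ Icc (l (c s)) (l (c t)) by
        rw [← hθ s hs, ← hθ t ht]; exact ⟨hζ.monotone hτ.1, hζ.monotone hτ.2⟩)
    have hrK := hK.out hs ht hr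
    refine ⟨r, hrK, hζ.injective ?_⟩
    rw [hθ r hrK]; exact hrτ
  · rintro _ ⟨s, hs, rfl⟩ _ ⟨t, ht, rfl⟩ hst
    rw [hinv s hs, hinv t ht]
    exact (hθm.lt_iff_lt hs ht).1 hst
  · rw [image_image]
    exact (image_congr hinv).trans (image_id' K)
  · rintro _ ⟨t, ht, rfl⟩
    rw [hinv t ht, hθ t ht]

lemma Reparam.of_clock {K : Set ℝ} (hK : K.OrdConnected) {ζ : ℝ → Plane} {l : Plane → ℝ}
    (hc : ContinuousOn (fun t => l (c t)) K) (hm : StrictMonoOn (fun t => l (c t)) K)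
    (hζ : StrictMono (fun τ => l (ζ τ))) (hr : ∀ t ∈ K, ∃ τ, ζ τ = c t)
    (hac : ∀ a b, AbsolutelyContinuousOnInterval ζ a b)
    (hd : ∀ τ, ∀ t ∈ inner K, ζ τ = c t → ∃ v ∈ D.fset ρ k (ζ τ), HasDerivAt ζ v τ) :
    D.Reparam ρ k c K := by
  obtain ⟨J, σ, hJ, hσ, hJK, he⟩ := exists_clock hK hc hm hζ hr
  refine ⟨J, σ, hσ, hJK, Traj.congr (γ := ζ) ⟨hJ, fun a _ b _ => hac a b, ?_⟩
    fun τ hτ => (he τ hτ).symm⟩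
  filter_upwards [ae_mem_inner J] with τ hτ hτJ
  obtain ⟨⟨s, hs, hsτ⟩, u, hu, hτu⟩ := hτ hτJ
  refine hd τ (σ τ) ⟨⟨σ s, hJK ▸ mem_image_of_mem σ hs, hσ hs hτJ hsτ⟩,
    σ u, hJK ▸ mem_image_of_mem σ hu, hσ hτJ hu hτu⟩ (he τ hτJ).symm

end FoldSaddle
-- Almost-everywhere solutions as flow arcs; first and last zeros
lemma sign_mul_self {e : ℝ} (he : e = 1 ∨ e = -1) : e * e = 1 := by
  rcases he with rfl | rfl <;> norm_num

lemma IsFlow.eq_of_ae {V : Plane → Plane} {φ : ℝ → Plane → Plane} (h : IsFlow V φ)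
    (hV : Continuous V) {ρ : ℝ} (hρ : ρ = 1 ∨ ρ = -1) {γ : ℝ → Plane} {s t : ℝ} (hst : s ≤ t)
    (hγ : AbsolutelyContinuousOnInterval γ s t)
    (hd : ∀ᵐ r, r ∈ Ioo s t → HasDerivAt γ (ρ • V (γ r)) r) : γ t = φ (ρ * (t - s)) (γ s) := by
  rcases hst.eq_or_lt with rfl | hst
  · rw [sub_self, mul_zero, h.zero]
  have hd' := hasDerivAt_of_ae (V := fun z => ρ • V z) hst (by fun_prop) hγ hd
  -- The equation holds only on the open interval, so the comparison with the flow starts at the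
  -- midpoint and reaches the endpoints by continuity.
  have hm : (s + t) / 2 ∈ Ioo s t := ⟨by linarith, by linarith⟩
  set m := (s + t) / 2
  have hmid : EqOn γ (fun r => φ (ρ * (r - m)) (γ m)) (Ioo s t) := by
    intro r hr
    rcases hρ with rfl | rfl
    · have := h.uniq γ s t m hm (fun u hu => by simpa only [one_smul] using hd' u hu) r hr
      simpa only [one_mul] using this
    · have := h.uniq (fun u => γ (-1 * u + 0)) (-t) (-s) (-m)
        ⟨by linarith [hm.2], by linarith [hm.1]⟩ (fun u hu => by
          have := hasDerivAt_comp_affine (-1) 0 (t := u) (hd' (-1 * u + 0)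
            ⟨by linarith [hu.2], by linarith [hu.1]⟩)
          rwa [smul_smul, neg_one_mul, neg_neg, one_smul] at this) (-r)
        ⟨by linarith [hr.2], by linarith [hr.1]⟩
      simp only [add_zero, neg_mul, one_mul, neg_neg] at this
      rw [this]
      congr 1; ring
  have hc := hγ.continuousOn
  rw [uIcc_of_le hst.le] at hc
  have hcl : EqOn γ (fun r => φ (ρ * (r - m)) (γ m)) (Icc s t) := by
    refine hmid.of_subset_closure hc ?_ Ioo_subset_Icc_self (by rw [closure_Ioo hst.ne])
    have := h.continuous_time (γ m)
    exact (this.comp (by fun_prop)).continuousOn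
  have e1 := hcl ⟨le_rfl, hst.le⟩
  have e2 := hcl ⟨hst.le, le_rfl⟩
  dsimp only at e1 e2
  rw [e2, e1, ← h.add]
  congr 1; ring

lemma IsFlow.deriv_scale {V : Plane → Plane} {φ : ℝ → Plane → Plane} (h : IsFlow V φ) (ρ : ℝ)
    (z : Plane) (t : ℝ) : HasDerivAt (fun t => φ (ρ * t) z) (ρ • V (φ (ρ * t) z)) t := by
  have := hasDerivAt_comp_affine ρ 0 (t := t) (h.deriv z (ρ * t + 0))
  simpa only [add_zero] using this

lemma exists_first_zero {f : ℝ → ℝ} {a b : ℝ} (hab : a ≤ b) (hf : ContinuousOn f (Icc a b))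
    (ha : f a < 0) (hb : 0 ≤ f b) : ∃ r ∈ Icc a b, f r = 0 ∧ ∀ s ∈ Ico a r, f s < 0 := by
  have hK : IsCompact (Icc a b ∩ f ⁻¹' {0}) := by
    have := hf.preimage_isClosed_of_isClosed isClosed_Icc (isClosed_singleton (x := (0 : ℝ)))
    exact isCompact_Icc.of_isClosed_subset this inter_subset_left
  have hne : (Icc a b ∩ f ⁻¹' {0}).Nonempty := by
    obtain ⟨r, hr, h0⟩ := intermediate_value_Icc hab hf (show (0 : ℝ) ∈ Icc (f a) (f b) from ⟨ha.le, hb⟩)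
    exact ⟨r, hr, h0⟩
  obtain ⟨r, ⟨hr, h0⟩, hmin⟩ := hK.exists_isLeast hne
  refine ⟨r, hr, h0, fun s hs => ?_⟩
  by_contra! hn
  have hsb : s ≤ b := hs.2.le.trans hr.2
  obtain ⟨q, hq, hq0⟩ := intermediate_value_Icc hs.1 (hf.mono (Icc_subset_Icc_right hsb))
    (show (0 : ℝ) ∈ Icc (f a) (f s) from ⟨ha.le, hn⟩)
  exact (hmin ⟨⟨hq.1, hq.2.trans hsb⟩, hq0⟩).not_gt (lt_of_le_of_lt hq.2 hs.2)

lemma exists_last_zero {f : ℝ → ℝ} {a b : ℝ} (hab : a ≤ b) (hf : ContinuousOn f (Icc a b))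
    (ha : 0 ≤ f a) (hb : f b < 0) : ∃ r ∈ Icc a b, f r = 0 ∧ ∀ s ∈ Ioc r b, f s < 0 := by
  obtain ⟨r, hr, h0, h⟩ := exists_first_zero (f := fun t => f (-t)) (a := -b) (b := -a)
    (by linarith) (hf.comp (by fun_prop) fun t ht => ⟨by linarith [ht.2], by linarith [ht.1]⟩)
    (by simpa using hb) (by simpa using ha)
  refine ⟨-r, ⟨by linarith [hr.2], by linarith [hr.1]⟩, h0, fun s hs => ?_⟩
  have := h (-s) ⟨by linarith [hs.2], by linarith [hs.1]⟩
  simpa using this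

namespace FoldSaddle

variable {D : FoldSaddle} {ρ k : ℝ} {I : Set ℝ} {γ : ℝ → Plane}

/-! ### Basic properties of trajectories -/

lemma Traj.snd_continuousOn (h : D.Traj ρ k I γ) : ContinuousOn (fun t => (γ t).2) I :=
  continuous_snd.comp_continuousOn h.continuousOn

lemma Traj.fst_continuousOn (h : D.Traj ρ k I γ) : ContinuousOn (fun t => (γ t).1) I :=
  continuous_fst.comp_continuousOn h.continuousOn

lemma Traj.flow_above (h : D.Traj ρ k I γ) (hρ : ρ = 1 ∨ ρ = -1) {s t : ℝ} (hs : s ∈ I)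
    (ht : t ∈ I) (hst : s ≤ t) (hy : ∀ r ∈ Ioo s t, 0 < (γ r).2) :
    γ t = D.φU (ρ * (t - s)) (γ s) := by
  refine D.flowU.eq_of_ae D.U_lip.continuous hρ hst (h.2.1 s hs t ht) ?_
  filter_upwards [h.2.2] with r hr hrst
  obtain ⟨v, hv, hd⟩ := hr (h.1.out hs ht (Ioo_subset_Icc_self hrst))
  have hy := hy r hrst
  rcases hv with ⟨-, rfl⟩ | ⟨h', -⟩ | ⟨h', -⟩
  · exact hd
  · linarith
  · linarith

lemma Traj.flow_below (h : D.Traj ρ k I γ) (hk : k = 1 ∨ k = -1) {s t : ℝ} (hs : s ∈ I)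
    (ht : t ∈ I) (hst : s ≤ t) (hy : ∀ r ∈ Ioo s t, (γ r).2 < 0) :
    γ t = D.φV (k * (t - s)) (γ s) := by
  refine D.flowV.eq_of_ae D.V_lip.continuous hk hst (h.2.1 s hs t ht) ?_
  filter_upwards [h.2.2] with r hr hrst
  obtain ⟨v, hv, hd⟩ := hr (h.1.out hs ht (Ioo_subset_Icc_self hrst))
  have hy := hy r hrst
  rcases hv with ⟨h', -⟩ | ⟨-, rfl⟩ | ⟨h', -⟩
  · linarith
  · exact hd
  · linarith

lemma kqf_strictMono (D : FoldSaddle) (hk : k = 1 ∨ k = -1) {z : Plane} (hz : z ≠ 0) :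
    StrictMono (fun t => k * qf (D.φV (k * t) z)) := by
  have h := D.qf_strictMono hz
  intro s t hst
  rcases hk with rfl | rfl
  · have := h hst; dsimp only at this ⊢; simpa only [one_mul] using this
  · have := h (show -1 * t < -1 * s by linarith)
    dsimp only at this ⊢; linarith

lemma ne_zero_of_snd_ne {z : Plane} (h : z.2 ≠ 0) : z ≠ 0 := fun h0 => h (by rw [h0]; rfl)

lemma qf_eq_zero_of_snd {z : Plane} (h : z.2 = 0) : qf z = 0 := by rw [qf, h, mul_zero]

/-- Below the axis k·qf increases strictly, while qf = 0 on the axis. Once k·qf ≥ 0 the axis is out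
of reach. -/
lemma Traj.below_forward (h : D.Traj ρ k I γ) (hk : k = 1 ∨ k = -1) {s t : ℝ} (hs : s ∈ I)
    (ht : t ∈ I) (hst : s ≤ t) (hy : (γ s).2 < 0) (hq : 0 ≤ k * qf (γ s)) : (γ t).2 < 0 := by
  by_contra! hn
  obtain ⟨r, hr, h0, hlt⟩ := exists_first_zero hst (h.snd_continuousOn.mono (h.1.out hs ht)) hy hn
  have hsr : s < r := lt_of_le_of_ne hr.1 fun e => by rw [e] at hy; exact hy.ne h0
  have hf := h.flow_below hk hs (h.1.out hs ht hr) hr.1 fun u hu => hlt u ⟨hu.1.le, hu.2⟩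
  have := D.kqf_strictMono hk (ne_zero_of_snd_ne hy.ne) (sub_pos.2 hsr)
  simp only [mul_zero, D.flowV.zero] at this
  rw [← hf, qf_eq_zero_of_snd h0, mul_zero] at this
  linarith

lemma Traj.below_backward (h : D.Traj ρ k I γ) (hk : k = 1 ∨ k = -1) {s t : ℝ} (hs : s ∈ I)
    (ht : t ∈ I) (hst : s ≤ t) (hy : (γ t).2 < 0) (hq : k * qf (γ t) ≤ 0) : (γ s).2 < 0 := by
  by_contra! hn
  obtain ⟨r, hr, h0, hlt⟩ := exists_last_zero hst (h.snd_continuousOn.mono (h.1.out hs ht)) hn hy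
  have hrt : r < t := lt_of_le_of_ne hr.2 fun e => by rw [← e] at hy; exact hy.ne h0
  have hf := h.flow_below hk (h.1.out hs ht hr) ht hr.2 fun u hu => hlt u ⟨hu.1, hu.2.le⟩
  have hne : γ r ≠ 0 := fun e => by rw [e, D.φV_zero] at hf; rw [hf] at hy; exact lt_irrefl _ hy
  have := D.kqf_strictMono hk hne (sub_pos.2 hrt)
  simp only [mul_zero, D.flowV.zero] at this
  rw [← hf, qf_eq_zero_of_snd h0, mul_zero] at this
  linarith

/-- At a time spent below the axis k·qf has a sign, and either sign keeps the trajectory below for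
all later or for all earlier times. -/
lemma Traj.above_ordConnected (h : D.Traj ρ k I γ) (hk : k = 1 ∨ k = -1) :
    {t | t ∈ I ∧ 0 ≤ (γ t).2}.OrdConnected := by
  refine ⟨fun s hs t ht r hr => ?_⟩
  have hrI := h.1.out hs.1 ht.1 hr
  refine ⟨hrI, ?_⟩
  by_contra! hn
  rcases le_total 0 (k * qf (γ r)) with hq | hq
  · exact ht.2.not_gt (h.below_forward hk hrI ht.1 hr.2 hn hq)
  · exact hs.2.not_gt (h.below_backward hk hs.1 hrI hr.1 hn hq)

lemma V_snd (D : FoldSaddle) (x : ℝ) : D.κ * x ^ 2 ≤ x * (D.V (x, 0)).2 := by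
  simpa [nf] using D.V_zero_mono (x, 0)

lemma fset_fst_pos (hρ : ρ = 1 ∨ ρ = -1) {z v : Plane} (hv : v ∈ D.fset ρ k z) (hz : 0 < z.2) :
    v = ρ • D.U z ∧ 0 < ρ * v.1 := by
  rcases hv with ⟨-, rfl⟩ | ⟨h', -⟩ | ⟨h', -⟩
  · refine ⟨rfl, ?_⟩
    rw [Prod.smul_fst, smul_eq_mul, ← mul_assoc, sign_mul_self hρ, one_mul]
    exact D.κ_pos.trans_le (D.U_fst z)
  · linarith
  · linarith

/-- Let v = aρU + bkV with v₂ = 0. Off the origin x V₂ > 0, so a > 0, and eliminating b gives x V₂ ·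
ρv₁ = a x (V₂U₁ - U₂V₁), positive by `slide`. Moreover ρU₂ and kV₂ must have opposite signs, which
is ρδ = -k. At the origin V vanishes and only the term aρU remains. -/
lemma fset_tangent (hρ : ρ = 1 ∨ ρ = -1) (hk : k = 1 ∨ k = -1) {z v : Plane}
    (hv : v ∈ D.fset ρ k z) (hz : z.2 = 0) (hv2 : v.2 = 0) :
    0 ≤ ρ * v.1 ∧ (z ≠ 0 → 0 < ρ * v.1 ∧ ρ * D.δ = -k) := by
  obtain ⟨x, y⟩ := z
  simp only at hz
  subst hz
  rcases hv with ⟨h', -⟩ | ⟨h', -⟩ | ⟨-, hv⟩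
  · exact absurd h' (lt_irrefl _)
  · exact absurd h' (lt_irrefl _)
  obtain ⟨a, b, ha, hb, hab, rfl⟩ := hv
  have hρ2 := sign_mul_self hρ
  have hk2 := sign_mul_self hk
  simp only [Prod.snd_add, Prod.smul_snd, smul_eq_mul, Prod.fst_add, Prod.smul_fst] at hv2 ⊢
  have hU1 := D.κ_pos.trans_le (D.U_fst (x, 0))
  rcases eq_or_ne x 0 with rfl | hx
  · have h0 : ((0, 0) : Plane) = 0 := rfl
    refine ⟨?_, fun h => absurd rfl h⟩
    rw [h0, D.V_zero] at *
    simp only [Prod.fst_zero, mul_zero, add_zero]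
    calc (0 : ℝ) ≤ a * (D.U 0).1 := mul_nonneg ha hU1.le
      _ = ρ * (a * (ρ * (D.U 0).1)) := by linear_combination (-a * (D.U 0).1) * hρ2
  · have hκ := D.κ_pos
    have hx2 : 0 < x ^ 2 := by positivity
    have hxV : 0 < x * (D.V (x, 0)).2 := (mul_pos hκ hx2).trans_le (D.V_snd x)
    have hxU := D.U_snd x hx
    have hsl := D.slide x
    set U1 := (D.U (x, 0)).1
    set U2 := (D.U (x, 0)).2
    set V1 := (D.V (x, 0)).1
    set V2 := (D.V (x, 0)).2
    have ha0 : 0 < a := by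
      refine lt_of_le_of_ne ha fun h0 => ?_
      rw [← h0] at hv2 hab
      have hb1 : b = 1 := by linarith
      rw [hb1] at hv2
      have : V2 = 0 := by rcases hk with rfl | rfl <;> linarith
      rw [this, mul_zero] at hxV
      exact lt_irrefl _ hxV
    have hid : x * V2 * (ρ * (a * (ρ * U1) + b * (k * V1))) = a * (x * (V2 * U1 - U2 * V1)) := by
      linear_combination (a * U1 * x * V2 - a * x * U2 * V1) * hρ2 + ρ * x * V1 * hv2
    have hpos : 0 < ρ * (a * (ρ * U1) + b * (k * V1)) := by
      refine pos_of_mul_pos_right (a := x * V2) ?_ hxV.le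
      rw [hid]
      exact mul_pos ha0 ((mul_pos hκ hx2).trans_le hsl)
    refine ⟨hpos.le, fun _ => ⟨hpos, ?_⟩⟩
    rcases D.δ_eq with hδ | hδ <;> rcases hρ with rfl | rfl <;> rcases hk with rfl | rfl <;>
      rw [hδ] at hxU ⊢ <;> first
        | (norm_num; done)
        | (exfalso
           have e1 := mul_pos ha0 hxU
           have e2 := mul_nonneg hb hxV.le
           have e3 : x * (a * U2) + x * (b * V2) = 0 := by linear_combination x * hv2
           linarith)
        | (exfalso
           have e1 := mul_pos ha0 hxU
           have e2 := mul_nonneg hb hxV.le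
           have e3 : x * (a * U2) + x * (b * V2) = 0 := by linear_combination -x * hv2
           linarith)
        | (exfalso
           have e1 := mul_pos ha0 hxU
           have e2 := mul_nonneg hb hxV.le
           have e3 : x * (a * U2) - x * (b * V2) = 0 := by linear_combination x * hv2
           linarith)
        | (exfalso
           have e1 := mul_pos ha0 hxU
           have e2 := mul_nonneg hb hxV.le
           have e3 : x * (a * U2) - x * (b * V2) = 0 := by linear_combination -x * hv2
           linarith)

/-- At an inner time on the axis the height has a local minimum, so its derivative vanishes there.
-/
lemma Traj.ae_above (h : D.Traj ρ k I γ) (hy : ∀ t ∈ inner I, 0 ≤ (γ t).2) :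
    ∀ᵐ t, t ∈ I → ∃ v ∈ D.fset ρ k (γ t), HasDerivAt γ v t ∧ ((γ t).2 = 0 → v.2 = 0) := by
  filter_upwards [h.2.2, ae_mem_inner I] with t ht hti htI
  obtain ⟨v, hv, hd⟩ := ht htI
  refine ⟨v, hv, hd, fun h0 => ?_⟩
  refine IsLocalMin.hasDerivAt_eq_zero (f := fun t => (γ t).2) ?_ (hasDerivAt_snd hd)
  filter_upwards [inner_mem_nhds (hti htI)] with r hr
  rw [h0]; exact hy r hr

lemma Traj.ac_fst (h : D.Traj ρ k I γ) {s t : ℝ} (hs : s ∈ I) (ht : t ∈ I) :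
    AbsolutelyContinuousOnInterval (fun t => (γ t).1) s t :=
  ac_lipschitz_comp (g := Prod.fst) LipschitzWith.prod_fst.lipschitzOnWith (h.2.1 s hs t ht)
    (mapsTo_univ _ _)

lemma Traj.monotone_fst (h : D.Traj ρ k I γ) (hρ : ρ = 1 ∨ ρ = -1) (hk : k = 1 ∨ k = -1)
    (hy : ∀ t ∈ inner I, 0 ≤ (γ t).2) : MonotoneOn (fun t => ρ * (γ t).1) I := by
  intro s hs t ht hst
  refine le_of_ae_deriv_nonneg (f := fun t => ρ * (γ t).1) hst ((h.ac_fst hs ht).const_mul ρ) ?_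
  filter_upwards [h.ae_above hy] with r hr hrst
  have hrI := h.1.out hs ht (Ioo_subset_Icc_self hrst)
  obtain ⟨v, hv, hd, hv0⟩ := hr hrI
  refine ⟨ρ * v.1, ?_, (hasDerivAt_fst hd).const_mul ρ⟩
  rcases (hy r (Ioo_subset_inner hs ht hrst)).lt_or_eq with h' | h'
  · exact (fset_fst_pos hρ hv h').2.le
  · exact (fset_tangent hρ hk hv h'.symm (hv0 h'.symm)).1

lemma eq_zero_of_locally_const {γ : ℝ → Plane} {v : Plane} {s t r : ℝ} (hr : r ∈ Ioo s t)
    (hd : HasDerivAt γ v r) {ρ : ℝ} (h : MonotoneOn (fun t => ρ * (γ t).1) (Icc s t))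
    (he : ρ * (γ s).1 = ρ * (γ t).1) : ρ * v.1 = 0 := by
  have h1 := (hasDerivAt_fst hd).const_mul ρ
  have hst := (hr.1.trans hr.2).le
  have h2 : HasDerivAt (fun t => ρ * (γ t).1) 0 r := by
    refine (hasDerivAt_const r (ρ * (γ s).1)).congr_of_eventuallyEq ?_
    filter_upwards [Ioo_mem_nhds hr.1 hr.2] with u hu
    refine le_antisymm ?_ ?_
    · rw [he]; exact h (Ioo_subset_Icc_self hu) (right_mem_Icc.2 hst) hu.2.le
    · exact h (left_mem_Icc.2 hst) (Ioo_subset_Icc_self hu) hu.1.le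
  exact h1.unique h2

lemma Traj.strictMono_fst (h : D.Traj ρ k I γ) (hρ : ρ = 1 ∨ ρ = -1) (hk : k = 1 ∨ k = -1)
    (hy : ∀ t ∈ inner I, 0 ≤ (γ t).2) (h0 : ∀ t ∈ inner I, γ t ≠ 0) :
    StrictMonoOn (fun t => ρ * (γ t).1) I := by
  intro s hs t ht hst
  have hm := h.monotone_fst hρ hk hy
  refine lt_of_le_of_ne (hm hs ht hst.le) fun he => ?_
  obtain ⟨r, hr, hr2⟩ := exists_mem_of_ae (h.ae_above hy) isOpen_Ioo (nonempty_Ioo.2 hst)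
  obtain ⟨v, hv, hd, hv0⟩ := hr2 (h.1.out hs ht (Ioo_subset_Icc_self hr))
  have hz := eq_zero_of_locally_const hr hd (hm.mono (h.1.out hs ht)) he
  have hri := Ioo_subset_inner hs ht hr
  rcases (hy r hri).lt_or_eq with h' | h'
  · exact (fset_fst_pos hρ hv h').2.ne' hz
  · exact ((fset_tangent hρ hk hv h'.symm (hv0 h'.symm)).2 (h0 r hri)).1.ne' hz

/-- Between two visits to the origin the monotone function ρx is constant, so x = 0. A stay at
positive height is then impossible, since there ρx has positive derivative. -/
lemma Traj.zeros_ordConnected (h : D.Traj ρ k I γ) (hρ : ρ = 1 ∨ ρ = -1) (hk : k = 1 ∨ k = -1)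
    (hy : ∀ t ∈ inner I, 0 ≤ (γ t).2) : {t | t ∈ I ∧ γ t = 0}.OrdConnected := by
  refine ⟨fun s hs t ht r hr => ?_⟩
  have hm := h.monotone_fst hρ hk hy
  have hrI := h.1.out hs.1 ht.1 hr
  refine ⟨hrI, ?_⟩
  rcases hr.1.eq_or_lt with rfl | hsr
  · exact hs.2
  rcases hr.2.eq_or_lt with rfl | hrt
  · exact ht.2
  have hxs : ρ * (γ s).1 = 0 := by rw [hs.2]; simp
  have hxt : ρ * (γ t).1 = 0 := by rw [ht.2]; simp
  have hx : (γ r).1 = 0 := by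
    have h1 := hm hs.1 hrI hr.1
    have h2 := hm hrI ht.1 hr.2
    dsimp only at h1 h2
    have : ρ * (γ r).1 = 0 := by linarith
    rcases hρ with rfl | rfl <;> linarith
  have hyr := hy r (Ioo_subset_inner hs.1 ht.1 ⟨hsr, hrt⟩)
  rcases hyr.lt_or_eq with hpos | h0
  · exfalso
    have hcont := h.snd_continuousOn.mono ((Ioo_subset_Icc_self).trans (h.1.out hs.1 ht.1))
    have hop := hcont.isOpen_inter_preimage isOpen_Ioo (isOpen_Ioi (a := (0 : ℝ)))
    obtain ⟨u, hu, hu2⟩ := exists_mem_of_ae h.2.2 hop ⟨r, ⟨hsr, hrt⟩, hpos⟩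
    obtain ⟨v, hv, hd⟩ := hu2 (h.1.out hs.1 ht.1 (Ioo_subset_Icc_self hu.1))
    have hz := eq_zero_of_locally_const hu.1 hd (hm.mono (h.1.out hs.1 ht.1)) (hxs.trans hxt.symm)
    exact (fset_fst_pos hρ hv hu.2).2.ne' hz
  · exact Prod.ext hx h0.symm

lemma m_le_m (D : FoldSaddle) {e a b : ℝ} (he : e = 1 ∨ e = -1) (ha : 0 ≤ e * a)
    (hab : e * a ≤ e * b) : D.m a ≤ D.m b := by
  have := (D.m_strictMonoOn he).monotoneOn (mem_Ici.2 ha) (mem_Ici.2 (ha.trans hab)) hab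
  simpa only [← mul_assoc, sign_mul_self he, one_mul] using this

lemma H_fst_zero (D : FoldSaddle) (x : ℝ) : D.H (x, 0) = -(D.δ * D.m x) := by
  simp only [m]; linear_combination (-D.H (x, 0)) * D.δ_sq

lemma fst_le_flow (D : FoldSaddle) (hρ : ρ = 1 ∨ ρ = -1) {z : Plane} {τ : ℝ} (hτ : 0 ≤ τ) :
    ρ * z.1 ≤ ρ * (D.φU (ρ * τ) z).1 := by
  have h := (D.U_strictMono z).monotone
  have hz : (D.φU 0 z).1 = z.1 := by rw [D.flowU.zero]
  rcases hρ with rfl | rfl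
  · have := h (show 0 ≤ 1 * τ by linarith); dsimp only at this; rw [hz] at this; linarith
  · have := h (show -1 * τ ≤ 0 by linarith); dsimp only at this; rw [hz] at this; linarith

lemma snd_le_of_H (D : FoldSaddle) {z w : Plane} (hz : z.2 = 0) (h : D.H z = D.H w)
    (hm : D.δ * D.m w.1 ≤ D.δ * D.m z.1) : w.2 ≤ 0 := by
  have := (D.H_strictMono w.1).le_iff_le (a := w.2) (b := 0)
  refine this.1 ?_
  rw [D.H_fst_zero]
  change D.H w ≤ _
  rw [← h, show z = (z.1, 0) from Prod.ext rfl hz, D.H_fst_zero]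
  linarith

/-- In the region ρδx ≤ 0 the quantity δ m(x) does not increase along the motion, so H(x, 0) = -δ
m(x) does not decrease. As H is constant on the arc, the arc ends at or below the axis. -/
lemma arc_forward (D : FoldSaddle) (hρ : ρ = 1 ∨ ρ = -1) {z : Plane} {τ : ℝ} (hτ : 0 ≤ τ)
    (hz : z.2 = 0) (h2 : ρ * D.δ * (D.φU (ρ * τ) z).1 ≤ 0) (h1 : ρ * D.δ * z.1 ≤ 0) :
    (D.φU (ρ * τ) z).2 ≤ 0 := by
  have hx := D.fst_le_flow hρ (z := z) hτ
  refine D.snd_le_of_H hz (D.H_flow _ _).symm ?_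
  rcases D.δ_eq with hδ | hδ <;> rw [hδ] at h1 h2 ⊢
  · have := D.m_le_m (e := -ρ) (a := (D.φU (ρ * τ) z).1) (b := z.1)
      (by rcases hρ with rfl | rfl <;> simp) (by linarith) (by linarith)
    linarith
  · have := D.m_le_m (e := ρ) (b := (D.φU (ρ * τ) z).1) (a := z.1) hρ (by linarith) (by linarith)
    linarith

lemma arc_backward (D : FoldSaddle) (hρ : ρ = 1 ∨ ρ = -1) {z : Plane} {τ : ℝ} (hτ : 0 ≤ τ)
    (hw : (D.φU (ρ * τ) z).2 = 0) (h2 : 0 ≤ ρ * D.δ * (D.φU (ρ * τ) z).1)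
    (h1 : 0 ≤ ρ * D.δ * z.1) : z.2 ≤ 0 := by
  have hx := D.fst_le_flow hρ (z := z) hτ
  refine D.snd_le_of_H hw (D.H_flow _ _) ?_
  rcases D.δ_eq with hδ | hδ <;> rw [hδ] at h1 h2 ⊢
  · have := D.m_le_m (e := ρ) (b := (D.φU (ρ * τ) z).1) (a := z.1) hρ (by linarith) (by linarith)
    linarith
  · have := D.m_le_m (e := -ρ) (a := (D.φU (ρ * τ) z).1) (b := z.1)
      (by rcases hρ with rfl | rfl <;> simp) (by linarith) (by linarith)
    linarith

/-- Otherwise the last visit to the axis before t would be followed by an upper arc, which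
`arc_forward` forces back to height at most 0. The region ρδx < 0 is where the upper field points
down to the axis. -/
lemma Traj.trapped_forward (h : D.Traj ρ k I γ) (hρ : ρ = 1 ∨ ρ = -1) {s t : ℝ} (hs : s ∈ I)
    (ht : t ∈ I) (hst : s ≤ t) (hy : 0 ≤ (γ t).2) (h0 : (γ s).2 = 0)
    (hx : ∀ r ∈ Icc s t, ρ * D.δ * (γ r).1 ≤ 0) : (γ t).2 = 0 := by
  by_contra hn
  have hpos := lt_of_le_of_ne hy (Ne.symm hn)
  obtain ⟨r, hr, hr0, hlt⟩ := exists_last_zero hst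
    ((h.snd_continuousOn.mono (h.1.out hs ht)).neg) (by simp [h0]) (by simpa using hpos)
  replace hr0 : (γ r).2 = 0 := by simpa using hr0
  have hf := h.flow_above hρ (h.1.out hs ht hr) ht hr.2 fun u hu => by
    simpa using hlt u ⟨hu.1, hu.2.le⟩
  have := D.arc_forward hρ (z := γ r) (sub_nonneg.2 hr.2) hr0
    (by rw [← hf]; exact hx t (right_mem_Icc.2 hst)) (hx r hr)
  rw [← hf] at this
  linarith

lemma Traj.trapped_backward (h : D.Traj ρ k I γ) (hρ : ρ = 1 ∨ ρ = -1) {s t : ℝ} (hs : s ∈ I)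
    (ht : t ∈ I) (hst : s ≤ t) (hy : 0 ≤ (γ s).2) (h0 : (γ t).2 = 0)
    (hx : ∀ r ∈ Icc s t, 0 ≤ ρ * D.δ * (γ r).1) : (γ s).2 = 0 := by
  by_contra hn
  have hpos := lt_of_le_of_ne hy (Ne.symm hn)
  obtain ⟨r, hr, hr0, hlt⟩ := exists_first_zero hst
    ((h.snd_continuousOn.mono (h.1.out hs ht)).neg) (by simpa using hpos) (by simp [h0])
  replace hr0 : (γ r).2 = 0 := by simpa using hr0
  have hf := h.flow_above hρ hs (h.1.out hs ht hr) hr.1 fun u hu => by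
    simpa using hlt u ⟨hu.1.le, hu.2⟩
  have := D.arc_backward hρ (z := γ s) (sub_nonneg.2 hr.1) (by rw [← hf]; exact hr0)
    (by rw [← hf]; exact hx r hr) (hx s (left_mem_Icc.2 hst))
  linarith

end FoldSaddle
end Filippov

namespace Filippov
namespace FoldSaddle

/-! ### The sliding motion -/

/-- Numerator of the speed of the sliding motion. -/
noncomputable def slideNum (D : FoldSaddle) (x : ℝ) : ℝ :=
  (D.V (x, 0)).2 * (D.U (x, 0)).1 - (D.U (x, 0)).2 * (D.V (x, 0)).1

/-- Denominator of the speed of the sliding motion. -/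
noncomputable def slideDen (D : FoldSaddle) (x : ℝ) : ℝ := (D.V (x, 0)).2 + D.δ * (D.U (x, 0)).2

variable (D : FoldSaddle)

lemma slideNum_continuous : Continuous D.slideNum := by
  have := D.U_lip.continuous
  have := D.V_lip.continuous
  unfold slideNum; fun_prop

lemma slideDen_continuous : Continuous D.slideDen := by
  have := D.U_lip.continuous
  have := D.V_lip.continuous
  unfold slideDen; fun_prop

lemma slideDen_lower {x : ℝ} (hx : x ≠ 0) : D.κ * x ^ 2 ≤ x * D.slideDen x := by
  have h1 := D.V_snd x
  have h2 := D.U_snd x hx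
  unfold slideDen
  nlinarith

lemma slideDen_upper (x : ℝ) : |D.slideDen x| ≤ 2 * D.K * |x| := by
  have hn : ‖((x, 0) : Plane) - 0‖ = |x| := by simp [Prod.norm_def]
  have h1 := D.V_lip.norm_sub_le (x, 0) 0
  have h2 := D.U_lip.norm_sub_le (x, 0) 0
  rw [hn] at h1 h2
  have h1' := (norm_snd_le _).trans h1
  have h2' := (norm_snd_le _).trans h2
  rw [Prod.snd_sub, D.V_zero, Prod.snd_zero, sub_zero, Real.norm_eq_abs] at h1'
  rw [Prod.snd_sub, D.U_zero, sub_zero, Real.norm_eq_abs] at h2'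
  have hδ : |D.δ| = 1 := by rcases D.δ_eq with h | h <;> rw [h] <;> simp
  calc |D.slideDen x| ≤ |(D.V (x, 0)).2| + |D.δ * (D.U (x, 0)).2| := abs_add_le _ _
    _ ≤ 2 * D.K * |x| := by rw [abs_mul, hδ]; linarith

/-- Numerator and denominator are both comparable with |x|, above and below, and both have the sign
of x. -/
lemma slide_ratio_bounds : ∃ c > 0, ∃ C, ∀ x, x ≠ 0 →
    0 < D.slideNum x / D.slideDen x ∧
    c ≤ D.slideDen x / D.slideNum x ∧ D.slideDen x / D.slideNum x ≤ C := by
  obtain ⟨C, hC⟩ := D.slide_le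
  have hκ := D.κ_pos
  have hC0 : 0 < |C| + 1 := by positivity
  refine ⟨D.κ / (|C| + 1), by positivity, 2 * D.K / D.κ, fun x hx => ?_⟩
  have hx0 := abs_pos.2 hx
  have hx2 : |x| * |x| = x ^ 2 := by rw [abs_mul_abs_self]; ring
  have n1 : D.κ * |x| ≤ |D.slideNum x| := by
    have := (D.slide x).trans (le_abs_self _)
    rw [abs_mul] at this
    change _ ≤ |x| * |D.slideNum x| at this
    nlinarith
  have n2 : |D.slideNum x| ≤ (|C| + 1) * |x| := (hC x).trans (by nlinarith [le_abs_self C])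
  have d1 : D.κ * |x| ≤ |D.slideDen x| := by
    have := (D.slideDen_lower hx).trans (le_abs_self _)
    rw [abs_mul] at this
    nlinarith
  have d2 := D.slideDen_upper x
  have hp : 0 < D.slideNum x * D.slideDen x := by
    have e1 := (mul_pos hκ (show 0 < x ^ 2 by positivity)).trans_le (D.slide x)
    have e2 := (mul_pos hκ (show 0 < x ^ 2 by positivity)).trans_le (D.slideDen_lower hx)
    change 0 < x * D.slideNum x at e1
    have e3 : 0 < x ^ 2 * (D.slideNum x * D.slideDen x) := by nlinarith
    exact pos_of_mul_pos_right e3 (sq_nonneg x)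
  have hn0 : 0 < |D.slideNum x| := (mul_pos hκ hx0).trans_le n1
  have hr : D.slideDen x / D.slideNum x = |D.slideDen x| / |D.slideNum x| := by
    rw [← abs_div, abs_of_pos]
    rwa [← div_pos_iff_of_pos_right (show 0 < D.slideNum x ^ 2 by
      have := abs_pos.1 hn0; positivity), pow_two, mul_div_mul_left _ _ (abs_pos.1 hn0)] at hp
  refine ⟨?_, ?_, ?_⟩
  · rcases mul_pos_iff.1 hp with h | h
    · exact div_pos h.1 h.2
    · exact div_pos_of_neg_of_neg h.1 h.2
  · rw [hr, div_le_div_iff₀ hC0 hn0]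
    nlinarith
  · rw [hr, div_le_div_iff₀ hn0 hκ]
    have : (0 : ℝ) ≤ D.K := D.K.2
    nlinarith

/-- The sliding speed need not extend continuously to 0, so the curve is built as the inverse of a
primitive of the reciprocal speed. The bounds on the speed make it Lipschitz and onto, passing
through the origin. -/
lemma exists_slideCurve : ∃ Q : ℝ → ℝ, StrictMono Q ∧ Function.Surjective Q ∧
    (∃ C, LipschitzWith C Q) ∧
    ∀ τ, Q τ ≠ 0 → HasDerivAt Q (D.slideNum (Q τ) / D.slideDen (Q τ)) τ := by
  obtain ⟨c, hc, C, hb⟩ := D.slide_ratio_bounds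
  -- The value at 0 does not affect the primitive; c keeps the bounds valid everywhere.
  set g : ℝ → ℝ := fun x => if x = 0 then c else D.slideDen x / D.slideNum x with hg
  have hcC : c ≤ C := (hb 1 one_ne_zero).2.1.trans (hb 1 one_ne_zero).2.2
  have hgb : ∀ x, c ≤ g x ∧ g x ≤ C := by
    intro x
    simp only [hg]
    split_ifs with h
    · exact ⟨le_rfl, hcC⟩
    · exact (hb x h).2
  have hgm : Measurable g := Measurable.ite (measurableSet_singleton 0) measurable_const
    (D.slideDen_continuous.measurable.div D.slideNum_continuous.measurable)
  have hgi : ∀ a b, IntervalIntegrable g volume a b := fun a b =>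
    (intervalIntegrable_const (c := C)).mono_fun' hgm.aestronglyMeasurable
      (Eventually.of_forall fun x => by
        change ‖g x‖ ≤ C
        rw [Real.norm_eq_abs, abs_of_pos (hc.trans_le (hgb x).1)]; exact (hgb x).2)
  set F : ℝ → ℝ := fun x => ∫ u in (0 : ℝ)..x, g u with hF
  have hFd : ∀ x, x ≠ 0 → HasDerivAt F (D.slideDen x / D.slideNum x) x := by
    intro x hx
    have hn : D.slideNum x ≠ 0 := fun h0 => by
      have := (hb x hx).1; rw [h0, zero_div] at this; exact lt_irrefl _ this
    have hev : g =ᶠ[𝓝 x] fun x => D.slideDen x / D.slideNum x := by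
      filter_upwards [isOpen_ne.mem_nhds hx] with u hu using if_neg hu
    have hgc : ContinuousAt g x :=
      (D.slideDen_continuous.continuousAt.div D.slideNum_continuous.continuousAt hn).congr hev.symm
    have := intervalIntegral.integral_hasDerivAt_right (hgi 0 x)
      (hgm.stronglyMeasurable.stronglyMeasurableAtFilter) hgc
    rwa [hev.eq_of_nhds] at this
  have hFm : ∀ a b, a ≤ b → c * (b - a) ≤ F b - F a := by
    intro a b hab
    rw [hF, intervalIntegral.integral_interval_sub_left (hgi _ _) (hgi _ _)]
    have := intervalIntegral.integral_mono_on hab (intervalIntegrable_const (c := c)) (hgi a b)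
      (fun x _ => (hgb x).1)
    rw [intervalIntegral.integral_const, smul_eq_mul] at this
    linarith
  have hFs : StrictMono F := fun a b hab => by
    have := hFm a b hab.le
    have := mul_pos hc (sub_pos.2 hab)
    linarith
  have hFc : Continuous F := intervalIntegral.continuous_primitive hgi 0
  have hF0 : F 0 = 0 := intervalIntegral.integral_same
  have hFsurj : Function.Surjective F := by
    intro y
    refine mem_range_of_exists_le_of_exists_ge hFc ⟨-(|y| / c), ?_⟩ ⟨|y| / c, ?_⟩
    · have := hFm (-(|y| / c)) 0 (by simp; positivity)
      rw [hF0, zero_sub, neg_neg, zero_sub, mul_div_cancel₀ _ hc.ne'] at this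
      linarith [neg_abs_le y]
    · have := hFm 0 (|y| / c) (by positivity)
      rw [hF0, sub_zero, sub_zero, mul_div_cancel₀ _ hc.ne'] at this
      linarith [le_abs_self y]
  set E := hFs.orderIsoOfSurjective F hFsurj with hE
  have hEF : ∀ τ, F (E.symm τ) = τ := fun τ => E.apply_symm_apply τ
  have hQl : LipschitzWith (Real.toNNReal c⁻¹) E.symm := by
    have key : ∀ a b, a ≤ b → |E.symm a - E.symm b| ≤ c⁻¹ * |a - b| := by
      intro a b hab
      have h1 := E.symm.monotone hab
      have h2 := hFm _ _ h1
      rw [hEF, hEF] at h2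
      rw [abs_of_nonpos (by linarith), abs_of_nonpos (by linarith), ← div_eq_inv_mul,
        le_div_iff₀ hc]
      linarith
    refine LipschitzWith.of_dist_le_mul fun a b => ?_
    rw [Real.coe_toNNReal _ (inv_nonneg.2 hc.le), Real.dist_eq, Real.dist_eq]
    rcases le_total a b with h | h
    · exact key a b h
    · rw [abs_sub_comm, abs_sub_comm a]; exact key b a h
  refine ⟨E.symm, E.symm.strictMono, E.symm.surjective, ⟨_, hQl⟩, fun τ hτ => ?_⟩
  have := HasDerivAt.of_local_left_inverse hQl.continuous.continuousAt (hFd _ hτ) (fun h0 => by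
    have := hc.trans_le (hb _ hτ).2.1; rw [h0] at this; exact lt_irrefl _ this)
    (Eventually.of_forall hEF)
  rwa [inv_div] at this

variable {D} {ρ k : ℝ}

lemma slideField_eq (hρ : ρ = 1 ∨ ρ = -1) (hk : k = 1 ∨ k = -1) (h : ρ * D.δ = -k) {x : ℝ}
    (hx : x ≠ 0) : D.slideField ρ k (x, 0) = (ρ * (D.slideNum x / D.slideDen x), 0) := by
  have hρ2 := sign_mul_self hρ
  have hk2 := sign_mul_self hk
  have hk0 : k ≠ 0 := by rintro rfl; simp at hk2
  have hd : D.slideDen x ≠ 0 := fun h0 => by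
    have := (mul_pos D.κ_pos (show 0 < x ^ 2 by positivity)).trans_le (D.slideDen_lower hx)
    rw [h0, mul_zero] at this; exact lt_irrefl _ this
  have hρk : ρ = -(k * D.δ) := by linear_combination D.δ * h - ρ * D.δ_sq
  have hden : k * (D.V (x, 0)).2 - ρ * (D.U (x, 0)).2 = k * D.slideDen x := by
    rw [slideDen, hρk]; ring
  rw [slideField, hden]
  refine Prod.ext ?_ ?_
  · simp only [Prod.smul_fst, Prod.fst_sub, smul_eq_mul, slideNum]
    field_simp
  · simp only [Prod.smul_snd, Prod.snd_sub, smul_eq_mul]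
    ring

/-- Since ρ = -kδ, the weights are V₂ and δU₂ divided by their sum, and both have the sign of x. -/
lemma slideField_mem (hk : k = 1 ∨ k = -1) (h : ρ * D.δ = -k) {x : ℝ}
    (hx : x ≠ 0) : D.slideField ρ k (x, 0) ∈ D.fset ρ k (x, 0) := by
  have hk2 := sign_mul_self hk
  have hk0 : k ≠ 0 := by rintro rfl; simp at hk2
  have hx2 : 0 < x ^ 2 := by positivity
  have hV := (mul_pos D.κ_pos hx2).trans_le (D.V_snd x)
  have hU := D.U_snd x hx
  have hE := (mul_pos D.κ_pos hx2).trans_le (D.slideDen_lower hx)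
  have hd : D.slideDen x ≠ 0 := fun h0 => by rw [h0, mul_zero] at hE; exact lt_irrefl _ hE
  have hρk : ρ = -(k * D.δ) := by linear_combination D.δ * h - ρ * D.δ_sq
  have hden : k * (D.V (x, 0)).2 - ρ * (D.U (x, 0)).2 = k * D.slideDen x := by
    rw [slideDen, hρk]; ring
  refine Or.inr (Or.inr ⟨rfl, (D.V (x, 0)).2 / D.slideDen x, D.δ * (D.U (x, 0)).2 / D.slideDen x,
    ?_, ?_, ?_, ?_⟩)
  · rw [← mul_div_mul_left _ _ hx]; exact (div_pos hV hE).le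
  · rw [← mul_div_mul_left _ _ hx]
    exact (div_pos (by linarith) hE).le
  · rw [← add_div]; exact div_self hd
  · rw [slideField, hden, smul_sub, sub_eq_add_neg, ← smul_neg, ← neg_smul]
    simp only [smul_smul]
    congr 1
    · congr 1; field_simp
    · congr 1; rw [hρk]; field_simp

/-! ### The phases of a trajectory -/

section phases

variable {Z W : FoldSaddle} {K : Set ℝ} {γ : ℝ → Plane}

lemma mem_of_inner (hK : K.OrdConnected) (hns : ¬ K.Subsingleton) {S : Set Plane} (hS : IsClosed S)
    (hc : ContinuousOn γ K) (h : ∀ t ∈ inner K, γ t ∈ S) : ∀ t ∈ K, γ t ∈ S := by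
  intro t ht
  have key : ∀ a b, a ∈ K → b ∈ K → a < b → t ∈ Icc a b → γ t ∈ S := by
    intro a b ha hb hab htab
    have h1 : t ∈ closure (Ioo a b) := by rwa [closure_Ioo hab.ne]
    have h2 := (hc t ht).mono ((Ioo_subset_inner ha hb).trans (inner_subset hK))
    have := h2.mem_closure h1 (t := S) fun r hr => h r (Ioo_subset_inner ha hb hr)
    rwa [hS.closure_eq] at this
  obtain ⟨s, hs, hst⟩ : ∃ s ∈ K, s ≠ t := by
    by_contra! hn
    exact hns fun a ha b hb => (hn a ha).trans (hn b hb).symm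
  rcases lt_or_gt_of_ne hst with h' | h'
  · exact key s t hs ht h' ⟨h'.le, le_rfl⟩
  · exact key t s ht hs h' ⟨le_rfl, h'.le⟩

lemma exists_inner (hns : ¬ K.Subsingleton) : (inner K).Nonempty := by
  rw [not_subsingleton_iff] at hns
  obtain ⟨a, ha, b, hb, hab⟩ := hns
  rcases lt_or_gt_of_ne hab with h | h
  · exact ⟨(a + b) / 2, ⟨a, ha, by linarith⟩, b, hb, by linarith⟩
  · exact ⟨(a + b) / 2, ⟨b, hb, by linarith⟩, a, ha, by linarith⟩

lemma Traj.reparam_const (h : Z.Traj ρ k K γ) (hz : ∀ t ∈ inner K, γ t = 0) :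
    W.Reparam ρ k (fun t => conj Z W (γ t)) K := by
  by_cases hs : K.Subsingleton
  · exact Reparam.of_subsingleton hs
  have h0 := mem_of_inner h.1 hs (isClosed_singleton (x := (0 : Plane))) h.continuousOn hz
  refine ⟨K, id, strictMonoOn_id, image_id K, Traj.congr (γ := fun _ => 0) ⟨h.1, fun a _ b _ => ?_,
    Eventually.of_forall fun t _ => ⟨0, ?_, hasDerivAt_const t 0⟩⟩ fun t ht => ?_⟩
  · exact (LipschitzWith.const (0 : Plane)).lipschitzOnWith.absolutelyContinuousOnInterval
  · refine Or.inr (Or.inr ⟨rfl, ?_⟩)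
    rw [W.V_zero, smul_zero]
    exact right_mem_segment _ _ _
  · simp only [Function.comp_apply, id]
    rw [mem_singleton_iff.1 (h0 t ht), conj_zero]

/-- An upper arc lies on one level of H, which `conj` preserves, and that level is one U-orbit. The
clock is ρx, whose order `conj` preserves. -/
lemma Traj.reparam_above (hδ : Z.δ = W.δ) (hρ : ρ = 1 ∨ ρ = -1) (hk : k = 1 ∨ k = -1)
    (h : Z.Traj ρ k K γ) (hy : ∀ t ∈ inner K, 0 < (γ t).2) :
    W.Reparam ρ k (fun t => conj Z W (γ t)) K := by
  by_cases hs : K.Subsingleton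
  · exact Reparam.of_subsingleton hs
  have hy0 := mem_of_inner h.1 hs (isClosed_le continuous_const continuous_snd : IsClosed {z : Plane | 0 ≤ z.2})
    h.continuousOn (fun t ht => (hy t ht).le)
  obtain ⟨t₀, ht₀⟩ := exists_inner hs
  replace ht₀ := inner_subset h.1 ht₀
  have hH : ∀ t ∈ K, Z.H (γ t) = Z.H (γ t₀) := by
    intro t ht
    rcases le_total t t₀ with hle | hle
    · rw [h.flow_above hρ ht ht₀ hle fun r hr => hy r (Ioo_subset_inner ht ht₀ hr), Z.H_flow]
    · rw [h.flow_above hρ ht₀ ht hle fun r hr => hy r (Ioo_subset_inner ht₀ ht hr), Z.H_flow]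
  have hm := h.strictMono_fst hρ hk (fun t ht => (hy t ht).le)
    (fun t ht => ne_zero_of_snd_ne (hy t ht).ne')
  have hm' : StrictMonoOn (fun t => ρ * (conj Z W (γ t)).1) K := by
    intro s hs t ht hst
    have h1 := hm hs ht hst
    dsimp only at h1 ⊢
    rcases hρ with rfl | rfl
    · have := (conj_fst_lt Z W (hy0 s hs) (hy0 t ht)).2 (by linarith); linarith
    · have := (conj_fst_lt Z W (hy0 t ht) (hy0 s hs)).2 (by linarith); linarith
  refine Reparam.of_clock (ζ := fun τ => W.φU (ρ * τ) (conj Z W (γ t₀))) (l := fun z => ρ * z.1)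
    h.1 ?_ hm' ?_ ?_ ?_ ?_
  · exact ((continuous_const.mul continuous_fst).comp (conj Z W).continuous).comp_continuousOn
      h.continuousOn
  · intro s t hst
    have hU := W.U_strictMono (conj Z W (γ t₀))
    dsimp only
    rcases hρ with rfl | rfl
    · have := hU (show 1 * s < 1 * t by linarith); dsimp only at this; linarith
    · have := hU (show -1 * t < -1 * s by linarith); dsimp only at this; linarith
  · intro t ht
    obtain ⟨τ, hτ⟩ := W.exists_time_of_H_eq (z := conj Z W (γ t₀)) (w := conj Z W (γ t)) (by
      rw [H_conj Z W hδ (hy0 t ht), H_conj Z W hδ (hy0 t₀ ht₀), hH t ht])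
    exact ⟨ρ * τ, by rw [← mul_assoc, sign_mul_self hρ, one_mul, hτ]⟩
  · refine fun a b => ac_of_hasDerivAt (W.flowU.deriv_scale ρ _) ?_ a b
    have := W.flowU.continuous_time (conj Z W (γ t₀))
    have h2 := W.U_lip.continuous
    exact (h2.comp (this.comp (continuous_const.mul continuous_id))).const_smul ρ
  · intro τ t ht he
    refine ⟨_, Or.inl ⟨?_, rfl⟩, W.flowU.deriv_scale ρ _ τ⟩
    rw [he]; exact conj_snd_pos Z W (hy t ht)

/-- The arc lies on one level of G, its image lies on one level by `G_conj`, and in a quadrant such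
a level contains one nonzero orbit. The clock is k·qf, which `conj` leaves unchanged. -/
lemma Traj.reparam_quadrant (hk : k = 1 ∨ k = -1) {e : ℝ} (he : e = 1 ∨ e = -1)
    (h : Z.Traj ρ k K γ) (hy : ∀ t ∈ inner K, (γ t).2 < 0) (hx : ∀ t ∈ inner K, 0 ≤ e * (γ t).1) :
    W.Reparam ρ k (fun t => conj Z W (γ t)) K := by
  by_cases hs : K.Subsingleton
  · exact Reparam.of_subsingleton hs
  have hy0 := mem_of_inner h.1 hs (isClosed_le continuous_snd continuous_const : IsClosed {z : Plane | z.2 ≤ 0})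
    h.continuousOn (fun t ht => (hy t ht).le)
  have hx0 := mem_of_inner h.1 hs
    (isClosed_le continuous_const (continuous_const.mul continuous_fst) : IsClosed {z : Plane | 0 ≤ e * z.1})
    h.continuousOn hx
  obtain ⟨t₀, ht₀'⟩ := exists_inner hs
  have ht₀ := inner_subset h.1 ht₀'
  have hz₀ := ne_zero_of_snd_ne (hy t₀ ht₀').ne
  have hfl : ∀ s ∈ K, ∀ t ∈ K, s ≤ t → γ t = Z.φV (k * (t - s)) (γ s) := fun s hs t ht hst =>
    h.flow_below hk hs ht hst fun r hr => hy r (Ioo_subset_inner hs ht hr)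
  have hne : ∀ t ∈ K, γ t ≠ 0 := by
    intro t ht h0
    rcases le_total t t₀ with hle | hle
    · have := hfl t ht t₀ ht₀ hle
      rw [h0, Z.φV_zero] at this
      exact hz₀ this
    · have := hfl t₀ ht₀ t ht hle
      rw [h0] at this
      exact Z.φV_ne_zero hz₀ _ this.symm
  have hG : ∀ t ∈ K, Z.G (γ t) = Z.G (γ t₀) := by
    intro t ht
    rcases le_total t t₀ with hle | hle
    · rw [hfl t ht t₀ ht₀ hle, Z.G_flow]
    · rw [hfl t₀ ht₀ t ht hle, Z.G_flow]
  have hcne : ∀ t ∈ K, conj Z W (γ t) ≠ 0 := fun t ht h0 => hne t ht ((conj_eq_zero Z W).1 h0)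
  refine Reparam.of_clock (ζ := fun τ => W.φV (k * τ) (conj Z W (γ t₀))) (l := fun z => k * qf z)
    h.1 ?_ ?_ (W.kqf_strictMono hk (hcne t₀ ht₀)) ?_ ?_ ?_
  · exact ((continuous_const.mul qf_continuous).comp (conj Z W).continuous).comp_continuousOn
      h.continuousOn
  · intro s hs t ht hst
    dsimp only
    rw [qf_conj Z W (hy0 s hs), qf_conj Z W (hy0 t ht), hfl s hs t ht hst.le]
    have := Z.kqf_strictMono hk (hne s hs) (sub_pos.2 hst)
    simpa only [mul_zero, Z.flowV.zero] using this
  · intro t ht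
    obtain ⟨τ, hτ⟩ := W.exists_time_of_G_eq he (hcne t₀ ht₀) (hcne t ht)
      (conj_fst_nonneg Z W he (hx0 t₀ ht₀)) (conj_snd_nonpos Z W (hy0 t₀ ht₀))
      (conj_fst_nonneg Z W he (hx0 t ht)) (conj_snd_nonpos Z W (hy0 t ht))
      (G_conj Z W he (hx0 t₀ ht₀) (hy0 t₀ ht₀) (hx0 t ht) (hy0 t ht) (hG t ht).symm)
    exact ⟨k * τ, by rw [← mul_assoc, sign_mul_self hk, one_mul, hτ]⟩
  · refine fun a b => ac_of_hasDerivAt (W.flowV.deriv_scale k _) ?_ a b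
    have := W.flowV.continuous_time (conj Z W (γ t₀))
    have h2 := W.V_lip.continuous
    exact (h2.comp (this.comp (continuous_const.mul continuous_id))).const_smul k
  · intro τ t ht he
    refine ⟨_, Or.inr (Or.inl ⟨?_, rfl⟩), W.flowV.deriv_scale k _ τ⟩
    rw [he]; exact conj_snd_neg Z W (hy t ht)

lemma Traj.reparam_below (hk : k = 1 ∨ k = -1) (h : Z.Traj ρ k K γ)
    (hy : ∀ t ∈ inner K, (γ t).2 < 0) : W.Reparam ρ k (fun t => conj Z W (γ t)) K := by
  have hk' : -k = 1 ∨ -k = -1 := by rcases hk with rfl | rfl <;> simp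
  -- k·qf increases along a lower arc, so the arc passes from one quadrant to the other at most
  -- once.
  have hP : {t | t ∈ inner K ∧ 0 ≤ k * qf (γ t)}.OrdConnected := by
    refine ⟨fun s hs t ht r hr => ?_⟩
    have hsK := inner_subset h.1 hs.1
    have htK := inner_subset h.1 ht.1
    have hrK := h.1.out hsK htK hr
    obtain ⟨⟨a, ha, has⟩, -⟩ := hs.1
    obtain ⟨-, b, hb, htb⟩ := ht.1
    refine ⟨⟨⟨a, ha, has.trans_le hr.1⟩, b, hb, lt_of_le_of_lt hr.2 htb⟩, ?_⟩
    have := h.flow_below hk hsK hrK hr.1 fun u hu => hy u (Ioo_subset_inner hsK hrK hu)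
    have hz := ne_zero_of_snd_ne (hy s hs.1).ne
    have h2 := (Z.kqf_strictMono hk hz).monotone (sub_nonneg.2 hr.1)
    simp only [mul_zero, Z.flowV.zero] at h2
    rw [this]
    exact hs.2.trans h2
  refine Reparam.split h.1 hP ?_ ?_
  · intro L hLK hL hi
    refine (h.mono hL hLK).reparam_quadrant hk hk' (fun t ht => hy t (inner_mono hLK ht)) ?_
    intro t ht
    have h1 := (hi ht).2
    have h2 := hy t (inner_mono hLK ht)
    rw [qf] at h1
    nlinarith
  · intro L hLK hL hi
    refine (h.mono hL hLK).reparam_quadrant hk hk (fun t ht => hy t (inner_mono hLK ht)) ?_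
    intro t ht
    have h1 : k * qf (γ t) < 0 := by
      by_contra! hn; exact Set.disjoint_left.1 hi ht ⟨inner_mono hLK ht, hn⟩
    have h2 := hy t (inner_mono hLK ht)
    rw [qf] at h1
    nlinarith

/-- The clock of the sliding motion, for curves on the switching manifold. -/
lemma exists_slide_clock (hρ : ρ = 1 ∨ ρ = -1) (hk : k = 1 ∨ k = -1) (hρδ : ρ * W.δ = -k) :
    ∃ ζ : ℝ → Plane, (∃ C, LipschitzWith C ζ) ∧ StrictMono (fun τ => ρ * (ζ τ).1) ∧
      (∀ z : Plane, z.2 = 0 → ∃ τ, ζ τ = z) ∧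
      ∀ τ, ζ τ ≠ 0 → (∃ x, x ≠ 0 ∧ ζ τ = (x, 0)) ∧ HasDerivAt ζ (W.slideField ρ k (ζ τ)) τ := by
  obtain ⟨Q, hQ, hQs, ⟨C, hQl⟩, hQd⟩ := W.exists_slideCurve
  refine ⟨fun τ => (Q (ρ * τ + 0), 0), ⟨C, ?_⟩, ?_, ?_, ?_⟩
  · refine LipschitzWith.of_dist_le_mul fun a b => ?_
    have := hQl.dist_le_mul (ρ * a + 0) (ρ * b + 0)
    have e : dist (ρ * a + 0) (ρ * b + 0) = dist a b := by
      rw [Real.dist_eq, Real.dist_eq]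
      rcases hρ with rfl | rfl
      · congr 1; ring
      · rw [abs_sub_comm a]; congr 1; ring
    rw [e] at this
    rw [Prod.dist_eq]
    simpa using this
  · intro s t hst
    dsimp only
    rcases hρ with rfl | rfl
    · have := hQ (show 1 * s + 0 < 1 * t + 0 by linarith); linarith
    · have := hQ (show -1 * t + 0 < -1 * s + 0 by linarith); linarith
  · intro z hz
    obtain ⟨q, hq⟩ := hQs z.1
    refine ⟨ρ * q, Prod.ext ?_ hz.symm⟩
    dsimp only
    rw [← mul_assoc, sign_mul_self hρ, one_mul, add_zero, hq]
  · intro τ hτ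
    have hx : Q (ρ * τ + 0) ≠ 0 := fun h0 => hτ (Prod.ext h0 rfl)
    refine ⟨⟨_, hx, rfl⟩, ?_⟩
    rw [slideField_eq hρ hk hρδ hx]
    have h1 := hasDerivAt_comp_affine ρ 0 (hQd _ hx)
    exact h1.prodMk (hasDerivAt_const τ 0)

/-- Only the order of points on the axis matters: the trajectory moves strictly in the direction ρ,
and the sliding curve of `W` runs through the whole axis in that direction. -/
lemma Traj.reparam_slide (hρ : ρ = 1 ∨ ρ = -1) (hk : k = 1 ∨ k = -1)
    (hρδ : ρ * W.δ = -k) (h : Z.Traj ρ k K γ) (hy : ∀ t ∈ inner K, (γ t).2 = 0)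
    (h0 : ∀ t ∈ inner K, γ t ≠ 0) : W.Reparam ρ k (fun t => conj Z W (γ t)) K := by
  by_cases hs : K.Subsingleton
  · exact Reparam.of_subsingleton hs
  have hy0 := mem_of_inner h.1 hs (isClosed_eq continuous_snd continuous_const : IsClosed {z : Plane | z.2 = 0})
    h.continuousOn hy
  have hm := h.strictMono_fst hρ hk (fun t ht => (hy t ht).ge) h0
  obtain ⟨ζ, ⟨C, hζl⟩, hζm, hζs, hζd⟩ := exists_slide_clock (W := W) hρ hk hρδ
  refine Reparam.of_clock (ζ := ζ) (l := fun z => ρ * z.1) h.1 ?_ ?_ hζm ?_ ?_ ?_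
  · exact ((continuous_const.mul continuous_fst).comp (conj Z W).continuous).comp_continuousOn
      h.continuousOn
  · intro s hs t ht hst
    have h1 := hm hs ht hst
    dsimp only at h1 ⊢
    rcases hρ with rfl | rfl
    · have := (conj_fst_lt Z W (hy0 s hs).ge (hy0 t ht).ge).2 (by linarith); linarith
    · have := (conj_fst_lt Z W (hy0 t ht).ge (hy0 s hs).ge).2 (by linarith); linarith
  · exact fun t ht => hζs _ ((conj_snd_eq_zero Z W).2 (hy0 t ht))
  · exact fun a b => hζl.lipschitzOnWith.absolutelyContinuousOnInterval
  · intro τ t ht he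
    have hne : ζ τ ≠ 0 := by
      rw [he]; exact fun e => h0 t ht ((conj_eq_zero Z W).1 e)
    obtain ⟨⟨x, hx, hζx⟩, hd⟩ := hζd τ hne
    refine ⟨_, ?_, hd⟩
    rw [hζx]
    exact slideField_mem hk hρδ hx

/-- A trajectory with y ≥ 0 on the axis where ρδx < 0 stays on it while in that region; one on the
axis where ρδx > 0 has been on it since entering that region. If ρδ = -k, the axis times thus form
two intervals of sliding, and the rest is an upper arc. If not, no inner time is on the axis. -/
lemma Traj.reparam_nonzero (hδ : Z.δ = W.δ) (hρ : ρ = 1 ∨ ρ = -1) (hk : k = 1 ∨ k = -1)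
    (h : Z.Traj ρ k K γ) (hy : ∀ t ∈ inner K, 0 ≤ (γ t).2) (h0 : ∀ t ∈ inner K, γ t ≠ 0) :
    W.Reparam ρ k (fun t => conj Z W (γ t)) K := by
  have hm := h.strictMono_fst hρ hk hy h0
  have hα : ρ * Z.δ = ρ ∨ ρ * Z.δ = -ρ := by
    rcases Z.δ_eq with e | e <;> rw [e] <;> simp
  have hin : ∀ {s t r : ℝ}, s ∈ inner K → t ∈ inner K → r ∈ Icc s t → r ∈ inner K := by
    rintro s t r ⟨⟨a, ha, has⟩, -⟩ ⟨-, b, hb, htb⟩ hr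
    exact ⟨⟨a, ha, has.trans_le hr.1⟩, b, hb, lt_of_le_of_lt hr.2 htb⟩
  have hmono : ∀ {s t r : ℝ}, s ∈ inner K → t ∈ inner K → r ∈ Icc s t →
      ρ * (γ s).1 ≤ ρ * (γ r).1 ∧ ρ * (γ r).1 ≤ ρ * (γ t).1 := by
    intro s t r hs ht hr
    have hrK := inner_subset h.1 (hin hs ht hr)
    exact ⟨hm.monotoneOn (inner_subset h.1 hs) hrK hr.1,
      hm.monotoneOn hrK (inner_subset h.1 ht) hr.2⟩
  by_cases hρδ : ρ * Z.δ = -k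
  · have hP : {t | t ∈ inner K ∧ (γ t).2 = 0 ∧ ρ * Z.δ * (γ t).1 < 0}.OrdConnected := by
      refine ⟨fun s hs t ht r hr => ?_⟩
      have hri := hin hs.1 ht.1 hr
      have hneg : ∀ u ∈ Icc s t, ρ * Z.δ * (γ u).1 < 0 := by
        intro u hu
        obtain ⟨h1, h2⟩ := hmono hs.1 ht.1 hu
        have h3 := hs.2.2
        have h4 := ht.2.2
        rcases hα with e | e <;> rw [e] at h3 h4 ⊢ <;> linarith
      refine ⟨hri, ?_, hneg r hr⟩
      exact h.trapped_forward hρ (inner_subset h.1 hs.1) (inner_subset h.1 hri) hr.1 (hy r hri)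
        hs.2.1 fun u hu => (hneg u ⟨hu.1, hu.2.trans hr.2⟩).le
    have hQ : {t | t ∈ inner K ∧ (γ t).2 = 0 ∧ 0 < ρ * Z.δ * (γ t).1}.OrdConnected := by
      refine ⟨fun s hs t ht r hr => ?_⟩
      have hri := hin hs.1 ht.1 hr
      have hpos : ∀ u ∈ Icc s t, 0 < ρ * Z.δ * (γ u).1 := by
        intro u hu
        obtain ⟨h1, h2⟩ := hmono hs.1 ht.1 hu
        have h3 := hs.2.2
        have h4 := ht.2.2
        rcases hα with e | e <;> rw [e] at h3 h4 ⊢ <;> linarith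
      refine ⟨hri, ?_, hpos r hr⟩
      exact h.trapped_backward hρ (inner_subset h.1 hri) (inner_subset h.1 ht.1) hr.2 (hy r hri)
        ht.2.1 fun u hu => (hpos u ⟨hr.1.trans hu.1, hu.2⟩).le
    refine Reparam.split h.1 hP ?_ fun L hLK hL hi => Reparam.split hL hQ ?_ ?_
    · exact fun L hLK hL hi => (h.mono hL hLK).reparam_slide hρ hk (hδ ▸ hρδ)
        (fun t ht => (hi ht).2.1) (fun t ht => h0 t (inner_mono hLK ht))
    · exact fun M hML hM hj => (h.mono hM (hML.trans hLK)).reparam_slide hρ hk (hδ ▸ hρδ)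
        (fun t ht => (hj ht).2.1) (fun t ht => h0 t (inner_mono (hML.trans hLK) ht))
    · intro M hML hM hj
      refine (h.mono hM (hML.trans hLK)).reparam_above hδ hρ hk fun t ht => ?_
      have htK := inner_mono (hML.trans hLK) ht
      refine lt_of_le_of_ne (hy t htK) fun e => ?_
      rcases lt_trichotomy (ρ * Z.δ * (γ t).1) 0 with hx | hx | hx
      · exact Set.disjoint_left.1 hi (inner_mono hML ht) ⟨htK, e.symm, hx⟩
      · refine h0 t htK (Prod.ext ?_ e.symm)
        have h1 := Z.δ_sq
        have h2 := sign_mul_self hρ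
        change (γ t).1 = 0
        linear_combination ρ * Z.δ * hx - (γ t).1 * ρ * ρ * h1 - (γ t).1 * h2
      · exact Set.disjoint_left.1 hj ht ⟨htK, e.symm, hx⟩
  · refine h.reparam_above hδ hρ hk fun t ht => ?_
    refine lt_of_le_of_ne (hy t ht) fun e => ?_
    -- A time interval spent on the axis away from the origin would contain a tangent velocity,
    -- which exists only if ρδ = -k.
    have hno : ∀ a b, a ∈ inner K → b ∈ inner K → a < b → (∀ r ∈ Icc a b, (γ r).2 = 0) → False := by
      intro a b ha hb hab hr
      obtain ⟨r, hrab, hr2⟩ := exists_mem_of_ae (h.ae_above hy) isOpen_Ioo (nonempty_Ioo.2 hab)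
      have hri := hin ha hb (Ioo_subset_Icc_self hrab)
      obtain ⟨v, hv, -, hv0⟩ := hr2 (inner_subset h.1 hri)
      have e0 := hr r (Ioo_subset_Icc_self hrab)
      exact hρδ ((fset_tangent hρ hk hv e0 (hv0 e0)).2 (h0 r hri)).2
    have hcont : ContinuousAt (fun r => ρ * Z.δ * (γ r).1) t :=
      (h.fst_continuousOn.continuousAt (mem_of_superset (inner_mem_nhds ht)
        (inner_subset h.1))).const_mul _
    rcases lt_trichotomy (ρ * Z.δ * (γ t).1) 0 with hx | hx | hx
    · obtain ⟨ε, hε, hb⟩ := Metric.mem_nhds_iff.1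
        (inter_mem (inner_mem_nhds ht) (hcont.eventually_lt continuousAt_const hx))
      have hmem : ∀ r ∈ Icc t (t + ε / 2), r ∈ inner K ∧ ρ * Z.δ * (γ r).1 < 0 := fun r hr =>
        hb (by rw [Metric.mem_ball, Real.dist_eq, abs_of_nonneg (by linarith [hr.1])]; linarith [hr.2])
      refine hno t (t + ε / 2) ht (hmem _ ⟨by linarith, le_rfl⟩).1 (by linarith) fun r hr => ?_
      exact h.trapped_forward hρ (inner_subset h.1 ht) (inner_subset h.1 (hmem r hr).1) hr.1
        (hy r (hmem r hr).1) e.symm fun u hu => (hmem u ⟨hu.1, hu.2.trans hr.2⟩).2.le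
    · refine h0 t ht (Prod.ext ?_ e.symm)
      have h1 := Z.δ_sq
      have h2 := sign_mul_self hρ
      change (γ t).1 = 0
      linear_combination ρ * Z.δ * hx - (γ t).1 * ρ * ρ * h1 - (γ t).1 * h2
    · obtain ⟨ε, hε, hb⟩ := Metric.mem_nhds_iff.1
        (inter_mem (inner_mem_nhds ht) (continuousAt_const.eventually_lt hcont hx))
      have hmem : ∀ r ∈ Icc (t - ε / 2) t, r ∈ inner K ∧ 0 < ρ * Z.δ * (γ r).1 := fun r hr =>
        hb (by rw [Metric.mem_ball, Real.dist_eq, abs_of_nonpos (by linarith [hr.2])]; linarith [hr.1])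
      refine hno (t - ε / 2) t (hmem _ ⟨le_rfl, by linarith⟩).1 ht (by linarith) fun r hr => ?_
      exact h.trapped_backward hρ (inner_subset h.1 (hmem r hr).1) (inner_subset h.1 ht) hr.2
        (hy r (hmem r hr).1) e.symm fun u hu => (hmem u ⟨hr.1.trans hu.1, hu.2⟩).2.le

/-- The conjugacy sends trajectories to reparametrised trajectories. -/
theorem Traj.reparam (hδ : Z.δ = W.δ) (hρ : ρ = 1 ∨ ρ = -1) (hk : k = 1 ∨ k = -1)
    (h : Z.Traj ρ k K γ) : W.Reparam ρ k (fun t => conj Z W (γ t)) K := by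
  refine Reparam.split h.1 (h.above_ordConnected hk) ?_ ?_
  · intro L hLK hL hi
    have hL' := h.mono hL hLK
    have hy : ∀ t ∈ inner L, 0 ≤ (γ t).2 := fun t ht => (hi ht).2
    refine Reparam.split hL (hL'.zeros_ordConnected hρ hk hy) ?_ ?_
    · exact fun M hML hM hj => (hL'.mono hM hML).reparam_const fun t ht => (hj ht).2
    · exact fun M hML hM hj => (hL'.mono hM hML).reparam_nonzero hδ hρ hk
        (fun t ht => hy t (inner_mono hML ht)) fun t ht e =>
        Set.disjoint_left.1 hj ht ⟨inner_subset hL (inner_mono hML ht), e⟩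
  · intro L hLK hL hi
    refine (h.mono hL hLK).reparam_below hk fun t ht => ?_
    by_contra! hn
    exact Set.disjoint_left.1 hi ht ⟨inner_subset h.1 (inner_mono hLK ht), hn⟩

/-- The conjugacy sends sliding trajectories to reparametrised sliding trajectories. -/
theorem SlideTraj.reparam (hδ : Z.δ = W.δ) (hρ : ρ = 1 ∨ ρ = -1) (hk : k = 1 ∨ k = -1)
    (h : Z.SlideTraj ρ k K γ) : ∃ (J : Set ℝ) (σ : ℝ → ℝ), StrictMonoOn σ J ∧ σ '' J = K ∧
      W.SlideTraj ρ k J (fun t => conj Z W (γ (σ t))) := by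
  have hx0 : ∀ t ∈ K, (γ t).1 ≠ 0 := by
    intro t ht h0
    obtain ⟨h1, h2⟩ := h.2.1 t ht
    rw [show γ t = 0 from Prod.ext h0 h1, Z.V_zero] at h2
    simp at h2
  have hγ : ∀ t ∈ K, γ t = ((γ t).1, 0) := fun t ht => Prod.ext rfl (h.2.1 t ht).1
  have hsgn : ∀ (D : FoldSaddle) {x : ℝ}, x ≠ 0 → 0 < D.δ * (D.U (x, 0)).2 * (D.V (x, 0)).2 := by
    intro D x hx
    have h1 := D.U_snd x hx
    have h2 := (mul_pos D.κ_pos (show 0 < x ^ 2 by positivity)).trans_le (D.V_snd x)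
    have h3 : 0 < x ^ 2 * (D.δ * (D.U (x, 0)).2 * (D.V (x, 0)).2) := by nlinarith
    exact pos_of_mul_pos_right h3 (sq_nonneg x)
  rcases K.eq_empty_or_nonempty with rfl | ⟨t₁, ht₁⟩
  · exact ⟨∅, id, by simp [StrictMonoOn], by simp, ordConnected_empty, by simp, by simp⟩
  -- Off the origin δU₂V₂ > 0 on the axis, so ρU₂ · kV₂ < 0 at a single sliding point fixes the
  -- signs.
  have hρδ : ρ * Z.δ = -k := by
    have h1 := (h.2.1 t₁ ht₁).2
    have h2 := hsgn Z (hx0 t₁ ht₁)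
    rw [← hγ t₁ ht₁] at h2
    rcases Z.δ_eq with e | e <;> rcases hρ with rfl | rfl <;> rcases hk with rfl | rfl <;>
      rw [e] at h2 ⊢ <;> first | (norm_num; done) | (exfalso; linarith)
  have hcond : ∀ {x : ℝ}, x ≠ 0 → ρ * (W.U (x, 0)).2 * (k * (W.V (x, 0)).2) < 0 := by
    intro x hx
    have h2 := hsgn W hx
    have e1 : k = -(ρ * W.δ) := by rw [← hδ]; linarith
    have e2 := sign_mul_self hρ
    rw [e1]
    have : ρ * (W.U (x, 0)).2 * (-(ρ * W.δ) * (W.V (x, 0)).2) =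
      -(W.δ * (W.U (x, 0)).2 * (W.V (x, 0)).2) := by
      linear_combination (-W.δ * (W.U (x, 0)).2 * (W.V (x, 0)).2) * e2
    linarith
  have hc : ContinuousOn γ K := fun t ht => (h.2.2 t ht).continuousWithinAt
  have hm : StrictMonoOn (fun t => ρ * (γ t).1) K := by
    refine strictMonoOn_of_deriv_pos h.1.convex
      (continuousOn_const.mul (continuous_fst.comp_continuousOn hc)) fun t ht => ?_
    have htK := interior_subset ht
    have hd := (h.2.2 t htK).hasDerivAt (mem_interior_iff_mem_nhds.1 ht)
    have hf := slideField_eq hρ hk hρδ (hx0 t htK)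
    rw [← hγ t htK] at hf
    rw [hf] at hd
    rw [((hasDerivAt_fst hd).const_mul ρ).deriv]
    obtain ⟨c, -, C, hb⟩ := Z.slide_ratio_bounds
    have := (hb _ (hx0 t htK)).1
    rw [← mul_assoc, sign_mul_self hρ, one_mul]
    exact this
  obtain ⟨ζ, ⟨C, hζl⟩, hζm, hζs, hζd⟩ := exists_slide_clock (W := W) hρ hk (hδ ▸ hρδ)
  obtain ⟨J, σ, hJ, hσ, hJK, he⟩ := exists_clock (c := fun t => conj Z W (γ t)) (ζ := ζ)
    (l := fun z => ρ * z.1) h.1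
    (((continuous_const.mul continuous_fst).comp (conj Z W).continuous).comp_continuousOn hc)
    (by
      intro s hs t ht hst
      have h1 := hm hs ht hst
      dsimp only at h1 ⊢
      have ys := (h.2.1 s hs).1.ge
      have yt := (h.2.1 t ht).1.ge
      rcases hρ with rfl | rfl
      · have := (conj_fst_lt Z W ys yt).2 (by linarith); linarith
      · have := (conj_fst_lt Z W yt ys).2 (by linarith); linarith) hζm
    (fun t ht => hζs _ ((conj_snd_eq_zero Z W).2 (h.2.1 t ht).1))
  have hJ' : ∀ τ ∈ J, (∃ x, x ≠ 0 ∧ conj Z W (γ (σ τ)) = (x, 0)) ∧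
      HasDerivAt ζ (W.slideField ρ k (conj Z W (γ (σ τ)))) τ := by
    intro τ hτ
    have hτK : σ τ ∈ K := hJK ▸ mem_image_of_mem σ hτ
    have hne : ζ τ ≠ 0 := by
      rw [← he τ hτ]
      intro e
      exact hx0 _ hτK (by rw [(conj_eq_zero Z W).1 e]; rfl)
    have := hζd τ hne
    rwa [← he τ hτ] at this
  refine ⟨J, σ, hσ, hJK, hJ, fun τ hτ => ?_, fun τ hτ => ?_⟩
  · obtain ⟨⟨x, hx, hxe⟩, -⟩ := hJ' τ hτ
    dsimp only
    rw [hxe]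
    exact ⟨rfl, hcond hx⟩
  · exact ((hJ' τ hτ).2.hasDerivWithinAt).congr (fun t ht => he t ht) (he τ hτ)

end phases

end FoldSaddle
/-! ### Winding numbers and orientation -/

/-- The closed curve `L` turns once around the origin in the positive direction. -/
def WindsOnce (L : ℝ → Plane) : Prop :=
  ∃ ρ φ : ℝ → ℝ, Continuous φ ∧ (∀ t, φ (t + 2 * Real.pi) = φ t + 2 * Real.pi) ∧
    ∀ t, 0 < ρ t ∧ L t = ρ t • (Real.cos (φ t), Real.sin (φ t))

/-- The unit circle. -/
noncomputable def circ (t : ℝ) : Plane := (Real.cos t, Real.sin t)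

lemma circ_continuous : Continuous circ := Real.continuous_cos.prodMk Real.continuous_sin

lemma circ_periodic (t : ℝ) : circ (t + 2 * Real.pi) = circ t := by
  simp [circ, Real.cos_add_two_pi, Real.sin_add_two_pi]

lemma norm_circ_le (t : ℝ) : ‖circ t‖ ≤ 1 :=
  max_le (Real.abs_cos_le_one t) (Real.abs_sin_le_one t)

lemma circ_ne_zero (t : ℝ) : circ t ≠ 0 := by
  intro h
  have h1 : Real.cos t = 0 := congrArg Prod.fst h
  have h2 : Real.sin t = 0 := congrArg Prod.snd h
  have := Real.sin_sq_add_cos_sq t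
  rw [h1, h2] at this
  norm_num at this

/-- The complex quotient of L by the direction of L₀ avoids the closed negative real axis, so its
principal argument is continuous and periodic. Adding it to the angle of L₀ gives an angle for L. -/
lemma WindsOnce.of_not_antiparallel {L₀ L : ℝ → Plane} (h : WindsOnce L₀) (hL : Continuous L)
    (hp : ∀ t, L (t + 2 * Real.pi) = L t) (hn : ∀ t, ∀ c : ℝ, 0 ≤ c → L t ≠ -c • L₀ t) :
    WindsOnce L := by
  obtain ⟨ρ, φ, hφ, hφp, hρ⟩ := h
  set r : ℝ → ℂ := fun t =>
    ⟨(L t).1 * Real.cos (φ t) + (L t).2 * Real.sin (φ t),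
      (L t).2 * Real.cos (φ t) - (L t).1 * Real.sin (φ t)⟩ with hr
  have hrc : Continuous r := by
    rw [show r = fun t => (((L t).1 * Real.cos (φ t) + (L t).2 * Real.sin (φ t) : ℝ) : ℂ) +
      (((L t).2 * Real.cos (φ t) - (L t).1 * Real.sin (φ t) : ℝ) : ℂ) * Complex.I by
        funext t; apply Complex.ext <;> simp [hr, -Complex.ofReal_cos, -Complex.ofReal_sin]]
    fun_prop
  have hrp : ∀ t, r (t + 2 * Real.pi) = r t := by
    intro t
    simp only [hr, hp, hφp, Real.cos_add_two_pi, Real.sin_add_two_pi]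
  have hL1 : ∀ t, (L t).1 = (r t).re * Real.cos (φ t) - (r t).im * Real.sin (φ t) := by
    intro t
    simp only [hr]
    linear_combination (-(L t).1) * Real.sin_sq_add_cos_sq (φ t)
  have hL2 : ∀ t, (L t).2 = (r t).re * Real.sin (φ t) + (r t).im * Real.cos (φ t) := by
    intro t
    simp only [hr]
    linear_combination (-(L t).2) * Real.sin_sq_add_cos_sq (φ t)
  have hs : ∀ t, r t ∈ Complex.slitPlane := by
    intro t
    by_contra hns
    rw [Complex.mem_slitPlane_iff, not_or, not_lt, not_not] at hns
    obtain ⟨h1, h2⟩ := hns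
    have hρt := (hρ t).1
    refine hn t (-(r t).re / ρ t) (div_nonneg (by linarith) hρt.le) ?_
    rw [(hρ t).2, smul_smul]
    have e : -(-(r t).re / ρ t) * ρ t = (r t).re := by field_simp
    rw [e]
    refine Prod.ext ?_ ?_
    · rw [hL1, h2]; simp
    · rw [hL2, h2]; simp
  refine ⟨fun t => ‖r t‖, fun t => φ t + Complex.arg (r t), ?_, ?_, ?_⟩
  · refine hφ.add (continuous_iff_continuousAt.2 fun t => ?_)
    exact (Complex.continuousAt_arg (hs t)).comp hrc.continuousAt
  · intro t
    dsimp only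
    rw [hφp, hrp]; ring
  · intro t
    have h0 : r t ≠ 0 := Complex.slitPlane_ne_zero (hs t)
    have h1 : (r t).re = ‖r t‖ * Real.cos (r t).arg := by
      rw [Complex.cos_arg h0]; field_simp
    have h2 : (r t).im = ‖r t‖ * Real.sin (r t).arg := by
      rw [Complex.sin_arg]; field_simp
    refine ⟨norm_pos_iff.2 h0, Prod.ext ?_ ?_⟩
    · simp only [Prod.smul_fst, smul_eq_mul]
      rw [hL1, h1, h2, Real.cos_add]; ring
    · simp only [Prod.smul_snd, smul_eq_mul]
      rw [hL2, h1, h2, Real.sin_add]; ring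

lemma WindsOnce.of_norm_sub_lt {L₀ L : ℝ → Plane} (h : WindsOnce L₀) (hL : Continuous L)
    (hp : ∀ t, L (t + 2 * Real.pi) = L t) (hn : ∀ t, ‖L t - L₀ t‖ < ‖L₀ t‖) :
    WindsOnce L := by
  refine h.of_not_antiparallel hL hp fun t c hc he => ?_
  have := hn t
  rw [he, show -c • L₀ t - L₀ t = (-(c + 1)) • L₀ t by module, norm_smul, Real.norm_eq_abs,
    abs_neg, abs_of_pos (by linarith)] at this
  nlinarith [norm_nonneg (L₀ t)]

/-- A is compared with its complex linear part, proportional to multiplication by w = (a + d) + i(b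
- c), which rotates the circle rigidly. If P denotes w times a unit vector v, then |Av|² = ⟨Av, P⟩ -
det A. Antiparallel vectors would make the right side negative. -/
lemma windsOnce_linear {A : Plane →L[ℝ] Plane}
    (hA : 0 < (A (1, 0)).1 * (A (0, 1)).2 - (A (1, 0)).2 * (A (0, 1)).1) {s : ℝ} (hs : 0 < s) :
    WindsOnce (fun t => A (s • circ t)) := by
  set a := (A (1, 0)).1
  set b := (A (1, 0)).2
  set c := (A (0, 1)).1
  set d := (A (0, 1)).2
  have hAz : ∀ z : Plane, A z = (a * z.1 + c * z.2, b * z.1 + d * z.2) := by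
    intro z
    have : z = z.1 • ((1, 0) : Plane) + z.2 • ((0, 1) : Plane) := by
      refine Prod.ext ?_ ?_ <;> simp
    conv_lhs => rw [this, map_add, map_smul, map_smul]
    refine Prod.ext ?_ ?_
    · simp only [Prod.fst_add, Prod.smul_fst, smul_eq_mul]; ring
    · simp only [Prod.snd_add, Prod.smul_snd, smul_eq_mul]; ring
  set w : ℂ := ⟨a + d, b - c⟩ with hw
  have hw0 : w ≠ 0 := by
    intro h0
    have h1 : a + d = 0 := congrArg Complex.re h0
    have h2 : b - c = 0 := congrArg Complex.im h0
    rw [show d = -a by linarith, show c = b by linarith] at hA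
    nlinarith [sq_nonneg a, sq_nonneg b]
  have h0 : WindsOnce (fun t => ‖w‖ • circ (t + w.arg)) :=
    ⟨fun _ => ‖w‖, fun t => t + w.arg, by fun_prop, fun t => by ring,
      fun t => ⟨norm_pos_iff.2 hw0, rfl⟩⟩
  refine h0.of_not_antiparallel
    (A.continuous.comp (circ_continuous.const_smul s))
    (fun t => by simp only [circ_periodic]) fun t k hk he => ?_
  have h1 : a + d = ‖w‖ * Real.cos w.arg := by
    rw [Complex.cos_arg hw0]; field_simp; rfl
  have h2 : b - c = ‖w‖ * Real.sin w.arg := by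
    rw [Complex.sin_arg]; field_simp; rfl
  rw [hAz] at he
  have e1 := congrArg Prod.fst he
  have e2 := congrArg Prod.snd he
  simp only [circ, Prod.smul_mk, smul_eq_mul, Real.cos_add, Real.sin_add] at e1 e2
  set C := Real.cos t
  set S := Real.sin t
  have hCS : S ^ 2 + C ^ 2 = 1 := Real.sin_sq_add_cos_sq t
  have f1 : s * (a * C + c * S) = -k * ((a + d) * C - (b - c) * S) := by
    rw [h1, h2]; linear_combination e1
  have f2 : s * (b * C + d * S) = -k * ((a + d) * S + (b - c) * C) := by
    rw [h1, h2]; linear_combination e2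
  set P := (a + d) * C - (b - c) * S
  set Q := (a + d) * S + (b - c) * C
  have hPQ : P ^ 2 + Q ^ 2 = (a + d) ^ 2 + (b - c) ^ 2 := by
    linear_combination ((a + d) ^ 2 + (b - c) ^ 2) * hCS
  have hX : (a * C + c * S) * P + (b * C + d * S) * Q = -(k / s) * (P ^ 2 + Q ^ 2) := by
    have : s * ((a * C + c * S) * P + (b * C + d * S) * Q) = -k * (P ^ 2 + Q ^ 2) := by
      linear_combination P * f1 + Q * f2
    field_simp
    linarith
  have hY : (a * C + c * S - P / 2) ^ 2 + (b * C + d * S - Q / 2) ^ 2 =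
      ((a - d) ^ 2 + (b + c) ^ 2) / 4 := by
    linear_combination (((a - d) ^ 2 + (b + c) ^ 2) / 4) * hCS
  have hks : 0 ≤ k / s := div_nonneg hk hs.le
  have hPQn : 0 ≤ P ^ 2 + Q ^ 2 := by positivity
  have hXX : (a * C + c * S) ^ 2 + (b * C + d * S) ^ 2 =
      (a * C + c * S) * P + (b * C + d * S) * Q - (a * d - b * c) := by
    linear_combination hY - hPQ / 4
  have h3 := mul_nonneg hks hPQn
  linarith [sq_nonneg (a * C + c * S), sq_nonneg (b * C + d * S)]

/-- A map that never reverses directions, composed with a map having a derivative of positive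
determinant, preserves the orientation infinitesimally. -/
lemma exists_windsOnce {Φ g : Plane → Plane} {q : Plane} {A : Plane →L[ℝ] Plane} {S N : Set Plane}
    (hA : 0 < (A (1, 0)).1 * (A (0, 1)).2 - (A (1, 0)).2 * (A (0, 1)).1)
    (hinj : Function.Injective A) (hΦ : HasFDerivAt Φ A q) (hN : N ∈ 𝓝 q)
    (hΦc : ContinuousOn Φ N) (hS : MapsTo Φ N S) (hg : ContinuousOn g S)
    (hgn : ∀ z ∈ S, ∀ w ∈ S, z ≠ w → ∀ c : ℝ, 0 ≤ c → g z - g w ≠ -c • (z - w)) :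
    ∃ s : ℝ, 0 < s ∧ (∀ t, q + s • circ t ∈ N) ∧
      WindsOnce (fun t => g (Φ (q + s • circ t)) - g (Φ q)) := by
  obtain ⟨K, hK, hKA⟩ : ∃ K > 0, ∀ v, K * ‖v‖ ≤ ‖A v‖ := by
    obtain ⟨K, hK, h⟩ := A.exists_antilipschitzWith (LinearMap.ker_eq_bot.2 hinj)
    refine ⟨(K : ℝ)⁻¹, by positivity, fun v => ?_⟩
    have := h.le_mul_dist v 0
    rw [map_zero, dist_zero_right, dist_zero_right] at this
    rw [inv_mul_le_iff₀ (by exact_mod_cast hK)]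
    exact this
  have hlit := hΦ.isLittleO.def (half_pos hK)
  obtain ⟨ε, hε, hball⟩ := Metric.mem_nhds_iff.1 (inter_mem hN hlit)
  have hs : 0 < ε / 2 := half_pos hε
  have hsε : ε / 2 < ε := half_lt_self hε
  set s := ε / 2
  have hmem : ∀ t, q + s • circ t ∈ N ∩ {x | ‖Φ x - Φ q - A (x - q)‖ ≤ K / 2 * ‖x - q‖} := by
    intro t
    refine hball ?_
    rw [Metric.mem_ball, dist_eq_norm, add_sub_cancel_left, norm_smul, Real.norm_eq_abs,
      abs_of_pos hs]
    have := mul_le_mul_of_nonneg_left (norm_circ_le t) hs.le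
    linarith
  have hlt : ∀ t, ‖Φ (q + s • circ t) - Φ q - A (s • circ t)‖ < ‖A (s • circ t)‖ := by
    intro t
    have h1 := (hmem t).2
    simp only [mem_ofPred_eq, add_sub_cancel_left] at h1
    have h2 := hKA (s • circ t)
    have h3 : 0 < ‖s • circ t‖ := norm_pos_iff.2 (smul_ne_zero hs.ne' (circ_ne_zero t))
    nlinarith
  have hcirc : Continuous (fun t => q + s • circ t) :=
    continuous_const.add (circ_continuous.const_smul s)
  have hΦL : Continuous (fun t => Φ (q + s • circ t)) :=
    hΦc.comp_continuous hcirc fun t => (hmem t).1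
  have hqN := mem_of_mem_nhds hN
  have hper : ∀ t, q + s • circ (t + 2 * Real.pi) = q + s • circ t := fun t => by
    rw [circ_periodic]
  have h1 : WindsOnce (fun t => Φ (q + s • circ t) - Φ q) :=
    (windsOnce_linear hA hs).of_norm_sub_lt (hΦL.sub continuous_const)
      (fun t => by simp only [hper]) hlt
  refine ⟨s, hs, fun t => (hmem t).1, h1.of_not_antiparallel ?_ (fun t => by simp only [hper])
    fun t c hc => ?_⟩
  · exact (hg.comp_continuous hΦL fun t => hS (hmem t).1).sub continuous_const
  · refine hgn _ (hS (hmem t).1) _ (hS hqN) (fun e => ?_) c hc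
    have := hlt t
    rw [e, sub_self, zero_sub, norm_neg] at this
    exact lt_irrefl _ this

/-- An injective continuous map of a convex open set preserves the orientation everywhere if it
turns one small circle into a curve of winding number one. -/
theorem preservesOrientationAt_of_windsOnce {f : Plane → Plane} {B : Set Plane} (hB : IsOpen B)
    (hBc : Convex ℝ B) (hf : ContinuousOn f B) (hfi : InjOn f B) {q₁ : Plane} {s₁ : ℝ}
    (hs₁ : 0 < s₁) (hq₁ : q₁ ∈ B) (hc₁ : ∀ t, q₁ + s₁ • circ t ∈ B)
    (hw : WindsOnce (fun t => f (q₁ + s₁ • circ t) - f q₁)) :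
    ∀ q ∈ B, PreservesOrientationAt f q := by
  intro q hq
  obtain ⟨ε, hε, hball⟩ := Metric.isOpen_iff.1 hB q hq
  refine ⟨ε, hε, fun s hs hsε => ?_⟩
  have hc : ∀ t, q + s • circ t ∈ B := by
    intro t
    refine hball ?_
    rw [Metric.mem_ball, dist_eq_norm, add_sub_cancel_left, norm_smul, Real.norm_eq_abs,
      abs_of_pos hs]
    have := mul_le_mul_of_nonneg_left (norm_circ_le t) hs.le
    linarith
  -- Centres and radii are interpolated, and convexity keeps the circles in B. Truncating the
  -- parameter defines the homotopy on all of ℝ, which is connected.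
  set cl : ℝ → ℝ := fun l => max 0 (min 1 l) with hcl
  have hclc : Continuous cl := by fun_prop
  have hcl0 : ∀ l, 0 ≤ cl l := fun l => le_max_left _ _
  have hcl1 : ∀ l, cl l ≤ 1 := fun l => max_le zero_le_one (min_le_left _ _)
  set a : ℝ → Plane := fun l => (1 - cl l) • q₁ + cl l • q with ha
  set σ : ℝ → ℝ := fun l => (1 - cl l) * s₁ + cl l * s with hσ
  have hσ0 : ∀ l, 0 < σ l := by
    intro l
    have h0 := hcl0 l
    have h1 := hcl1 l
    simp only [hσ]
    rcases h0.eq_or_lt with e | h0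
    · rw [← e]; linarith
    · nlinarith
  have haB : ∀ l, a l ∈ B := fun l =>
    hBc hq₁ hq (by linarith [hcl1 l]) (hcl0 l) (by ring)
  have hpB : ∀ l t, a l + σ l • circ t ∈ B := by
    intro l t
    have := hBc (hc₁ t) (hc t) (show 0 ≤ 1 - cl l by linarith [hcl1 l]) (hcl0 l) (by ring)
    convert this using 1
    simp only [ha, hσ]; module
  have hac : Continuous a := by fun_prop
  have hσc : Continuous σ := by fun_prop
  set L : ℝ → ℝ → Plane := fun l t => f (a l + σ l • circ t) - f (a l) with hL
  have hLc : Continuous (fun w : ℝ × ℝ => L w.1 w.2) := by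
    refine (hf.comp_continuous ?_ fun w => hpB w.1 w.2).sub
      (hf.comp_continuous (hac.comp continuous_fst) fun w => haB w.1)
    exact (hac.comp continuous_fst).add
      ((hσc.comp continuous_fst).smul (circ_continuous.comp continuous_snd))
  have hLn : ∀ l t, L l t ≠ 0 := by
    intro l t h0
    have := hfi (hpB l t) (haB l) (sub_eq_zero.1 h0)
    rw [add_eq_left] at this
    exact smul_ne_zero (hσ0 l).ne' (circ_ne_zero t) this
  have hLp : ∀ l t, L l (t + 2 * Real.pi) = L l t := fun l t => by
    simp only [hL, circ_periodic]
  have hLt : ∀ l, Continuous (L l) := fun l => hLc.comp (by fun_prop : Continuous fun t : ℝ => (l, t))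
  have hloc : ∀ l₀, ∀ᶠ l in 𝓝 l₀, ∀ t, ‖L l t - L l₀ t‖ < ‖L l₀ t‖ ∧ ‖L l₀ t - L l t‖ < ‖L l t‖ := by
    intro l₀
    -- Uniformity in t comes from compactness of one period.
    have := (isCompact_Icc (a := (0 : ℝ)) (b := 2 * Real.pi)).eventually_forall_of_forall_eventually
      (x₀ := l₀) (P := fun l t => ‖L l t - L l₀ t‖ < ‖L l₀ t‖ ∧ ‖L l₀ t - L l t‖ < ‖L l t‖) (by
        intro t _
        have c1 : Continuous (fun w : ℝ × ℝ => L w.1 w.2 - L l₀ w.2) :=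
          hLc.sub ((hLt l₀).comp continuous_snd)
        have c2 : Continuous (fun w : ℝ × ℝ => L l₀ w.2 - L w.1 w.2) :=
          ((hLt l₀).comp continuous_snd).sub hLc
        have hpos := norm_pos_iff.2 (hLn l₀ t)
        refine (c1.norm.continuousAt.eventually_lt
          ((hLt l₀).comp continuous_snd).norm.continuousAt ?_).and
          (c2.norm.continuousAt.eventually_lt hLc.norm.continuousAt ?_)
        · simpa using hpos
        · simpa using hpos)
    filter_upwards [this] with l hl t
    obtain ⟨u, hu, hut⟩ : ∃ u ∈ Icc 0 (2 * Real.pi), ∀ l, L l t = L l u := by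
      have hpi : 0 < 2 * Real.pi := Real.two_pi_pos
      have hper : ∀ l, Function.Periodic (L l) (2 * Real.pi) := fun l => hLp l
      refine ⟨toIcoMod hpi 0 t, ?_, fun l => ?_⟩
      · have := toIcoMod_mem_Ico hpi 0 t
        rw [zero_add] at this
        exact Ico_subset_Icc_self this
      · rw [toIcoMod]; exact ((hper l).sub_zsmul_eq _).symm
    rw [hut, hut]
    exact hl u hu
  have hiff : IsLocallyConstant (fun l => WindsOnce (L l)) := by
    rw [IsLocallyConstant.iff_eventually_eq]
    intro l₀
    filter_upwards [hloc l₀] with l hl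
    exact propext ⟨fun h => h.of_norm_sub_lt (hLt l₀) (hLp l₀) fun t => (hl t).2,
      fun h => h.of_norm_sub_lt (hLt l) (hLp l) fun t => (hl t).1⟩
  have h01 := hiff.apply_eq_of_preconnectedSpace 0 1
  have e0 : L 0 = fun t => f (q₁ + s₁ • circ t) - f q₁ := by
    funext t; simp [hL, ha, hσ, hcl]
  have e1 : L 1 = fun t => f (q + s • circ t) - f q := by
    funext t; simp [hL, ha, hσ, hcl]
  rw [e0, e1] at h01
  obtain ⟨ρ, φ, h1, h2, h3⟩ := h01.mp hw
  exact ⟨ρ, φ, h1, h2, h3⟩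

open FoldSaddle

/-! ### Directions under the conjugacy on the upper half plane -/

namespace FoldSaddle

lemma conj_snd_lt {Z W : FoldSaddle} (hδ : Z.δ = W.δ) {z w : Plane} (hz : 0 ≤ z.2) (hw : 0 ≤ w.2)
    (h1 : z.1 = w.1) (h2 : z.2 < w.2) : (conj Z W z).2 < (conj Z W w).2 := by
  have e1 : (conj Z W z).1 = (conj Z W w).1 := W.s_strictMono.injective (by
    rw [s_conj Z W hz, s_conj Z W hw, h1])
  refine (W.H_strictMono (conj Z W w).1).lt_iff_lt.1 ?_
  change W.H ((conj Z W w).1, (conj Z W z).2) < W.H (conj Z W w)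
  rw [← e1]
  change W.H (conj Z W z) < _
  rw [H_conj Z W hδ hz, H_conj Z W hδ hw, show z = (w.1, z.2) from Prod.ext h1 rfl]
  exact Z.H_strictMono w.1 h2

/-- `conj` preserves the order of abscissas and, on each vertical, the order of heights. It
therefore cannot send a difference to a nonpositive multiple of itself. -/
lemma conj_not_antiparallel {Z W : FoldSaddle} (hδ : Z.δ = W.δ) {z w : Plane} (hz : 0 ≤ z.2)
    (hw : 0 ≤ w.2) (hzw : z ≠ w) {c : ℝ} (hc : 0 ≤ c) :
    conj Z W z - conj Z W w ≠ -c • (z - w) := by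
  intro h
  have h1 := congrArg Prod.fst h
  have h2 := congrArg Prod.snd h
  simp only [Prod.fst_sub, Prod.snd_sub, Prod.smul_fst, Prod.smul_snd, smul_eq_mul] at h1 h2
  rcases lt_trichotomy z.1 w.1 with hx | hx | hx
  · have := (conj_fst_lt Z W hz hw).2 hx
    nlinarith
  · rcases lt_trichotomy z.2 w.2 with hy | hy | hy
    · have := conj_snd_lt hδ hz hw hx hy
      nlinarith
    · exact hzw (Prod.ext hx hy)
    · have := conj_snd_lt hδ hw hz hx.symm hy
      nlinarith
  · have := (conj_fst_lt Z W hw hz).2 hx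
    nlinarith

end FoldSaddle

/-- The local diffeomorphism `Φ` carries the nonsmooth vector field `Z` to the normal form `D`, with
upper field `ρ U` and lower field `k V`. -/
structure Straightens {r : ℕ∞} (Z : NSVF r) (D : FoldSaddle) (ρ k : ℝ)
    (Φ : OpenPartialHomeomorph Plane Plane) : Prop where
  source_subset : Φ.source ⊆ Z.D
  lip : ∃ K, LipschitzOnWith K Φ Φ.source
  lip_symm : ∃ K, LipschitzOnWith K Φ.symm Φ.target
  snd : ∀ q ∈ Φ.source, (Φ q).2 = Z.f q
  deriv : ∀ q ∈ Φ.source, ∃ A N : Plane →L[ℝ] Plane, HasFDerivAt Φ A q ∧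
    HasFDerivAt Φ.symm N (Φ q) ∧ (∀ v, N (A v) = v) ∧ A (Z.X q) = ρ • D.U (Φ q) ∧
    A (Z.Y q) = k • D.V (Φ q) ∧ (∀ v, (A v).2 = fderiv ℝ Z.f q v) ∧
    0 < (A (1, 0)).1 * (A (0, 1)).2 - (A (1, 0)).2 * (A (0, 1)).1

/-! ### Transport of trajectories and sliding through a straightening chart -/

namespace Straightens

variable {r : ℕ∞} {Z : NSVF r} {D : FoldSaddle} {ρ k : ℝ} {Φ : OpenPartialHomeomorph Plane Plane}
  {S I : Set ℝ} {γ : ℝ → Plane}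

lemma fset_of_filippovSet (h : Straightens Z D ρ k Φ) {q : Plane} (hq : q ∈ Φ.source)
    {A : Plane →L[ℝ] Plane} (hX : A (Z.X q) = ρ • D.U (Φ q)) (hY : A (Z.Y q) = k • D.V (Φ q))
    {v : Plane} (hv : v ∈ Z.filippovSet q) : A v ∈ D.fset ρ k (Φ q) := by
  unfold fset
  simp only [mem_ofPred_eq]
  rw [h.snd q hq]
  rcases hv with ⟨h0, rfl⟩ | ⟨h0, rfl⟩ | ⟨h0, a, b, ha, hb, hab, rfl⟩
  · exact Or.inl ⟨h0, hX⟩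
  · exact Or.inr (Or.inl ⟨h0, hY⟩)
  · refine Or.inr (Or.inr ⟨h0, a, b, ha, hb, hab, ?_⟩)
    rw [map_add, map_smul, map_smul, hX, hY]

lemma exists_filippovSet (h : Straightens Z D ρ k Φ) {q : Plane} (hq : q ∈ Φ.source)
    {A : Plane →L[ℝ] Plane} (hX : A (Z.X q) = ρ • D.U (Φ q)) (hY : A (Z.Y q) = k • D.V (Φ q))
    {v : Plane} (hv : v ∈ D.fset ρ k (Φ q)) : ∃ w ∈ Z.filippovSet q, A w = v := by
  unfold fset at hv
  simp only [mem_ofPred_eq] at hv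
  rw [h.snd q hq] at hv
  rcases hv with ⟨h0, rfl⟩ | ⟨h0, rfl⟩ | ⟨h0, a, b, ha, hb, hab, rfl⟩
  · exact ⟨_, Or.inl ⟨h0, rfl⟩, hX⟩
  · exact ⟨_, Or.inr (Or.inl ⟨h0, rfl⟩), hY⟩
  · exact ⟨_, Or.inr (Or.inr ⟨h0, a, b, ha, hb, hab, rfl⟩), by
      rw [map_add, map_smul, map_smul, hX, hY]⟩

lemma traj (h : Straightens Z D ρ k Φ) {S : Set Plane} (hS : S ⊆ Φ.source)
    (hγ : Z.IsTrajectory S I γ) : D.Traj ρ k I (fun t => Φ (γ t)) := by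
  obtain ⟨hI, hm, hac, hd⟩ := hγ
  obtain ⟨K, hK⟩ := h.lip
  refine ⟨hI, fun a ha b hb => ac_lipschitz_comp hK (hac a ha b hb) fun t ht =>
    hS (hm (hI.uIcc_subset ha hb ht)), ?_⟩
  filter_upwards [hd] with t ht htI
  obtain ⟨v, hv, hdv⟩ := ht htI
  have hq := hS (hm htI)
  obtain ⟨A, N, hA, -, -, hX, hY, -⟩ := h.deriv _ hq
  exact ⟨A v, h.fset_of_filippovSet hq hX hY hv, hA.comp_hasDerivAt t hdv⟩

lemma isTrajectory (h : Straightens Z D ρ k Φ) {S : Set Plane} (hS : S ⊆ Φ.source)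
    (hm : MapsTo γ I S) (hγ : D.Traj ρ k I (fun t => Φ (γ t))) : Z.IsTrajectory S I γ := by
  obtain ⟨hI, hac, hd⟩ := hγ
  obtain ⟨K, hK⟩ := h.lip_symm
  have hinv : ∀ t ∈ I, Φ.symm (Φ (γ t)) = γ t := fun t ht => Φ.left_inv (hS (hm ht))
  refine ⟨hI, hm, fun a ha b hb => ?_, ?_⟩
  · have hab := hI.uIcc_subset ha hb
    exact ac_congr (ac_lipschitz_comp hK (hac a ha b hb) fun t ht =>
      Φ.map_source (hS (hm (hab ht)))) fun t ht => hinv t (hab ht)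
  · filter_upwards [hd, ae_mem_inner I] with t ht hti htI
    obtain ⟨v, hv, hdv⟩ := ht htI
    have hq := hS (hm htI)
    obtain ⟨A, N, -, hN, hNA, hX, hY, -⟩ := h.deriv _ hq
    obtain ⟨w, hw, rfl⟩ := h.exists_filippovSet hq hX hY hv
    refine ⟨w, hw, ?_⟩
    have := hN.comp_hasDerivAt t hdv
    rw [hNA] at this
    refine this.congr_of_eventuallyEq ?_
    filter_upwards [inner_mem_nhds (hti htI)] with s hs
    exact (hinv s (inner_subset hI hs)).symm

lemma map_slidingField {q : Plane} {A : Plane →L[ℝ] Plane} (hX : A (Z.X q) = ρ • D.U (Φ q)) (hY : A (Z.Y q) = k • D.V (Φ q))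
    (hf : ∀ v, (A v).2 = fderiv ℝ Z.f q v) :
    (lieD Z.X Z.f q = ρ * (D.U (Φ q)).2 ∧ lieD Z.Y Z.f q = k * (D.V (Φ q)).2) ∧
    A (Z.slidingField q) = D.slideField ρ k (Φ q) := by
  have h1 : lieD Z.X Z.f q = ρ * (D.U (Φ q)).2 := by
    rw [lieD, ← hf, hX, Prod.smul_snd, smul_eq_mul]
  have h2 : lieD Z.Y Z.f q = k * (D.V (Φ q)).2 := by
    rw [lieD, ← hf, hY, Prod.smul_snd, smul_eq_mul]
  refine ⟨⟨h1, h2⟩, ?_⟩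
  rw [NSVF.slidingField, FoldSaddle.slideField, map_smul, map_sub, map_smul, map_smul, hX, hY,
    h1, h2]

lemma mem_escaping_union_sliding (h : Straightens Z D ρ k Φ) {q : Plane} (hq : q ∈ Φ.source) :
    q ∈ Z.escaping ∪ Z.sliding ↔
      (Φ q).2 = 0 ∧ ρ * (D.U (Φ q)).2 * (k * (D.V (Φ q)).2) < 0 := by
  obtain ⟨A, N, -, -, -, hX, hY, hf, -⟩ := h.deriv _ hq
  obtain ⟨⟨h1, h2⟩, -⟩ := map_slidingField hX hY hf
  rw [← h1, ← h2, h.snd q hq, mul_neg_iff]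
  simp only [NSVF.escaping, NSVF.sliding, NSVF.switching, mem_union, mem_ofPred_eq]
  have := h.source_subset hq
  tauto

lemma slideTraj (h : Straightens Z D ρ k Φ) {S : Set Plane} (hS : S ⊆ Φ.source)
    (hγ : Z.IsSlidingTrajectory S I γ) : D.SlideTraj ρ k I (fun t => Φ (γ t)) := by
  obtain ⟨hI, hm, hm2, hd⟩ := hγ
  refine ⟨hI, fun t ht => (h.mem_escaping_union_sliding (hS (hm ht))).1 (hm2 ht), fun t ht => ?_⟩
  have hq := hS (hm ht)
  obtain ⟨A, N, hA, -, -, hX, hY, hf, -⟩ := h.deriv _ hq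
  have := hA.comp_hasDerivWithinAt t (hd t ht)
  rwa [(map_slidingField hX hY hf).2] at this

lemma isSlidingTrajectory (h : Straightens Z D ρ k Φ) {S : Set Plane} (hS : S ⊆ Φ.source)
    (hm : MapsTo γ I S) (hγ : D.SlideTraj ρ k I (fun t => Φ (γ t))) :
    Z.IsSlidingTrajectory S I γ := by
  obtain ⟨hI, hc, hd⟩ := hγ
  have hinv : ∀ t ∈ I, Φ.symm (Φ (γ t)) = γ t := fun t ht => Φ.left_inv (hS (hm ht))
  refine ⟨hI, hm, fun t ht => (h.mem_escaping_union_sliding (hS (hm ht))).2 (hc t ht),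
    fun t ht => ?_⟩
  have hq := hS (hm ht)
  obtain ⟨A, N, -, hN, hNA, hX, hY, hf, -⟩ := h.deriv _ hq
  have := hN.comp_hasDerivWithinAt t (hd t ht)
  rw [← (map_slidingField hX hY hf).2, hNA] at this
  exact this.congr (fun s hs => (hinv s hs).symm) (hinv t ht).symm

section maps

variable {r' : ℕ∞} {W : NSVF r'} {E : FoldSaddle} {Ψ : OpenPartialHomeomorph Plane Plane}
  {S T : Set Plane} {g : Plane → Plane}

lemma mapsOrbits (hZ : Straightens Z D ρ k Φ) (hW : Straightens W E ρ k Ψ) (hδ : D.δ = E.δ)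
    (hρ : ρ = 1 ∨ ρ = -1) (hk : k = 1 ∨ k = -1) (hS : S ⊆ Φ.source) (hT : T ⊆ Ψ.source)
    (hg : MapsTo g S T) (hgc : ∀ q ∈ S, Ψ (g q) = conj D E (Φ q)) :
    MapsOrbits (Z.IsTrajectory S) (W.IsTrajectory T) g := by
  intro I γ hγ
  obtain ⟨J, σ, hσ, hJ, hT'⟩ := (hZ.traj hS hγ).reparam hδ hρ hk
  have hm : ∀ t ∈ J, γ (σ t) ∈ S := fun t ht => hγ.2.1 (hJ ▸ mem_image_of_mem σ ht)
  exact ⟨J, σ, hσ, hJ, hW.isTrajectory hT (fun t ht => hg (hm t ht))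
    (hT'.congr fun t ht => (hgc _ (hm t ht)).symm)⟩

lemma mapsOrbits_sliding (hZ : Straightens Z D ρ k Φ) (hW : Straightens W E ρ k Ψ)
    (hδ : D.δ = E.δ) (hρ : ρ = 1 ∨ ρ = -1) (hk : k = 1 ∨ k = -1) (hS : S ⊆ Φ.source)
    (hT : T ⊆ Ψ.source) (hg : MapsTo g S T) (hgc : ∀ q ∈ S, Ψ (g q) = conj D E (Φ q)) :
    MapsOrbits (Z.IsSlidingTrajectory S) (W.IsSlidingTrajectory T) g := by
  intro I γ hγ
  obtain ⟨J, σ, hσ, hJ, hJ1, hJ2, hJ3⟩ := (hZ.slideTraj hS hγ).reparam hδ hρ hk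
  have hm : ∀ t ∈ J, γ (σ t) ∈ S := fun t ht => hγ.2.1 (hJ ▸ mem_image_of_mem σ ht)
  have he : ∀ t ∈ J, Ψ ((g ∘ γ ∘ σ) t) = conj D E (Φ (γ (σ t))) := fun t ht => hgc _ (hm t ht)
  refine ⟨J, σ, hσ, hJ, hW.isSlidingTrajectory hT (fun t ht => hg (hm t ht))
    ⟨hJ1, fun t ht => ?_, fun t ht => ?_⟩⟩
  · dsimp only
    rw [he t ht]
    exact hJ2 t ht
  · dsimp only
    rw [he t ht]
    exact (hJ3 t ht).congr he (he t ht)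

/-- Two nonsmooth vector fields with normal forms of the same type are `Σ`-equivalent. -/
theorem sigmaEquivalentAt (hZ : Straightens Z D ρ k Φ)
    (hW : Straightens W E ρ k (OpenPartialHomeomorph.refl Plane)) (hδ : D.δ = E.δ)
    (hρ : ρ = 1 ∨ ρ = -1) (hk : k = 1 ∨ k = -1) {p : Plane} (hp : p ∈ Φ.source) (hp0 : Φ p = 0)
    (hconv : Convex ℝ Φ.source) : SigmaEquivalentAt Z p W 0 := by
  set h : OpenPartialHomeomorph Plane Plane := Φ.transHomeomorph (conj D E) with hh
  have hs : h.source = Φ.source := rfl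
  have hap : ∀ q, h q = conj D E (Φ q) := fun q => rfl
  have hsym : ∀ q, h.symm q = Φ.symm ((conj D E).symm q) := fun q => rfl
  have htar : ∀ q ∈ h.target, conj E D q ∈ Φ.target := fun q hq => hq
  refine ⟨h, hZ.source_subset, fun q _ => hW.source_subset (mem_univ q), hp, ?_, ?_, ?_, ?_, ?_, ?_, ?_⟩
  · rw [hap, hp0, conj_zero]
  -- The test circle is centred strictly above the switching line, where `conj` is known to reverse
  -- no direction; convexity of the source then carries the conclusion everywhere.
  · obtain ⟨ε, hε, hball⟩ := Metric.isOpen_iff.1 Φ.open_target 0 (hp0 ▸ Φ.map_source hp)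
    have hz : ((0, ε / 2) : Plane) ∈ Φ.target := hball (by
      simp [Prod.norm_def, abs_of_pos hε, hε])
    set q := Φ.symm (0, ε / 2)
    have hq : q ∈ Φ.source := Φ.map_target hz
    have hΦq : Φ q = (0, ε / 2) := Φ.right_inv hz
    obtain ⟨A, N, hA, -, hNA, -, -, -, hdet⟩ := hZ.deriv q hq
    have hopen : IsOpen (Φ.source ∩ Φ ⁻¹' {z : Plane | 0 < z.2}) :=
      Φ.isOpen_inter_preimage (isOpen_lt continuous_const continuous_snd)
    obtain ⟨s, hs0, hsN, hw⟩ := exists_windsOnce (g := conj D E) (S := {z : Plane | 0 < z.2}) hdet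
      (Function.LeftInverse.injective hNA) hA
      (hopen.mem_nhds ⟨hq, by simp only [mem_preimage, hΦq, mem_ofPred_eq]; linarith⟩)
      (Φ.continuousOn.mono inter_subset_left) (fun z hz => hz.2) (conj D E).continuous.continuousOn
      (fun z hz w hw hzw c hc => conj_not_antiparallel hδ (le_of_lt hz) (le_of_lt hw) hzw hc)
    exact preservesOrientationAt_of_windsOnce h.open_source hconv h.continuousOn h.injOn hs0 hq
      (fun t => (hsN t).1) hw
  · ext w
    constructor
    · rintro ⟨q, ⟨hq, -, hq0⟩, rfl⟩
      refine ⟨h.map_source hq, hW.source_subset (mem_univ _), ?_⟩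
      rw [← hW.snd _ (mem_univ _)]
      change (conj D E (Φ q)).2 = 0
      rw [conj_snd_eq_zero, hZ.snd q hq, hq0]
    · rintro ⟨hw, -, hw0⟩
      have hq := h.map_target hw
      refine ⟨h.symm w, ⟨hq, hZ.source_subset hq, ?_⟩, h.right_inv hw⟩
      rw [← hW.snd _ (mem_univ _)] at hw0
      change w.2 = 0 at hw0
      rw [← hZ.snd _ hq, ← conj_snd_eq_zero D E, ← hap, h.right_inv hw, hw0]
  · exact hZ.mapsOrbits hW hδ hρ hk subset_rfl (subset_univ _) h.mapsTo fun q _ => rfl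
  · refine hW.mapsOrbits hZ hδ.symm hρ hk (subset_univ _) subset_rfl h.symm.mapsTo fun q hq => ?_
    exact Φ.right_inv (htar q hq)
  · exact hZ.mapsOrbits_sliding hW hδ hρ hk subset_rfl (subset_univ _) h.mapsTo fun q _ => rfl
  · refine hW.mapsOrbits_sliding hZ hδ.symm hρ hk (subset_univ _) subset_rfl h.symm.mapsTo
      fun q hq => ?_
    exact Φ.right_inv (htar q hq)

end maps

end Straightens

/-! ### The models -/

/-- The normal form of the models. -/
noncomputable def modelSaddle (δ : ℝ) (hδ : δ = 1 ∨ δ = -1) : FoldSaddle where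
  U := fun z => (1, δ * z.1)
  V := fun z => (z.2, z.1)
  δ := δ
  K := 1
  κ := 1
  U_lip := LipschitzWith.of_dist_le_mul fun z w => by
    have : |δ| = 1 := by rcases hδ with h | h <;> rw [h] <;> simp
    rw [dist_eq_norm, dist_eq_norm, Prod.mk_sub_mk, Prod.norm_def, sub_self, norm_zero, ← mul_sub,
      norm_mul, Real.norm_eq_abs δ, this, NNReal.coe_one, one_mul, one_mul,
      max_eq_right (norm_nonneg _)]
    exact norm_fst_le (z - w)
  V_lip := LipschitzWith.of_dist_le_mul fun z w => by
    rw [Prod.dist_eq, Prod.dist_eq, max_comm]; simp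
  δ_eq := hδ
  κ_pos := one_pos
  U_fst := fun _ => le_rfl
  U_zero := by simp
  U_snd := fun x hx => by
    have : δ * δ = 1 := by rcases hδ with h | h <;> rw [h] <;> norm_num
    have h2 : 0 < x ^ 2 := by positivity
    calc (0 : ℝ) < x ^ 2 := h2
      _ = δ * x * (δ * x) := by linear_combination (-x ^ 2) * this
  U_far := ⟨1, one_pos, 1, one_pos, fun z => by
    have : δ * δ = 1 := by rcases hδ with h | h <;> rw [h] <;> norm_num
    rw [← mul_assoc, this]
    exact ⟨fun h => by linarith, fun h => by linarith⟩⟩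
  V_zero := rfl
  V_mono := fun z w => le_of_eq (by ring)
  slide := fun x => le_of_eq (by ring)
  slide_le := ⟨1, fun x => by simp⟩

lemma straightens_model (r : ℕ∞) (τ : Kind) {ρ k δ : ℝ} (hδ : δ = 1 ∨ δ = -1)
    (hα : alpha₁ τ = ρ * δ) : Straightens (model r τ ρ k) (modelSaddle δ hδ) ρ k
      (OpenPartialHomeomorph.refl Plane) where
  source_subset := subset_univ _
  lip := ⟨1, LipschitzWith.id.lipschitzOnWith⟩
  lip_symm := ⟨1, LipschitzWith.id.lipschitzOnWith⟩
  snd := fun _ _ => rfl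
  deriv := fun q _ => by
    refine ⟨ContinuousLinearMap.id ℝ Plane, ContinuousLinearMap.id ℝ Plane, hasFDerivAt_id q,
      hasFDerivAt_id _, fun _ => rfl, ?_, ?_, fun v => ?_, ?_⟩
    · refine Prod.ext ?_ ?_
      · simp [model, modelSaddle]
      · simp [model, modelSaddle, hα, mul_assoc]
    · exact Prod.ext rfl rfl
    · simp only [model]
      rw [fderiv_snd]; rfl
    · simp

lemma isVisibleFold_model (r : ℕ∞) (τ : Kind) (ρ k : ℝ) :
    IsVisibleFold (model r τ ρ k).X (model r τ ρ k).f 0 ↔ 0 < alpha₁ τ * ρ := by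
  have h1 : lieD (model r τ ρ k).X (model r τ ρ k).f = fun q => alpha₁ τ * q.1 := by
    funext q
    simp only [lieD, model]
    rw [fderiv_snd]; rfl
  have h2 : HasFDerivAt (fun q : Plane => alpha₁ τ * q.1)
      (alpha₁ τ • ContinuousLinearMap.fst ℝ ℝ ℝ) 0 := hasFDerivAt_fst.const_mul _
  have h3 : lieD (model r τ ρ k).X (lieD (model r τ ρ k).X (model r τ ρ k).f) 0 = alpha₁ τ * ρ := by
    rw [h1, lieD, h2.fderiv]
    simp [model]
  rw [IsVisibleFold, h3, h1]
  simp [model]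

/-! ### Global extension of a local normal form -/

/-- Truncation of a real number to `[-r, r]`. -/
noncomputable def clampR (r x : ℝ) : ℝ := max (-r) (min r x)

lemma abs_clampR_le {r : ℝ} (hr : 0 ≤ r) (x : ℝ) : |clampR r x| ≤ r :=
  abs_le.2 ⟨le_max_left _ _, max_le (by linarith) (min_le_left _ _)⟩

lemma clampR_of_abs_le {r x : ℝ} (h : |x| ≤ r) : clampR r x = x := by
  obtain ⟨h1, h2⟩ := abs_le.1 h
  rw [clampR, min_eq_right h2, max_eq_right h1]

lemma clampR_sub_le (r x y : ℝ) : |clampR r x - clampR r y| ≤ |x - y| := by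
  have h1 := abs_max_sub_max_le_max (-r) (min r x) (-r) (min r y)
  have h2 := abs_min_sub_min_le_max r x r y
  simp only [sub_self, abs_zero] at h1 h2
  rw [max_eq_right (abs_nonneg (min r x - min r y))] at h1
  rw [max_eq_right (abs_nonneg (x - y))] at h2
  exact h1.trans h2

lemma clampR_zero {r : ℝ} (hr : 0 ≤ r) : clampR r 0 = 0 := clampR_of_abs_le (by simpa using hr)

lemma mul_clampR_pos {r x : ℝ} (hr : 0 < r) (hx : x ≠ 0) : 0 < x * clampR r x := by
  rcases lt_or_gt_of_ne hx with h | h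
  · exact mul_pos_of_neg_of_neg h (max_lt (by linarith) (lt_of_le_of_lt (min_le_right _ _) h))
  · exact mul_pos h (lt_max_of_lt_right (lt_min hr h))

lemma norm_sq_le (d : Plane) : ‖d‖ ^ 2 ≤ d.1 ^ 2 + d.2 ^ 2 := by
  rw [Prod.norm_def, Real.norm_eq_abs, Real.norm_eq_abs]
  rcases le_total |d.1| |d.2| with h | h
  · rw [max_eq_right h, sq_abs]; nlinarith [sq_nonneg d.1]
  · rw [max_eq_left h, sq_abs]; nlinarith [sq_nonneg d.2]

set_option maxHeartbeats 2000000 in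
-- Let C be the retraction onto the rectangle |x| ≤ r, |y| ≤ r'. The extensions are U₀ ∘ C and M +
-- (V₀ - M) ∘ C: the first is frozen outside, the second keeps its linear growth. Strict
-- differentiability makes V₀ - M Lipschitz with a small constant c, so the monotonicity of M
-- survives with κ₀ / 2.
theorem exists_foldSaddle {U₀ V₀ : Plane → Plane} {L M : Plane →L[ℝ] Plane}
    (hU : HasStrictFDerivAt U₀ L 0) (hV : HasStrictFDerivAt V₀ M 0) (hU1 : 0 < (U₀ 0).1)
    (hU2 : (U₀ 0).2 = 0) {δ : ℝ} (hδ : δ = 1 ∨ δ = -1) (hL : 0 < δ * (L (1, 0)).2)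
    (hV0 : V₀ 0 = 0) {κ₀ : ℝ} (hκ₀ : 0 < κ₀)
    (hM : ∀ z : Plane, κ₀ * (z.1 ^ 2 + z.2 ^ 2) ≤ z.1 * (M z).2 + z.2 * (M z).1) :
    ∃ D : FoldSaddle, D.δ = δ ∧ ∀ᶠ z in 𝓝 (0 : Plane), D.U z = U₀ z ∧ D.V z = V₀ z := by
  set a := δ * (L (1, 0)).2 with ha
  set u := (U₀ 0).1 with hu
  have hδ1 : |δ| = 1 := by rcases hδ with h | h <;> rw [h] <;> simp
  obtain ⟨c, hc, hc1, hca, hcκ⟩ : ∃ c : ℝ≥0, 0 < c ∧ (c : ℝ) ≤ 1 ∧ (c : ℝ) ≤ a / 4 ∧ (c : ℝ) ≤ κ₀ / 4 := by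
    have h : 0 < min 1 (min (a / 4) (κ₀ / 4)) := by positivity
    refine ⟨Real.toNNReal (min 1 (min (a / 4) (κ₀ / 4))), Real.toNNReal_pos.2 h, ?_⟩
    rw [Real.coe_toNNReal _ h.le]
    exact ⟨min_le_left _ _, (min_le_right _ _).trans (min_le_left _ _),
      (min_le_right _ _).trans (min_le_right _ _)⟩
  obtain ⟨s, hs, hsU⟩ := hU.approximates_deriv_on_nhds (Or.inr hc)
  obtain ⟨t, ht, htV⟩ := hV.approximates_deriv_on_nhds (Or.inr hc)
  have hcont : ∀ᶠ z in 𝓝 (0 : Plane), u / 2 < (U₀ z).1 ∧ (U₀ z).1 < 3 * u / 2 := by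
    have h1 : ContinuousAt (fun z => (U₀ z).1) 0 :=
      continuous_fst.continuousAt.comp hU.continuousAt
    exact (continuousAt_const.eventually_lt h1 (by change u / 2 < u; linarith)).and
      (h1.eventually_lt continuousAt_const (by change u < 3 * u / 2; linarith))
  obtain ⟨ε, hε, hball⟩ := Metric.mem_nhds_iff.1 (inter_mem (inter_mem hs ht) hcont)
  set nL := ‖L‖
  set nM := ‖M‖
  have hnL : 0 ≤ nL := norm_nonneg _
  have hnM : 0 ≤ nM := norm_nonneg _
  -- r makes the cross term x U₂V₁ in `slide` at most κ₀u/16 · x², against a main term of at least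
  -- κ₀u/4 · x².
  obtain ⟨r, hr, hrε, hrb⟩ : ∃ r : ℝ, 0 < r ∧ r < ε ∧ (nL + 1) * r * (nM + 1) ≤ κ₀ * u / 16 := by
    refine ⟨min (ε / 2) (κ₀ * u / 16 / ((nL + 1) * (nM + 1))), by positivity,
      (min_le_left _ _).trans_lt (half_lt_self hε), ?_⟩
    have := min_le_right (ε / 2) (κ₀ * u / 16 / ((nL + 1) * (nM + 1)))
    rw [le_div_iff₀ (by positivity)] at this
    linarith
  -- r' is so small compared with r that on the sides x = ±r the contribution ±a r to δU₂ dominates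
  -- that of y. This yields `U_far`.
  obtain ⟨r', hr', hrr, hrL⟩ : ∃ r' : ℝ, 0 < r' ∧ r' ≤ r ∧ nL * r' ≤ a / 4 * r := by
    refine ⟨min r (a / 4 * r / (nL + 1)), by positivity, min_le_left _ _, ?_⟩
    have := min_le_right r (a / 4 * r / (nL + 1))
    rw [le_div_iff₀ (by positivity)] at this
    have h2 : 0 < min r (a / 4 * r / (nL + 1)) := by positivity
    nlinarith
  set C : Plane → Plane := fun z => (clampR r z.1, clampR r' z.2) with hC
  have hCn : ∀ z, ‖C z‖ ≤ r := fun z =>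
    max_le (abs_clampR_le hr.le _) ((abs_clampR_le hr'.le _).trans hrr)
  have hmem : ∀ z, ‖z‖ ≤ r → z ∈ (s ∩ t) ∩ {z | u / 2 < (U₀ z).1 ∧ (U₀ z).1 < 3 * u / 2} :=
    fun z hz => hball (by rw [mem_ball_zero_iff]; linarith)
  have hCl : ∀ z w, ‖C z - C w‖ ≤ ‖z - w‖ := fun z w =>
    max_le ((clampR_sub_le r z.1 w.1).trans (norm_fst_le (z - w)))
      ((clampR_sub_le r' z.2 w.2).trans (norm_snd_le (z - w)))
  have hUa : ∀ z w : Plane, ‖z‖ ≤ r → ‖w‖ ≤ r → ‖U₀ z - U₀ w - L (z - w)‖ ≤ c * ‖z - w‖ :=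
    fun z w hz hw => hsU z (hmem z hz).1.1 w (hmem w hw).1.1
  have hVa : ∀ z w : Plane, ‖z‖ ≤ r → ‖w‖ ≤ r → ‖V₀ z - V₀ w - M (z - w)‖ ≤ c * ‖z - w‖ :=
    fun z w hz hw => htV z (hmem z hz).1.2 w (hmem w hw).1.2
  have hUl : ∀ z w : Plane, ‖z‖ ≤ r → ‖w‖ ≤ r → ‖U₀ z - U₀ w‖ ≤ (nL + c) * ‖z - w‖ := by
    intro z w hz hw
    have h1 := hUa z w hz hw
    have h2 := L.le_opNorm (z - w)
    have h3 := norm_sub_norm_le (U₀ z - U₀ w) (L (z - w))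
    linarith
  set V : Plane → Plane := fun z => M z + (V₀ (C z) - M (C z)) with hVdef
  have hVd : ∀ z w, ‖V z - V w - M (z - w)‖ ≤ c * ‖z - w‖ := by
    intro z w
    have h1 := hVa (C z) (C w) (hCn z) (hCn w)
    have h2 := mul_le_mul_of_nonneg_left (hCl z w) c.2
    have h3 : V z - V w - M (z - w) = V₀ (C z) - V₀ (C w) - M (C z - C w) := by
      simp only [hVdef, map_sub]; abel
    rw [h3]
    exact h1.trans h2
  have hVl : ∀ z w, ‖V z - V w‖ ≤ (nM + c) * ‖z - w‖ := by
    intro z w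
    have h1 := hVd z w
    have h2 := M.le_opNorm (z - w)
    have h3 := norm_sub_norm_le (V z - V w) (M (z - w))
    linarith
  have hC0 : ∀ x, C (x, 0) = (clampR r x, 0) := fun x => by
    simp only [hC, clampR_zero hr'.le]
  have hV00 : V 0 = 0 := by
    have : C 0 = 0 := Prod.ext (clampR_zero hr.le) (clampR_zero hr'.le)
    simp only [hVdef, this, hV0, map_zero]; simp
  have hVm : ∀ z w : Plane, κ₀ / 2 * ((z.1 - w.1) ^ 2 + (z.2 - w.2) ^ 2) ≤
      (z.1 - w.1) * ((V z).2 - (V w).2) + (z.2 - w.2) * ((V z).1 - (V w).1) := by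
    intro z w
    have h1 := hVd z w
    have h2 := hM (z - w)
    have h3 := norm_sq_le (z - w)
    set d := z - w
    set e := V z - V w - M d with he
    have e1 := (norm_fst_le e).trans h1
    have e2 := (norm_snd_le e).trans h1
    have d1 := norm_fst_le d
    have d2 := norm_snd_le d
    rw [Real.norm_eq_abs] at e1 e2 d1 d2
    have m1 : |d.1 * e.2| ≤ ‖d‖ * (c * ‖d‖) := by
      rw [abs_mul]; exact mul_le_mul d1 e2 (abs_nonneg _) (norm_nonneg _)
    have m2 : |d.2 * e.1| ≤ ‖d‖ * (c * ‖d‖) := by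
      rw [abs_mul]; exact mul_le_mul d2 e1 (abs_nonneg _) (norm_nonneg _)
    have m3 : (c : ℝ) * ‖d‖ ^ 2 ≤ κ₀ / 4 * (d.1 ^ 2 + d.2 ^ 2) :=
      mul_le_mul hcκ h3 (by positivity) (by positivity)
    have k1 := (abs_le.1 m1).1
    have k2 := (abs_le.1 m2).1
    have f1 : (V z).1 - (V w).1 = (M d).1 + e.1 := by simp [he]
    have f2 : (V z).2 - (V w).2 = (M d).2 + e.2 := by simp [he]
    rw [f1, f2]
    change κ₀ / 2 * (d.1 ^ 2 + d.2 ^ 2) ≤ d.1 * _ + d.2 * _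
    nlinarith
  have hnx : ∀ x : ℝ, ‖((x, 0) : Plane)‖ = |x| := fun x => by simp [Prod.norm_def]
  have hLx : ∀ x y : ℝ, |δ * (U₀ (x, y)).2 - a * x| ≤ nL * |y| + c * ‖((x, y) : Plane)‖ ∨
      r < ‖((x, y) : Plane)‖ := by
    intro x y
    by_cases hxy : ‖((x, y) : Plane)‖ ≤ r
    swap
    · exact Or.inr (not_le.1 hxy)
    left
    have h1 := (norm_snd_le _).trans (hUa (x, y) 0 hxy (by simpa using hr.le))
    rw [sub_zero, Prod.snd_sub, Prod.snd_sub, hU2, sub_zero, Real.norm_eq_abs] at h1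
    have h2 : L (x, y) = x • L (1, 0) + L (0, y) := by
      rw [← map_smul, ← map_add]; congr 1; simp
    have h3 : |(L (0, y)).2| ≤ nL * |y| := by
      refine (norm_snd_le _).trans ((L.le_opNorm _).trans ?_)
      simp [Prod.norm_def]
      rfl
    have h4 : δ * (U₀ (x, y)).2 - a * x = δ * ((U₀ (x, y)).2 - (L (x, y)).2) + δ * (L (0, y)).2 := by
      rw [h2, ha, Prod.snd_add, Prod.smul_snd, smul_eq_mul]; ring
    rw [h4]
    refine (abs_add_le _ _).trans ?_
    rw [abs_mul, abs_mul, hδ1, one_mul, one_mul]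
    linarith
  have hK : ∀ z w : Plane, (nL + c) * ‖z - w‖ ≤ (‖L‖₊ + ‖M‖₊ + 1 : ℝ≥0) * ‖z - w‖ ∧
      (nM + c) * ‖z - w‖ ≤ (‖L‖₊ + ‖M‖₊ + 1 : ℝ≥0) * ‖z - w‖ := by
    intro z w
    push_cast
    have := norm_nonneg (z - w)
    constructor
    · exact mul_le_mul_of_nonneg_right (by change nL + c ≤ nL + nM + 1; linarith) this
    · exact mul_le_mul_of_nonneg_right (by change nM + c ≤ nL + nM + 1; linarith) this
  have hU1b : ∀ z, u / 2 < (U₀ (C z)).1 ∧ (U₀ (C z)).1 < 3 * u / 2 := fun z => (hmem _ (hCn z)).2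
  have hU2b : ∀ x : ℝ, |(U₀ (C (x, 0))).2| ≤ (nL + 1) * r := by
    intro x
    have h1 := (norm_snd_le _).trans (hUl (C (x, 0)) 0 (hCn _) (by simpa using hr.le))
    rw [Prod.snd_sub, hU2, sub_zero, sub_zero, Real.norm_eq_abs] at h1
    refine h1.trans (mul_le_mul (by linarith) (hCn _) (norm_nonneg _) (by positivity))
  have hVb : ∀ x : ℝ, ‖V (x, 0)‖ ≤ (nM + 1) * |x| := by
    intro x
    have := hVl (x, 0) 0
    rw [hV00, sub_zero, sub_zero, hnx] at this
    exact this.trans (mul_le_mul_of_nonneg_right (by linarith) (abs_nonneg _))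
  set κ := min (u / 2) (min (κ₀ / 2) (κ₀ * u / 16)) with hκ
  have hκ1 : κ ≤ u / 2 := min_le_left _ _
  have hκ2 : κ ≤ κ₀ / 2 := (min_le_right _ _).trans (min_le_left _ _)
  have hκ3 : κ ≤ κ₀ * u / 16 := (min_le_right _ _).trans (min_le_right _ _)
  have hκpos : 0 < κ := by positivity
  refine ⟨{ U := U₀ ∘ C, V := V, δ := δ, K := ‖L‖₊ + ‖M‖₊ + 1, κ := κ, δ_eq := hδ, κ_pos := hκpos
            U_lip := ?_, V_lip := ?_, U_fst := ?_, U_zero := ?_, U_snd := ?_, U_far := ?_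
            V_zero := hV00, V_mono := ?_, slide := ?_, slide_le := ?_ }, rfl, ?_⟩
  · refine LipschitzWith.of_dist_le_mul fun z w => ?_
    rw [dist_eq_norm, dist_eq_norm]
    refine (hUl _ _ (hCn z) (hCn w)).trans (le_trans ?_ (hK z w).1)
    exact mul_le_mul_of_nonneg_left (hCl z w) (by positivity)
  · refine LipschitzWith.of_dist_le_mul fun z w => ?_
    rw [dist_eq_norm, dist_eq_norm]
    exact (hVl z w).trans (hK z w).2
  · exact fun z => hκ1.trans (hU1b z).1.le
  · change (U₀ (C (0, 0))).2 = 0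
    rw [hC0, clampR_zero hr.le]; exact hU2
  · intro x hx
    change 0 < δ * x * (U₀ (C (x, 0))).2
    rw [hC0]
    have hp := mul_clampR_pos hr hx
    set x' := clampR r x
    have hx' : |x'| ≤ r := abs_clampR_le hr.le x
    have hx0 : x' ≠ 0 := fun h0 => by rw [h0, mul_zero] at hp; exact lt_irrefl _ hp
    rcases hLx x' 0 with h | h
    swap
    · rw [hnx] at h; linarith
    rw [abs_zero, mul_zero, zero_add, hnx] at h
    have h1 : |x' * (δ * (U₀ (x', 0)).2) - a * x' ^ 2| ≤ c * x' ^ 2 := by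
      have : x' * (δ * (U₀ (x', 0)).2) - a * x' ^ 2 = x' * (δ * (U₀ (x', 0)).2 - a * x') := by ring
      rw [this, abs_mul, ← sq_abs x']
      nlinarith [abs_nonneg x']
    have h2 := (abs_le.1 h1).1
    have hx2 : 0 < x' ^ 2 := by positivity
    have h3 : 0 < x' * (δ * (U₀ (x', 0)).2) := by nlinarith
    have h4 : 0 < x' ^ 2 * (δ * x * (U₀ (x', 0)).2) := by
      have := mul_pos hp h3
      linarith
    exact pos_of_mul_pos_right h4 hx2.le
  · refine ⟨r, hr, a * r / (4 * u), by positivity, fun z => ?_⟩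
    have hz := hU1b z
    have hmul : a * r / (4 * u) * (U₀ (C z)).1 ≤ a * r / 2 := by
      rw [div_mul_eq_mul_div, div_le_div_iff₀ (by positivity) two_pos]
      have : 0 < a * r := by positivity
      nlinarith
    have hy : |clampR r' z.2| ≤ r' := abs_clampR_le hr'.le _
    have hest : ∀ x : ℝ, C z = (x, clampR r' z.2) →
        |δ * (U₀ (C z)).2 - a * x| ≤ a / 4 * r + a / 4 * r := by
      intro x hx
      rcases hLx x (clampR r' z.2) with h | h
      swap
      · rw [← hx] at h; linarith [hCn z]
      rw [← hx] at h
      have h1 := mul_le_mul_of_nonneg_left hy hnL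
      have h2 := mul_le_mul hca (hCn z) (norm_nonneg _) (by positivity)
      linarith
    constructor
    · intro h
      have hx : C z = (r, clampR r' z.2) := by
        simp only [hC, clampR, min_eq_left h, max_eq_right (show -r ≤ r by linarith)]
      have := (abs_le.1 (hest r hx)).1
      change a * r / (4 * u) * (U₀ (C z)).1 ≤ δ * (U₀ (C z)).2
      linarith
    · intro h
      have hx : C z = (-r, clampR r' z.2) := by
        simp only [hC, clampR, min_eq_right (show z.1 ≤ r by linarith), max_eq_left h]
      have := (abs_le.1 (hest (-r) hx)).2
      change a * r / (4 * u) * (U₀ (C z)).1 ≤ -(δ * (U₀ (C z)).2)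
      linarith
  · intro z w
    refine le_trans (mul_le_mul_of_nonneg_right hκ2 (by positivity)) (hVm z w)
  · intro x
    change κ * x ^ 2 ≤ x * ((V (x, 0)).2 * (U₀ (C (x, 0))).1 - (U₀ (C (x, 0))).2 * (V (x, 0)).1)
    have h1 := hVm (x, 0) 0
    rw [hV00] at h1
    simp only [Prod.fst_zero, Prod.snd_zero, sub_zero, zero_mul, add_zero] at h1
    have h2 := (hU1b (x, 0)).1
    have h3 := hU2b x
    have h4 := (norm_fst_le _).trans (hVb x)
    rw [Real.norm_eq_abs] at h4
    set U1 := (U₀ (C (x, 0))).1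
    set U2 := (U₀ (C (x, 0))).2
    set V1 := (V (x, 0)).1
    set V2 := (V (x, 0)).2
    have h5 : |x * (U2 * V1)| ≤ κ₀ * u / 16 * x ^ 2 := by
      rw [abs_mul, abs_mul, ← sq_abs x]
      have : |U2| * |V1| ≤ (nL + 1) * r * ((nM + 1) * |x|) :=
        mul_le_mul h3 h4 (abs_nonneg _) (by positivity)
      have h6 := mul_le_mul_of_nonneg_left this (abs_nonneg x)
      have h7 := mul_le_mul_of_nonneg_right hrb (sq_nonneg |x|)
      linarith
    have h6 := (abs_le.1 h5).2
    have hx2 := sq_nonneg x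
    have h7 : κ₀ / 2 * x ^ 2 * (u / 2) ≤ x * V2 * U1 := by
      have : κ₀ / 2 * x ^ 2 ≤ x * V2 := by nlinarith
      exact mul_le_mul this h2.le (by positivity) (by nlinarith)
    have h8 := mul_le_mul_of_nonneg_right hκ3 hx2
    have h9 : 0 ≤ κ₀ * u * x ^ 2 := by positivity
    nlinarith
  · refine ⟨(nM + 1) * (3 * u / 2) + (nL + 1) * r * (nM + 1), fun x => ?_⟩
    change |(V (x, 0)).2 * (U₀ (C (x, 0))).1 - (U₀ (C (x, 0))).2 * (V (x, 0)).1| ≤ _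
    have h2 := hU1b (x, 0)
    have h3 := hU2b x
    have h4 := (norm_fst_le _).trans (hVb x)
    have h5 := (norm_snd_le _).trans (hVb x)
    rw [Real.norm_eq_abs] at h4 h5
    refine (abs_sub _ _).trans ?_
    rw [abs_mul, abs_mul]
    have h6 : |(U₀ (C (x, 0))).1| ≤ 3 * u / 2 := abs_le.2 ⟨by linarith, h2.2.le⟩
    have h7 := mul_le_mul h5 h6 (abs_nonneg _) (by positivity)
    have h8 := mul_le_mul h3 h4 (abs_nonneg _) (by positivity)
    linarith
  · filter_upwards [Metric.ball_mem_nhds (0 : Plane) hr'] with z hz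
    rw [mem_ball_zero_iff] at hz
    have hz1 := (norm_fst_le z).trans hz.le
    have hz2 := (norm_snd_le z).trans hz.le
    have hCz : C z = z :=
      Prod.ext (clampR_of_abs_le (hz1.trans hrr)) (clampR_of_abs_le hz2)
    refine ⟨?_, ?_⟩
    · change U₀ (C z) = U₀ z
      rw [hCz]
    · change M z + (V₀ (C z) - M (C z)) = V₀ z
      rw [hCz]; abel

/-! ### Straightening a fold-saddle -/

/-- Linear coordinates adapted to a saddle whose eigenspaces are transverse to the kernel of a
linear functional. -/
lemma exists_saddle_coordinates {A : Plane →L[ℝ] Plane} {g : Plane →L[ℝ] ℝ} {a b : ℝ} (ha : a < 0)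
    (hb : 0 < b) (hA : Module.End.HasEigenvalue (A : Plane →ₗ[ℝ] Plane) a)
    (hB : Module.End.HasEigenvalue (A : Plane →ₗ[ℝ] Plane) b)
    (hg : ∀ (c : ℝ) (v : Plane),
      Module.End.HasEigenvector (A : Plane →ₗ[ℝ] Plane) c v → g v ≠ 0) :
    ∃ (ξ : Plane →L[ℝ] ℝ) (k κ : ℝ), (k = 1 ∨ k = -1) ∧ 0 < κ ∧
      0 < ξ (1, 0) * g (0, 1) - g (1, 0) * ξ (0, 1) ∧
      ∀ q, κ * (ξ q ^ 2 + g q ^ 2) ≤ ξ q * (k * g (A q)) + g q * (k * ξ (A q)) := by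
  have hnorm : ∀ c, Module.End.HasEigenvalue (A : Plane →ₗ[ℝ] Plane) c →
      ∃ e : Plane, A e = c • e ∧ g e = 1 := by
    intro c hc
    obtain ⟨v, hv⟩ := hc.exists_hasEigenvector
    have h0 := hg c v hv
    have h1 : A v = c • v := hv.apply_eq_smul
    refine ⟨(g v)⁻¹ • v, ?_, ?_⟩
    · rw [map_smul, h1, smul_comm]
    · rw [map_smul, smul_eq_mul, inv_mul_cancel₀ h0]
  obtain ⟨e, hAe, hge⟩ := hnorm a hA
  obtain ⟨d, hAd, hgd⟩ := hnorm b hB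
  have hw : d.1 * e.2 - d.2 * e.1 ≠ 0 := by
    intro h0
    have h1 : e.1 • d = d.1 • e := by
      refine Prod.ext ?_ ?_ <;> simp only [Prod.smul_fst, Prod.smul_snd, smul_eq_mul] <;> linarith
    have h2 : e.2 • d = d.2 • e := by
      refine Prod.ext ?_ ?_ <;> simp only [Prod.smul_fst, Prod.smul_snd, smul_eq_mul] <;> linarith
    have h3 := congrArg g h1
    have h4 := congrArg g h2
    rw [map_smul, map_smul, hge, hgd, smul_eq_mul, smul_eq_mul, mul_one, mul_one] at h3 h4
    have hed : e = d := Prod.ext h3 h4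
    rw [hed, hAd] at hAe
    have h5 := congrArg g hAe
    rw [map_smul, map_smul, hgd, smul_eq_mul, smul_eq_mul] at h5
    linarith
  set w := d.1 * e.2 - d.2 * e.1 with hwdef
  -- k is the sign of w, so that the coordinates (ξ, g) are positively oriented.
  obtain ⟨k, hk, hkw⟩ : ∃ k : ℝ, (k = 1 ∨ k = -1) ∧ 0 < k / w := by
    rcases lt_or_gt_of_ne hw with h | h
    · exact ⟨-1, Or.inr rfl, div_pos_of_neg_of_neg (by norm_num) h⟩
    · exact ⟨1, Or.inl rfl, div_pos one_pos h⟩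
  have hk2 := sign_mul_self hk
  set u : Plane → ℝ := fun q => (q.1 * e.2 - q.2 * e.1) / w with hu
  set v : Plane → ℝ := fun q => (d.1 * q.2 - d.2 * q.1) / w with hv
  have hdec : ∀ q : Plane, q = u q • d + v q • e := by
    intro q
    refine Prod.ext ?_ ?_
    · simp only [Prod.fst_add, Prod.smul_fst, smul_eq_mul, hu, hv]
      field_simp
      rw [hwdef]; ring
    · simp only [Prod.snd_add, Prod.smul_snd, smul_eq_mul, hu, hv]
      field_simp
      rw [hwdef]; ring
  have hgq : ∀ q, g q = u q + v q := by
    intro q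
    conv_lhs => rw [hdec q, map_add, map_smul, map_smul, hge, hgd]
    simp
  have hAq : ∀ q, A q = (b * u q) • d + (a * v q) • e := by
    intro q
    conv_lhs => rw [hdec q, map_add, map_smul, map_smul, hAe, hAd]
    module
  have hgA : ∀ q, g (A q) = b * u q + a * v q := by
    intro q
    rw [hAq, map_add, map_smul, map_smul, hge, hgd]
    simp
  -- For q = u d + v e one has g = u + v and ξ = k(u - v). The quadratic form becomes 2b u² - 2a v²,
  -- and for eigenvalues ±1 the linear map would be exactly k(y, x).
  set ξ : Plane →L[ℝ] ℝ := (k * (e.2 + d.2) / w) • ContinuousLinearMap.fst ℝ ℝ ℝ +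
    (-(k * (e.1 + d.1) / w)) • ContinuousLinearMap.snd ℝ ℝ ℝ with hξ
  have hξq : ∀ q, ξ q = k * (u q - v q) := by
    intro q
    simp only [hξ, hu, hv, add_apply, smul_apply,
      ContinuousLinearMap.coe_fst', ContinuousLinearMap.coe_snd', smul_eq_mul]
    field_simp
    ring
  have hξd : ξ d = k := by
    rw [hξq]
    have h1 : u d = 1 := by simp only [hu]; exact div_self hw
    have h2 : v d = 0 := by simp only [hv]; ring
    rw [h1, h2]; ring
  have hξe : ξ e = -k := by
    rw [hξq]
    have h1 : u e = 0 := by simp only [hu]; ring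
    have h2 : v e = 1 := by simp only [hv]; exact div_self hw
    rw [h1, h2]; ring
  refine ⟨ξ, k, min b (-a), hk, lt_min hb (by linarith), ?_, fun q => ?_⟩
  · have : ξ (1, 0) * g (0, 1) - g (1, 0) * ξ (0, 1) = 2 * (k / w) := by
      rw [hξq, hξq, hgq, hgq]
      simp only [hu, hv]
      field_simp
      rw [hwdef]; ring
    rw [this]; positivity
  · have hξA : ξ (A q) = k * (b * u q - a * v q) := by
      rw [hAq, map_add, map_smul, map_smul, hξd, hξe, smul_eq_mul, smul_eq_mul]; ring
    rw [hξA, hgA, hξq, hgq]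
    have e1 : k * (u q - v q) * (k * (b * u q + a * v q)) +
        (u q + v q) * (k * (k * (b * u q - a * v q))) = 2 * b * u q ^ 2 + 2 * (-a) * v q ^ 2 := by
      linear_combination (2 * b * u q ^ 2 - 2 * a * v q ^ 2) * hk2
    have e2 : (k * (u q - v q)) ^ 2 + (u q + v q) ^ 2 = 2 * u q ^ 2 + 2 * v q ^ 2 := by
      linear_combination (u q - v q) ^ 2 * hk2
    rw [e1, e2]
    have h1 := mul_le_mul_of_nonneg_right (min_le_left b (-a)) (sq_nonneg (u q))
    have h2 := mul_le_mul_of_nonneg_right (min_le_right b (-a)) (sq_nonneg (v q))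
    linarith

lemma injective_prod_of_det {ξ g : Plane →L[ℝ] ℝ}
    (h : 0 < ξ (1, 0) * g (0, 1) - g (1, 0) * ξ (0, 1)) : Function.Injective (ξ.prod g) := by
  rw [injective_iff_map_eq_zero]
  intro v hv
  have h1 : ∀ l : Plane →L[ℝ] ℝ, l v = v.1 * l (1, 0) + v.2 * l (0, 1) := by
    intro l
    have : v = v.1 • ((1, 0) : Plane) + v.2 • ((0, 1) : Plane) := by
      refine Prod.ext ?_ ?_ <;> simp
    conv_lhs => rw [this, map_add, map_smul, map_smul]
    simp
  have e1 : ξ v = 0 := congrArg Prod.fst hv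
  have e2 : g v = 0 := congrArg Prod.snd hv
  rw [h1] at e1 e2
  refine Prod.ext ?_ ?_
  · refine (mul_eq_zero.1 (?_ : (ξ (1, 0) * g (0, 1) - g (1, 0) * ξ (0, 1)) * v.1 = 0)).resolve_left h.ne'
    linear_combination g (0, 1) * e1 - ξ (0, 1) * e2
  · refine (mul_eq_zero.1 (?_ : (ξ (1, 0) * g (0, 1) - g (1, 0) * ξ (0, 1)) * v.2 = 0)).resolve_left h.ne'
    linear_combination ξ (1, 0) * e2 - g (1, 0) * e1

/-- A chart whose second coordinate is a given function and whose first one is affine. -/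
lemma exists_chart {f : Plane → ℝ} {p : Plane} (hf : ContDiffAt ℝ ∞ f p) (hfp : f p = 0)
    {ξ : Plane →L[ℝ] ℝ}
    (hdet : 0 < ξ (1, 0) * fderiv ℝ f p (0, 1) - fderiv ℝ f p (1, 0) * ξ (0, 1)) :
    ∃ Ψ : OpenPartialHomeomorph Plane Plane, p ∈ Ψ.source ∧ (∀ q, Ψ q = (ξ q - ξ p, f q)) ∧
      ContDiffAt ℝ 1 Ψ p ∧ ContDiffAt ℝ 1 Ψ.symm 0 := by
  have hF : ContDiffAt ℝ 1 (fun q => (ξ q - ξ p, f q)) p :=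
    ((ξ.contDiff.contDiffAt).sub contDiffAt_const).prodMk (hf.of_le (by exact_mod_cast le_top))
  set e : Plane ≃L[ℝ] Plane := (LinearEquiv.ofInjectiveEndo
    ((ξ.prod (fderiv ℝ f p) : Plane →L[ℝ] Plane) : Plane →ₗ[ℝ] Plane)
    (injective_prod_of_det hdet)).toContinuousLinearEquiv with he
  have hd : HasFDerivAt (fun q => (ξ q - ξ p, f q)) (e : Plane →L[ℝ] Plane) p := by
    have h1 : (e : Plane →L[ℝ] Plane) = ξ.prod (fderiv ℝ f p) := by
      ext <;> rfl
    rw [h1]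
    exact (ξ.hasFDerivAt.sub_const _).prodMk
      (hf.differentiableAt (by simp)).hasFDerivAt
  refine ⟨hF.toOpenPartialHomeomorph _ hd one_ne_zero,
    hF.mem_toOpenPartialHomeomorph_source hd one_ne_zero, fun q => rfl, hF, ?_⟩
  have h := hF.to_localInverse hd one_ne_zero
  simp only [sub_self, hfp] at h
  exact h

/-- A fold-saddle has a local normal form. -/
lemma exists_straightens {r : ℕ∞} (hr : 1 ≤ r) (Z : NSVF r) (p : Plane) (hZ : IsFoldSaddle Z p) :
    ∃ (ρ k : ℝ) (D : FoldSaddle) (Φ : OpenPartialHomeomorph Plane Plane),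
      (ρ = 1 ∨ ρ = -1) ∧ (k = 1 ∨ k = -1) ∧ Straightens Z D ρ k Φ ∧ p ∈ Φ.source ∧ Φ p = 0 ∧
      Convex ℝ Φ.source ∧ 0 < D.δ * lieD Z.X (lieD Z.X Z.f) p := by
  obtain ⟨hpD, ⟨hfp, hXf, hX2⟩, -, hYp, ⟨a, b, ha, hb, hA, hB⟩, htr⟩ := hZ
  obtain ⟨ξ, k, κ, hk, hκ, hdet, hsaddle⟩ := exists_saddle_coordinates ha hb hA hB htr
  have hnhds : Z.D ∈ 𝓝 p := Z.isOpen_D.mem_nhds hpD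
  have hr1 : (1 : WithTop ℕ∞) ≤ (r : WithTop ℕ∞) := by exact_mod_cast hr
  have hX1 : ContDiffAt ℝ 1 Z.X p := (Z.smooth_X.contDiffAt hnhds).of_le hr1
  have hY1 : ContDiffAt ℝ 1 Z.Y p := (Z.smooth_Y.contDiffAt hnhds).of_le hr1
  have hf : ContDiffAt ℝ ∞ Z.f p := Z.smooth_f.contDiffAt hnhds
  have hdf : ContDiffAt ℝ 1 (fderiv ℝ Z.f) p :=
    hf.fderiv_right (WithTop.coe_le_coe.2 (le_top : (1 + 1 : ℕ∞) ≤ ⊤))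
  obtain ⟨Ψ, hpΨ, hΨ, hΨ1, hΨs⟩ := exists_chart hf hfp hdet
  have hΨp : Ψ p = 0 := by rw [hΨ, hfp, sub_self]; rfl
  have hΨ0 : Ψ.symm 0 = p := by rw [← hΨp]; exact Ψ.left_inv hpΨ
  -- the components of the vector fields in the chart
  have hcomp : ∀ {W : Plane → Plane}, ContDiffAt ℝ 1 W p →
      ContDiffAt ℝ 1 (fun q => (ξ (W q), lieD W Z.f q)) p := fun hW =>
    (ξ.contDiff.contDiffAt.comp p hW).prodMk (hdf.clm_apply hW)
  have hXc := hcomp hX1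
  have hYc := hcomp hY1
  set Xc : Plane → Plane := fun q => (ξ (Z.X q), lieD Z.X Z.f q) with hXcdef
  set Yc : Plane → Plane := fun q => (ξ (Z.Y q), lieD Z.Y Z.f q) with hYcdef
  set T : Plane → Plane →L[ℝ] Plane := fun q => ξ.prod (fderiv ℝ Z.f q) with hT
  have hTΨ : ∀ q ∈ Z.D, HasFDerivAt Ψ (T q) q := by
    intro q hq
    have h1 : (Ψ : Plane → Plane) = fun q => (ξ q - ξ p, Z.f q) := funext hΨ
    rw [h1]
    exact (ξ.hasFDerivAt.sub_const _).prodMk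
      (((Z.smooth_f.contDiffAt (Z.isOpen_D.mem_nhds hq)).differentiableAt (by simp)).hasFDerivAt)
  have hTinj : Function.Injective (T p) := injective_prod_of_det hdet
  have hTsurj : Function.Surjective (T p) :=
    LinearMap.injective_iff_surjective (f := (T p : Plane →ₗ[ℝ] Plane)).1 hTinj
  -- derivatives in the chart
  set N := fderiv ℝ Ψ.symm 0 with hN
  have hNs : HasStrictFDerivAt Ψ.symm N 0 := hΨs.hasStrictFDerivAt one_ne_zero
  have hNT : ∀ v, N (T p v) = v := by
    have h1 : HasFDerivAt (Ψ.symm ∘ Ψ) (N.comp (T p)) p := by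
      have h2 := hNs.hasFDerivAt
      rw [← hΨp] at h2
      exact h2.comp p (hTΨ p hpD)
    have h3 : HasFDerivAt (Ψ.symm ∘ Ψ) (ContinuousLinearMap.id ℝ Plane) p :=
      (hasFDerivAt_id p).congr_of_eventuallyEq (Ψ.eventually_left_inverse hpΨ)
    intro v
    exact congrArg (fun l : Plane →L[ℝ] Plane => l v) (h1.unique h3)
  -- X(p) is tangent to Σ, so ξ(X(p)) = 0 would mean X(p) = 0 and hence X².f(p) = 0.
  have hXp : ξ (Z.X p) ≠ 0 := by
    intro h0
    have h1 : T p (Z.X p) = 0 := Prod.ext h0 hXf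
    have h2 : Z.X p = 0 := hTinj (by rw [h1, map_zero])
    apply hX2
    rw [lieD, h2, map_zero]
  obtain ⟨ρ, hρ, hρX⟩ : ∃ ρ : ℝ, (ρ = 1 ∨ ρ = -1) ∧ 0 < ρ * ξ (Z.X p) := by
    rcases lt_or_gt_of_ne hXp with h | h
    · exact ⟨-1, Or.inr rfl, by linarith⟩
    · exact ⟨1, Or.inl rfl, by linarith⟩
  obtain ⟨δ, hδ, hδX⟩ : ∃ δ : ℝ, (δ = 1 ∨ δ = -1) ∧ 0 < δ * lieD Z.X (lieD Z.X Z.f) p := by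
    rcases lt_or_gt_of_ne hX2 with h | h
    · exact ⟨-1, Or.inr rfl, by linarith⟩
    · exact ⟨1, Or.inl rfl, by linarith⟩
  have hchart : ∀ {G : Plane → Plane} (c : ℝ), ContDiffAt ℝ 1 G p →
      HasStrictFDerivAt (fun z => c • G (Ψ.symm z)) (c • (fderiv ℝ G p).comp N) 0 := by
    intro G c hG
    have h1 := hG.hasStrictFDerivAt one_ne_zero
    rw [← hΨ0] at h1
    have h2 := (h1.comp (0 : Plane) hNs).const_smul c
    rw [hΨ0] at h2
    exact h2
  have hfX : (lieD Z.X Z.f) = fun q => (Xc q).2 := rfl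
  have hL : 0 < δ * ((ρ • (fderiv ℝ Xc p).comp N : Plane →L[ℝ] Plane) (1, 0)).2 := by
    -- The horizontal direction at p is that of X(p). The x-derivative of U₂ is therefore ρ X².f(p)
    -- / ξ(X(p)), which has the sign of X².f(p).
    have h1 : N (1, 0) = (ξ (Z.X p))⁻¹ • Z.X p := by
      have h2 : ((1, 0) : Plane) = T p ((ξ (Z.X p))⁻¹ • Z.X p) := by
        rw [map_smul]
        refine Prod.ext ?_ ?_
        · exact (inv_mul_cancel₀ hXp).symm
        · exact ((congrArg ((ξ (Z.X p))⁻¹ * ·) hXf).trans (mul_zero _)).symm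
      rw [h2, hNT]
    have h3 : (fderiv ℝ Xc p (Z.X p)).2 = lieD Z.X (lieD Z.X Z.f) p := by
      have h4 := (hXc.differentiableAt one_ne_zero).hasFDerivAt.snd
      rw [lieD, hfX, h4.fderiv]
      rfl
    have h5 : ((ρ • (fderiv ℝ Xc p).comp N : Plane →L[ℝ] Plane) (1, 0)).2 =
        ρ * ((ξ (Z.X p))⁻¹ * lieD Z.X (lieD Z.X Z.f) p) := by
      rw [smul_apply, ContinuousLinearMap.comp_apply, h1, map_smul, ← h3]
      rfl
    rw [h5]
    have h6 : 0 < ρ * (ξ (Z.X p))⁻¹ := by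
      have := div_pos hρX (pow_pos (abs_pos.2 hXp) 2)
      rw [sq_abs] at this
      have h7 : ρ * (ξ (Z.X p))⁻¹ = ρ * ξ (Z.X p) / ξ (Z.X p) ^ 2 := by field_simp
      rw [h7]; exact this
    have := mul_pos h6 hδX
    linarith
  have hM : ∀ z : Plane, κ * (z.1 ^ 2 + z.2 ^ 2) ≤
      z.1 * ((k • (fderiv ℝ Yc p).comp N : Plane →L[ℝ] Plane) z).2 +
      z.2 * ((k • (fderiv ℝ Yc p).comp N : Plane →L[ℝ] Plane) z).1 := by
    intro z
    obtain ⟨v, rfl⟩ := hTsurj z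
    have h1 : (k • (fderiv ℝ Yc p).comp N : Plane →L[ℝ] Plane) (T p v) =
        k • (ξ (fderiv ℝ Z.Y p v), fderiv ℝ Z.f p (fderiv ℝ Z.Y p v)) := by
      rw [smul_apply, ContinuousLinearMap.comp_apply, hNT]
      congr 1
      have hY' := (hY1.differentiableAt one_ne_zero).hasFDerivAt
      have h2 : HasFDerivAt Yc _ p := (ξ.hasFDerivAt.comp p hY').prodMk
        ((hdf.differentiableAt one_ne_zero).hasFDerivAt.clm_apply hY')
      rw [h2.fderiv]
      refine Prod.ext rfl ?_
      simp [hYp]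
    rw [h1]
    exact hsaddle v
  obtain ⟨D, hDδ, hD⟩ := exists_foldSaddle (hchart ρ hXc) (hchart k hYc)
    (by rw [hΨ0]; exact hρX) (by rw [hΨ0]; exact (congrArg (ρ * ·) hXf).trans (mul_zero _)) hδ hL
    (by rw [hΨ0]
        have : Yc p = 0 := by
          simp only [hYcdef, lieD, hYp, map_zero]; rfl
        rw [this, smul_zero]) hκ hM
  -- the neighbourhood
  obtain ⟨K₁, S₁, hS₁, hlip₁⟩ := hΨ1.exists_lipschitzOnWith
  obtain ⟨K₂, S₂, hS₂, hlip₂⟩ := hΨs.exists_lipschitzOnWith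
  have htend : Tendsto Ψ (𝓝 p) (𝓝 0) := by
    have := Ψ.continuousAt hpΨ
    rwa [ContinuousAt, hΨp] at this
  have hdetn : ∀ᶠ q in 𝓝 p,
      0 < ξ (1, 0) * fderiv ℝ Z.f q (0, 1) - fderiv ℝ Z.f q (1, 0) * ξ (0, 1) := by
    have h1 : ContinuousAt (fun q => ξ (1, 0) * fderiv ℝ Z.f q (0, 1) -
        fderiv ℝ Z.f q (1, 0) * ξ (0, 1)) p := by
      have h2 : ∀ v, ContinuousAt (fun q => fderiv ℝ Z.f q v) p := fun v =>
        hdf.continuousAt.clm_apply continuousAt_const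
      exact (continuousAt_const.mul (h2 _)).sub ((h2 _).mul continuousAt_const)
    exact h1.eventually_const_lt hdet
  have hall : ∀ᶠ q in 𝓝 p, q ∈ Z.D ∧ q ∈ Ψ.source ∧ q ∈ S₁ ∧ Ψ q ∈ S₂ ∧
      ContDiffAt ℝ 1 Ψ.symm (Ψ q) ∧
      0 < ξ (1, 0) * fderiv ℝ Z.f q (0, 1) - fderiv ℝ Z.f q (1, 0) * ξ (0, 1) ∧
      D.U (Ψ q) = ρ • Xc (Ψ.symm (Ψ q)) ∧ D.V (Ψ q) = k • Yc (Ψ.symm (Ψ q)) := by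
    filter_upwards [hnhds, Ψ.open_source.mem_nhds hpΨ, hS₁, htend hS₂,
      htend.eventually (hΨs.eventually (by simp)), hdetn, htend.eventually hD]
      with q h1 h2 h3 h4 h5 h6 h7
    exact ⟨h1, h2, h3, h4, h5, h6, h7⟩
  -- Restricting to a ball makes the source convex, as the homotopy of circles requires.
  obtain ⟨ε, hε, hball⟩ := Metric.eventually_nhds_iff_ball.1 hall
  have hsrc : (Ψ.restrOpen (Metric.ball p ε) Metric.isOpen_ball).source = Metric.ball p ε := by
    rw [Ψ.restrOpen_source]
    exact inter_eq_right.2 fun q hq => (hball q hq).2.1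
  refine ⟨ρ, k, D, Ψ.restrOpen (Metric.ball p ε) Metric.isOpen_ball, hρ, hk, ?_, ?_, hΨp, ?_, ?_⟩
  · refine ⟨?_, ⟨K₁, ?_⟩, ⟨K₂, ?_⟩, ?_, ?_⟩
    · rw [hsrc]; exact fun q hq => (hball q hq).1
    · rw [hsrc]; exact hlip₁.mono fun q hq => (hball q hq).2.2.1
    · refine hlip₂.mono fun z hz => ?_
      have h1 := (Ψ.restrOpen (Metric.ball p ε) Metric.isOpen_ball).map_target hz
      rw [hsrc] at h1
      have h2 := (hball _ h1).2.2.2.1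
      rwa [show Ψ ((Ψ.restrOpen (Metric.ball p ε) Metric.isOpen_ball).symm z) = z from
        (Ψ.restrOpen (Metric.ball p ε) Metric.isOpen_ball).right_inv hz] at h2
    · intro q _
      exact congrArg Prod.snd (hΨ q)
    · rw [hsrc]
      intro q hq
      obtain ⟨hqD, hqΨ, -, -, hqs, hqdet, hqU, hqV⟩ := hball q hq
      rw [Ψ.left_inv hqΨ] at hqU hqV
      have hN' := (hqs.differentiableAt one_ne_zero).hasFDerivAt
      refine ⟨T q, fderiv ℝ Ψ.symm (Ψ q), hTΨ q hqD, hN', ?_, ?_, ?_, fun v => rfl, hqdet⟩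
      · have h3 : HasFDerivAt (Ψ.symm ∘ Ψ) (ContinuousLinearMap.id ℝ Plane) q :=
          (hasFDerivAt_id q).congr_of_eventuallyEq (Ψ.eventually_left_inverse hqΨ)
        intro v
        exact congrArg (fun l : Plane →L[ℝ] Plane => l v) ((hN'.comp q (hTΨ q hqD)).unique h3)
      · change Xc q = ρ • D.U (Ψ q)
        rw [hqU, smul_smul, sign_mul_self hρ, one_smul]
      · change Yc q = k • D.V (Ψ q)
        rw [hqV, smul_smul, sign_mul_self hk, one_smul]
  · rw [hsrc]; exact Metric.mem_ball_self hε
  · rw [hsrc]; exact convex_ball p ε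
  · rw [hDδ]; exact hδX

end Filippov

/-! ### The normal form theorem -/

theorem lemma1 (r : ℕ∞) (hr : 1 ≤ r) (Z : Filippov.NSVF r) (p : Filippov.Plane)
    (hZ : Filippov.IsFoldSaddle Z p) :
    ∃ (τ : Filippov.Kind) (ρ₁ k₁ : ℝ), (ρ₁ = 1 ∨ ρ₁ = -1) ∧ (k₁ = 1 ∨ k₁ = -1) ∧
      (Filippov.IsVisibleFold Z.X Z.f p ↔
        Filippov.IsVisibleFold (Filippov.model r τ ρ₁ k₁).X (Filippov.model r τ ρ₁ k₁).f 0) ∧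
      Filippov.SigmaEquivalentAt Z p (Filippov.model r τ ρ₁ k₁) 0 := by
  obtain ⟨ρ, k, D, Φ, hρ, hk, hS, hp, hp0, hconv, hδ⟩ := Filippov.exists_straightens hr Z p hZ
  have hρ2 := Filippov.sign_mul_self hρ
  -- The model has upper field ρ(1, δx), so its label is read off from ρδ, and X².f of the model at
  -- the origin is α₁(τ)ρ = δ.
  obtain ⟨τ, hτ⟩ : ∃ τ, Filippov.alpha₁ τ = ρ * D.δ := by
    have h : ρ * D.δ = 1 ∨ ρ * D.δ = -1 := by
      rcases hρ with h | h <;> rcases D.δ_eq with h' | h' <;> rw [h, h'] <;> norm_num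
    rcases h with h | h
    · exact ⟨Filippov.Kind.vis, h.symm⟩
    · exact ⟨Filippov.Kind.inv, h.symm⟩
  refine ⟨τ, ρ, k, hρ, hk, ?_, hS.sigmaEquivalentAt
    (Filippov.straightens_model r τ D.δ_eq hτ) rfl hρ hk hp hp0 hconv⟩
  have h1 : Filippov.alpha₁ τ * ρ = D.δ := by rw [hτ]; linear_combination D.δ * hρ2
  rw [Filippov.isVisibleFold_model, h1]
  constructor
  · intro h
    exact (pos_iff_pos_of_mul_pos hδ).2 h.2.2
  · intro h
    exact ⟨hZ.2.1.1, hZ.2.1.2.1, (pos_iff_pos_of_mul_pos hδ).1 h⟩
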